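/- Let $(M^{2n},\omega)$ be a closed symplectic manifold with a Riemannian metric $g$ compatible with $\omega$ (that is, $g(u,v)=\omega(u,Jv)$ with $J^2=-1$), let $G$ be an abelian Lie group whose Lie algebra $\mathfrak g$ carries an inner product, and let $\pi\colon P\to M$ be a smooth principal $G$-bundle. As $G$ is abelian, the adjoint bundle $\mathrm{Ad}\,P$ is $M\times\mathfrak g$; the curvature $F(A)\in\Omega^2(M,\mathfrak g)$ of a connection $A$ on $P$ is determined by $\pi^*F(A)=dA$, and $d_AB=dB$ for $B\in\Omega^0(M,\mathrm{Ad}\,P)=C^\infty(M,\mathfrak g)$. Write $\|\cdot\|$ for the $L^2$ norm of $\mathfrak g$-valued forms given by $g$ and the inner product, and $F(A)=F_p(A)+\Phi\,\omega$ for the Lefschetz decomposition, where $F_p(A)$ is primitive. A connection $A$ is called Yang–Mills if it is a critical point of $A\mapsto\|F(A)\|^2$, and primitive Yang–Mills if it is a critical point of $A\mapsto\|F_p(A)\|^2$; critical points are taken with respect to all variations $A+t\,\pi^*\eta$ with $\eta\in\Omega^1(M,\mathfrak g)$. The cone Yang–Mills functional is $$S_{cYM}(A,B)=\|F(A)+\omega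 B\|^2+\|d_AB\|^2,$$ and one says that $A+\theta B$ is a critical point of it if $\frac{d}{dt}\big|_{t=0}S_{cYM}(A+t\,\pi^*\eta,\,B+tb)=0$ for all $\eta\in\Omega^1(M,\mathfrak g)$ and $b\in C^\infty(M,\mathfrak g)$. Proposition. If a connection $A$ on $P$ is Yang–Mills but not primitive Yang–Mills, or is primitive Yang–Mills but not Yang–Mills, then there is no $B\in C^\infty(M,\mathfrak g)$ such that $A+\theta B$ is a critical point of the cone Yang–Mills functional. -/

import Mathlib

open scoped Manifold ContDiff Bundle

noncomputable section

namespace ConeYM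

/-! ### Differential forms on manifolds without boundary -/

section Forms

variable {E : Type*} [NormedAddCommGroup E] [NormedSpace ℝ E]
  {M : Type*} [TopologicalSpace M] [ChartedSpace E M]
  {V : Type*} [NormedAddCommGroup V] [NormedSpace ℝ V]

/-- A (not necessarily smooth) `V`-valued differential `k`-form on a manifold `M` modelled on `E`:
an alternating `k`-linear map on every tangent space. -/
abbrev DForm (E : Type*) [NormedAddCommGroup E] [NormedSpace ℝ E]
    (M : Type*) [TopologicalSpace M] [ChartedSpace E M] (k : ℕ)
    (V : Type*) [NormedAddCommGroup V] [NormedSpace ℝ V] : Type _ :=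
  ∀ x : M, TangentSpace 𝓘(ℝ, E) x [⋀^Fin k]→L[ℝ] V

/-- The representative of a form in the chart at `c`: its pullback under the inverse chart. -/
def chartRep {k : ℕ} (c : M) (α : DForm E M k V) (y : E) : E [⋀^Fin k]→L[ℝ] V :=
  (α ((extChartAt 𝓘(ℝ, E) c).symm y)).compContinuousLinearMap
    (mfderiv 𝓘(ℝ, E) 𝓘(ℝ, E) (extChartAt 𝓘(ℝ, E) c).symm y)

/-- A form is smooth if its representatives in the charts are smooth. -/
def SmoothForm {k : ℕ} (α : DForm E M k V) : Prop :=
  ∀ c : M, ContDiffOn ℝ ∞ (chartRep c α) (extChartAt 𝓘(ℝ, E) c).target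

/-- The exterior derivative of a form, at `x` computed in the chart at `x`. -/
def extD {k : ℕ} (α : DForm E M k V) : DForm E M (k + 1) V := fun x =>
  (extDeriv (chartRep x α) (extChartAt 𝓘(ℝ, E) x x)).compContinuousLinearMap
    (mfderiv 𝓘(ℝ, E) 𝓘(ℝ, E) (extChartAt 𝓘(ℝ, E) x) x)

/-- The pullback of a form under a map of manifolds. -/
def pullForm {E' : Type*} [NormedAddCommGroup E'] [NormedSpace ℝ E']
    {N : Type*} [TopologicalSpace N] [ChartedSpace E' N] {k : ℕ}
    (f : N → M) (α : DForm E M k V) : DForm E' N k V := fun p =>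
  (α (f p)).compContinuousLinearMap (mfderiv 𝓘(ℝ, E') 𝓘(ℝ, E) f p)

/-- The differential of a vector-valued function, as a `1`-form. -/
def dFun (B : M → V) : DForm E M 1 V := fun x =>
  ContinuousAlternatingMap.ofSubsingleton ℝ (TangentSpace 𝓘(ℝ, E) x) V (0 : Fin 1)
    (mfderiv 𝓘(ℝ, E) 𝓘(ℝ, V) B x)

/-- The product of a real-valued form `Ω` and a vector-valued function `B`:
`(u₁, …, uₖ) ↦ Ω(u₁, …, uₖ) • B`. -/
def mulFun {k : ℕ} (Ω : DForm E M k ℝ) (B : M → V) : DForm E M k V := fun x =>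
  (ContinuousLinearMap.toSpanSingleton ℝ (B x)).compContinuousAlternatingMap (Ω x)

end Forms

/-! ### Symplectic manifolds with a compatible metric

The manifold `M` has dimension `2 * n` and is modelled on `EuclideanSpace ℝ (Fin (2 * n))`. -/

/-- The model space of dimension `2 * n`. -/
abbrev Model (n : ℕ) : Type := EuclideanSpace ℝ (Fin (2 * n))

section Symplectic

variable {n : ℕ} {M : Type*} [TopologicalSpace M] [ChartedSpace (Model n) M]

/-- Symplectic forms: smooth, closed and nondegenerate `2`-forms. -/
structure IsSymplectic (Ω : DForm (Model n) M 2 ℝ) : Prop where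
  smooth : SmoothForm Ω
  closed : extD Ω = 0
  nondegenerate : ∀ (x : M) (u : TangentSpace 𝓘(ℝ, Model n) x),
    (∀ v : TangentSpace 𝓘(ℝ, Model n) x, Ω x ![u, v] = 0) → u = 0

/-- A smooth Riemannian metric on `M`. -/
abbrev RiemMetric (n : ℕ) (M : Type*) [TopologicalSpace M] [ChartedSpace (Model n) M]
    [IsManifold 𝓘(ℝ, Model n) ∞ M] : Type _ :=
  Bundle.ContMDiffRiemannianMetric 𝓘(ℝ, Model n) ∞ (Model n)
    (fun x : M => TangentSpace 𝓘(ℝ, Model n) x)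

/-- A basis of the tangent space at `x` (the coordinate basis of the preferred chart at `x`). The
pointwise expressions below are the usual ones for an arbitrary basis, and do not depend on it. -/
def frame (x : M) (i : Fin (2 * n)) : TangentSpace 𝓘(ℝ, Model n) x :=
  (EuclideanSpace.single i (1 : ℝ) : Model n)

/-- The matrix `Ω(eᵢ, eⱼ)` of a `2`-form at `x`. -/
def formMatrix (Ω : DForm (Model n) M 2 ℝ) (x : M) : Matrix (Fin (2 * n)) (Fin (2 * n)) ℝ :=
  Matrix.of fun i j => Ω x ![frame x i, frame x j]

variable {V : Type*} [NormedAddCommGroup V] [NormedSpace ℝ V]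

/-- The dual Lefschetz operator on `2`-forms, `Λ α = -½ ∑ᵢⱼ (W⁻¹)ᵢⱼ α(eᵢ, eⱼ)` with
`W = (Ω(eᵢ, eⱼ))`, normalized so that `Λ Ω = n`. It is the adjoint of `f ↦ f Ω`. A `2`-form is
primitive if it is in the kernel of `Λ`. -/
def dualLefschetz (Ω : DForm (Model n) M 2 ℝ) (α : DForm (Model n) M 2 V) (x : M) : V :=
  -((1 / 2 : ℝ) • ∑ i, ∑ j, ((formMatrix Ω x)⁻¹ i j) • α x ![frame x i, frame x j])

/-- The component `Φ` in the Lefschetz decomposition `α = αₚ + Φ Ω` of a `2`-form. -/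
def lefschetzCoeff (Ω : DForm (Model n) M 2 ℝ) (α : DForm (Model n) M 2 V) (x : M) : V :=
  ((n : ℝ)⁻¹) • dualLefschetz Ω α x

/-- The primitive component `αₚ` in the Lefschetz decomposition `α = αₚ + Φ Ω` of a `2`-form. -/
def primitivePart (Ω : DForm (Model n) M 2 ℝ) (α : DForm (Model n) M 2 V) :
    DForm (Model n) M 2 V :=
  α - mulFun Ω (lefschetzCoeff Ω α)

variable [IsManifold 𝓘(ℝ, Model n) ∞ M]

/-- The metric `g` is compatible with `Ω`: `g(u, v) = Ω(u, J v)` with `J² = -1`. (That `J` is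
smooth and preserves `Ω` follows.) -/
def Compatible (Ω : DForm (Model n) M 2 ℝ) (g : RiemMetric n M) : Prop :=
  ∀ x : M, ∃ J : TangentSpace 𝓘(ℝ, Model n) x →L[ℝ] TangentSpace 𝓘(ℝ, Model n) x,
    (∀ u, J (J u) = -u) ∧ ∀ u v, g.inner x u v = Ω x ![u, J v]

/-- The matrix `g(eᵢ, eⱼ)` of the metric at `x`. -/
def metricMatrix (g : RiemMetric n M) (x : M) : Matrix (Fin (2 * n)) (Fin (2 * n)) ℝ :=
  Matrix.of fun i j => g.inner x (frame x i) (frame x j)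

/-- The inner product of two `V`-valued `k`-forms at `x`, given by the metric `g` and a bilinear
form `κ` on `V`:
`(1 / k!) ∑ g^{i₁ j₁} ⋯ g^{iₖ jₖ} κ(α_{i₁ … iₖ}, β_{j₁ … jₖ})`. -/
def formInner (g : RiemMetric n M) (κ : LinearMap.BilinForm ℝ V) {k : ℕ}
    (α β : DForm (Model n) M k V) (x : M) : ℝ :=
  ((k.factorial : ℝ)⁻¹) * ∑ a : Fin k → Fin (2 * n), ∑ b : Fin k → Fin (2 * n),
    (∏ l, (metricMatrix g x)⁻¹ (a l) (b l)) *
      κ (α x fun l => frame x (a l)) (β x fun l => frame x (b l))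

/-- The matrix of the metric in the coordinates of the chart at `c`, at the point with coordinates
`y`. -/
def chartGram (g : RiemMetric n M) (c : M) (y : Model n) : Matrix (Fin (2 * n)) (Fin (2 * n)) ℝ :=
  Matrix.of fun i j =>
    g.inner ((extChartAt 𝓘(ℝ, Model n) c).symm y)
      (mfderiv 𝓘(ℝ, Model n) 𝓘(ℝ, Model n) (extChartAt 𝓘(ℝ, Model n) c).symm y
        (EuclideanSpace.single i (1 : ℝ) : Model n))
      (mfderiv 𝓘(ℝ, Model n) 𝓘(ℝ, Model n) (extChartAt 𝓘(ℝ, Model n) c).symm y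
        (EuclideanSpace.single j (1 : ℝ) : Model n))

variable [MeasurableSpace M]

/-- The measure `√(det gᵢⱼ) dy¹ ⋯ dy²ⁿ` on the domain of the chart at `c`, extended by zero. -/
def chartVolume (g : RiemMetric n M) (c : M) : MeasureTheory.Measure M :=
  MeasureTheory.Measure.map (extChartAt 𝓘(ℝ, Model n) c).symm
    ((MeasureTheory.volume.restrict (extChartAt 𝓘(ℝ, Model n) c).target).withDensity
      fun y => ENNReal.ofReal (Real.sqrt (chartGram g c y).det))

/-- The Riemannian volume measure. The measures `chartVolume g c` agree on the overlaps of the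
chart domains, so that their supremum is the measure which is `√(det gᵢⱼ) dy¹ ⋯ dy²ⁿ` in every
chart. -/
def riemannianVolume (g : RiemMetric n M) : MeasureTheory.Measure M :=
  ⨆ c : M, chartVolume g c

/-- The squared `L²` norm `‖α‖² = ∫_M ⟨α, α⟩ dvol` of a form. -/
def normSq (g : RiemMetric n M) (κ : LinearMap.BilinForm ℝ V) {k : ℕ}
    (α : DForm (Model n) M k V) : ℝ :=
  ∫ x, formInner g κ α α x ∂(riemannianVolume g)

end Symplectic

/-! ### Principal bundles and connections

The Lie algebra of `G` is the tangent space `GroupLieAlgebra 𝓘(ℝ, EG) G` at the identity, whose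
underlying normed space is the model space `EG`. -/

section Principal

variable {E : Type*} [NormedAddCommGroup E] [NormedSpace ℝ E]
  {M : Type*} [TopologicalSpace M] [ChartedSpace E M]
  {EG : Type*} [NormedAddCommGroup EG] [NormedSpace ℝ EG]
  {G : Type*} [TopologicalSpace G] [ChartedSpace EG G] [Group G]
  {EP : Type*} [NormedAddCommGroup EP] [NormedSpace ℝ EP]
  {P : Type*} [TopologicalSpace P] [ChartedSpace EP P] [MulAction (MulOpposite G) P]

/-- `pr : P → M` is a smooth principal `G`-bundle, for the right action
`p · g = MulOpposite.op g • p`. -/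
structure IsPrincipalBundle (E EG G EP : Type*) [NormedAddCommGroup E] [NormedSpace ℝ E]
    {M : Type*} [TopologicalSpace M] [ChartedSpace E M]
    [NormedAddCommGroup EG] [NormedSpace ℝ EG]
    [TopologicalSpace G] [ChartedSpace EG G] [Group G]
    [NormedAddCommGroup EP] [NormedSpace ℝ EP]
    {P : Type*} [TopologicalSpace P] [ChartedSpace EP P] [MulAction (MulOpposite G) P]
    (pr : P → M) : Prop where
  smooth_proj : ContMDiff 𝓘(ℝ, EP) 𝓘(ℝ, E) ∞ pr
  smooth_act : ContMDiff (𝓘(ℝ, EP).prod 𝓘(ℝ, EG)) 𝓘(ℝ, EP) ∞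
    (fun q : P × G => MulOpposite.op q.2 • q.1)
  proj_act : ∀ (p : P) (g : G), pr (MulOpposite.op g • p) = pr p
  locally_trivial : ∀ x : M, ∃ U : Set M, IsOpen U ∧ x ∈ U ∧
    ∃ e : OpenPartialHomeomorph P (M × G),
      e.source = pr ⁻¹' U ∧ e.target = U ×ˢ Set.univ ∧
      ContMDiffOn 𝓘(ℝ, EP) (𝓘(ℝ, E).prod 𝓘(ℝ, EG)) ∞ e e.source ∧
      ContMDiffOn (𝓘(ℝ, E).prod 𝓘(ℝ, EG)) 𝓘(ℝ, EP) ∞ e.symm e.target ∧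
      ∀ p ∈ e.source, (e p).1 = pr p ∧
        ∀ g : G, e (MulOpposite.op g • p) = (pr p, (e p).2 * g)

/-- The adjoint action of `g` on the Lie algebra: the derivative of `h ↦ g h g⁻¹` at `1`. -/
def Ad (EG : Type*) {G : Type*} [NormedAddCommGroup EG] [NormedSpace ℝ EG]
    [TopologicalSpace G] [ChartedSpace EG G] [Group G] (g : G) : EG → EG := fun ξ =>
  mfderiv 𝓘(ℝ, EG) 𝓘(ℝ, EG) (fun h : G => g * h * g⁻¹) 1 ξ

/-- The Lie bracket of the Lie algebra. -/
def lieBr (EG G : Type*) [NormedAddCommGroup EG] [NormedSpace ℝ EG]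
    [TopologicalSpace G] [ChartedSpace EG G] [Group G] (ξ ζ : EG) : EG :=
  Bracket.bracket (L := GroupLieAlgebra 𝓘(ℝ, EG) G) (M := GroupLieAlgebra 𝓘(ℝ, EG) G) ξ ζ

/-- Connections on `P`: smooth Lie algebra valued `1`-forms `A` on `P` with `A(ξ*) = ξ` for the
fundamental vector fields `ξ*`, and `R_g^* A = Ad(g⁻¹) A`. -/
structure IsConnection (EG G : Type*) [NormedAddCommGroup EG] [NormedSpace ℝ EG]
    [TopologicalSpace G] [ChartedSpace EG G] [Group G]
    {EP : Type*} [NormedAddCommGroup EP] [NormedSpace ℝ EP]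
    {P : Type*} [TopologicalSpace P] [ChartedSpace EP P] [MulAction (MulOpposite G) P]
    (A : DForm EP P 1 EG) : Prop where
  smooth : SmoothForm A
  vertical : ∀ (p : P) (ξ : EG),
    A p ![(mfderiv 𝓘(ℝ, EG) 𝓘(ℝ, EP) (fun g : G => MulOpposite.op g • p) 1 ξ : EP)] = ξ
  equivariant : ∀ (p : P) (g : G) (v : TangentSpace 𝓘(ℝ, EP) p),
    A (MulOpposite.op g • p)
        ![mfderiv 𝓘(ℝ, EP) 𝓘(ℝ, EP) (fun q : P => MulOpposite.op g • q) p v] =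
      Ad EG g⁻¹ (A p ![v])

/-- `F` is the curvature of `A`, as a form on the base: `pr^* F = dA + ½ [A ∧ A]`. Here `G` is
abelian, so that the adjoint bundle is `M × 𝔤` and forms with values in it are `𝔤`-valued forms. -/
def IsCurvature (G : Type*) [TopologicalSpace G] [ChartedSpace EG G] [CommGroup G]
    (pr : P → M) (A : DForm EP P 1 EG) (F : DForm E M 2 EG) : Prop :=
  ∀ (p : P) (u v : TangentSpace 𝓘(ℝ, EP) p),
    pullForm pr F p ![u, v] = extD A p ![u, v] + lieBr EG G (A p ![u]) (A p ![v])

open Classical in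
/-- The curvature `F(A)` of a connection. -/
def curvature (G : Type*) [TopologicalSpace G] [ChartedSpace EG G] [CommGroup G]
    (pr : P → M) (A : DForm EP P 1 EG) : DForm E M 2 EG :=
  if h : ∃ F : DForm E M 2 EG, IsCurvature G pr A F then h.choose else 0

end Principal

/-! ### The functionals and their critical points -/

section Functionals

variable {n : ℕ} {M : Type*} [TopologicalSpace M] [ChartedSpace (Model n) M]
  [IsManifold 𝓘(ℝ, Model n) ∞ M] [MeasurableSpace M]
  {EG : Type*} [NormedAddCommGroup EG] [NormedSpace ℝ EG]
  (G : Type*) [TopologicalSpace G] [ChartedSpace EG G] [CommGroup G]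
  {EP : Type*} [NormedAddCommGroup EP] [NormedSpace ℝ EP]
  {P : Type*} [TopologicalSpace P] [ChartedSpace EP P]

/-- The Yang-Mills functional `‖F(A)‖²`. -/
def yangMills (g : RiemMetric n M) (κ : LinearMap.BilinForm ℝ EG) (pr : P → M)
    (A : DForm EP P 1 EG) : ℝ :=
  normSq g κ (curvature G pr A)

/-- The primitive Yang-Mills functional `‖Fₚ(A)‖²`. -/
def primitiveYangMills (Ω : DForm (Model n) M 2 ℝ) (g : RiemMetric n M)
    (κ : LinearMap.BilinForm ℝ EG) (pr : P → M) (A : DForm EP P 1 EG) : ℝ :=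
  normSq g κ (primitivePart Ω (curvature G pr A))

/-- The cone Yang-Mills functional `‖F(A) + Ω B‖² + ‖d_A B‖²`. As `G` is abelian, `B` is a
`𝔤`-valued function on `M`, and `d_A B = dB`. -/
def coneYangMills (Ω : DForm (Model n) M 2 ℝ) (g : RiemMetric n M)
    (κ : LinearMap.BilinForm ℝ EG) (pr : P → M) (A : DForm EP P 1 EG) (B : M → EG) : ℝ :=
  normSq g κ (curvature G pr A + mulFun Ω B) + normSq g κ (dFun (E := Model n) B)

/-- `A` is a critical point of a functional `S` on connections: the derivative of `S` vanishes in
the direction of every smooth `𝔤`-valued `1`-form `η` on `M`. The space of connections is an affine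
space over these forms, by `(A, η) ↦ A + pr^* η`. -/
def IsCriticalConnection (pr : P → M) (S : DForm EP P 1 EG → ℝ) (A : DForm EP P 1 EG) : Prop :=
  ∀ η : DForm (Model n) M 1 EG, SmoothForm η →
    HasDerivAt (fun t : ℝ => S (A + t • pullForm pr η)) 0 0

/-- `A` is a Yang-Mills connection. -/
def IsYangMills (g : RiemMetric n M) (κ : LinearMap.BilinForm ℝ EG) (pr : P → M)
    (A : DForm EP P 1 EG) : Prop :=
  IsCriticalConnection (n := n) pr (yangMills G g κ pr) A

/-- `A` is a primitive Yang-Mills connection. -/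
def IsPrimitiveYangMills (Ω : DForm (Model n) M 2 ℝ) (g : RiemMetric n M)
    (κ : LinearMap.BilinForm ℝ EG) (pr : P → M) (A : DForm EP P 1 EG) : Prop :=
  IsCriticalConnection (n := n) pr (primitiveYangMills G Ω g κ pr) A

/-- `A + θ B` is a critical point of the cone Yang-Mills functional. -/
def IsConeCritical (Ω : DForm (Model n) M 2 ℝ) (g : RiemMetric n M)
    (κ : LinearMap.BilinForm ℝ EG) (pr : P → M) (A : DForm EP P 1 EG) (B : M → EG) : Prop :=
  ∀ (η : DForm (Model n) M 1 EG) (b : M → EG), SmoothForm η →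
    ContMDiff 𝓘(ℝ, Model n) 𝓘(ℝ, EG) ∞ b →
    HasDerivAt (fun t : ℝ => coneYangMills G Ω g κ pr (A + t • pullForm pr η) (B + t • b)) 0 0

end Functionals

end ConeYM

end

open ConeYM

/-!
Let `F` be the curvature of `A`, let `Φ = Λ F / n` be the coefficient of its Lefschetz
decomposition, and let `f = Φ + B`. As `G` is abelian, `F(A + t π^* η) = F + t dη`
(`curvature_add_smul`), so that the three functionals are quadratic polynomials along the
variations. As `Λ` is the adjoint of the multiplication by `Ω` and the Lefschetz decomposition is
orthogonal, criticality reads as follows (`isYangMills_iff`, `isPrimitiveYangMills_iff`,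
`IsConeCritical.equations`):

* Yang-Mills: `∫ ⟨F, dη⟩ = 0` for all `η`;
* primitive Yang-Mills: `∫ ⟨F, dη⟩ = ∫ κ(Φ, Λ dη)` for all `η`;
* cone Yang-Mills: `∫ ⟨F, dη⟩ + ∫ κ(B, Λ dη) = 0` for all `η`, and `n ∫ κ(b, f) + ∫ ⟨dB, db⟩ = 0`
  for all `b`.

The link between them is that a smooth function `h` satisfies `∫ κ(h, Λ dη) = 0` for all `η` if and
only if `dh = 0` (`dFun_eq_zero_of_integral_eq_zero`, `integral_eq_zero_of_dFun_eq_zero`).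

Suppose that `A + θ B` is critical. If `A` is Yang-Mills, then `∫ κ(B, Λ dη) = 0` for all `η`, so
that `dB = 0`; the choice `b = f` then gives `f = 0`, that is `Φ = -B`, and `A` is primitive
Yang-Mills. If `A` is primitive Yang-Mills, then `∫ κ(f, Λ dη) = 0` for all `η`, so that `df = 0`;
the choice `b = f` gives `f = 0`, the choice `b = B` gives `dB = 0`, and `A` is Yang-Mills. For
`n = 0` the equations do not give `f = 0`, but there `Λ` vanishes.

The characterization of `dh = 0` comes from an integration by parts, `integral_bilin_dualLefschetz`:
`∫ κ(h, Λ dη)` is the integral of the contraction of `dh` and `η` with the Poisson bivector `W⁻¹` of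
`Ω`. In a chart the volume density of a compatible metric is `√|det W|`, and `dΩ = 0` says that
`W⁻¹` is divergence free with respect to it (`sum_fderiv_density_mul_inv`). With `η = dh ∘ J`, up to
sign, the contraction is `⟨dh, dh⟩`.

Two foundational facts are needed besides. The curvature exists and is smooth, because `A` is
locally the sum of a form pulled back from the base and of the Maurer-Cartan form of the group,
which is closed: inversion reverses it, while it preserves `2`-forms at the identity. The supremum
of the chart measures is a finite measure, positive on nonempty open sets and given by the density
in every chart (`riemannianVolume_restrict_source`).
-/

noncomputable section

set_option linter.unusedSectionVars false

namespace ConeYM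

/-! ### Differential forms in charts -/

section Charts

variable {E : Type*} [NormedAddCommGroup E] [NormedSpace ℝ E]
  {M : Type*} [TopologicalSpace M] [ChartedSpace E M]

theorem mfderiv_symm_comp_mfderiv_extChartAt [IsManifold 𝓘(ℝ, E) ∞ M] {c x : M}
    (hx : x ∈ (extChartAt 𝓘(ℝ, E) c).source) (v : E) :
    mfderiv 𝓘(ℝ, E) 𝓘(ℝ, E) (extChartAt 𝓘(ℝ, E) c).symm (extChartAt 𝓘(ℝ, E) c x)
      (mfderiv 𝓘(ℝ, E) 𝓘(ℝ, E) (extChartAt 𝓘(ℝ, E) c) x v) = v := by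
  have : IsManifold 𝓘(ℝ, E) 1 M := .of_le (n := ∞) (by simp)
  have h := mfderivWithin_extChartAt_symm_comp_mfderiv_extChartAt' (I := 𝓘(ℝ, E)) hx
  simp only [modelWithCornersSelf_coe, Set.range_id, mfderivWithin_univ] at h
  exact congrArg (fun L : E →L[ℝ] E => L v) h

theorem mfderiv_extChartAt_comp_mfderiv_symm [IsManifold 𝓘(ℝ, E) ∞ M] {c : M} {y : E}
    (hy : y ∈ (extChartAt 𝓘(ℝ, E) c).target) (v : E) :
    mfderiv 𝓘(ℝ, E) 𝓘(ℝ, E) (extChartAt 𝓘(ℝ, E) c) ((extChartAt 𝓘(ℝ, E) c).symm y)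
      (mfderiv 𝓘(ℝ, E) 𝓘(ℝ, E) (extChartAt 𝓘(ℝ, E) c).symm y v) = v := by
  have : IsManifold 𝓘(ℝ, E) 1 M := .of_le (n := ∞) (by simp)
  have h := mfderiv_extChartAt_comp_mfderivWithin_extChartAt_symm (I := 𝓘(ℝ, E)) hy
  simp only [modelWithCornersSelf_coe, Set.range_id, mfderivWithin_univ] at h
  exact congrArg (fun L : E →L[ℝ] E => L v) h

theorem contMDiffAt_extChartAt_symm [IsManifold 𝓘(ℝ, E) ∞ M] {c : M} {y : E}
    (hy : y ∈ (extChartAt 𝓘(ℝ, E) c).target) :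
    ContMDiffAt 𝓘(ℝ, E) 𝓘(ℝ, E) ∞ (extChartAt 𝓘(ℝ, E) c).symm y :=
  (contMDiffOn_extChartAt_symm c).contMDiffAt ((isOpen_extChartAt_target c).mem_nhds hy)

theorem contMDiffAt_extChartAt_of_mem [IsManifold 𝓘(ℝ, E) ∞ M] {c x : M}
    (hx : x ∈ (extChartAt 𝓘(ℝ, E) c).source) :
    ContMDiffAt 𝓘(ℝ, E) 𝓘(ℝ, E) ∞ (extChartAt 𝓘(ℝ, E) c) x :=
  contMDiffAt_extChartAt' (by simpa using hx)

end Charts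

section Pullback

variable {E : Type*} [NormedAddCommGroup E] [NormedSpace ℝ E]
  {M : Type*} [TopologicalSpace M] [ChartedSpace E M] [IsManifold 𝓘(ℝ, E) ∞ M]
  {E' : Type*} [NormedAddCommGroup E'] [NormedSpace ℝ E']
  {N : Type*} [TopologicalSpace N] [ChartedSpace E' N] [IsManifold 𝓘(ℝ, E') ∞ N]
  {V : Type*} [NormedAddCommGroup V] [NormedSpace ℝ V] {k : ℕ}

/-- A map of manifolds written in the charts at `d` and `c`. -/
def writtenInCharts (d : N) (c : M) (f : N → M) (y : E') : E :=
  extChartAt 𝓘(ℝ, E) c (f ((extChartAt 𝓘(ℝ, E') d).symm y))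

theorem contDiffAt_writtenInCharts {d : N} {c : M} {f : N → M} {y : E'}
    (hy : y ∈ (extChartAt 𝓘(ℝ, E') d).target)
    (hf : ContMDiffAt 𝓘(ℝ, E') 𝓘(ℝ, E) ∞ f ((extChartAt 𝓘(ℝ, E') d).symm y))
    (hc : f ((extChartAt 𝓘(ℝ, E') d).symm y) ∈ (extChartAt 𝓘(ℝ, E) c).source) :
    ContDiffAt ℝ ∞ (writtenInCharts d c f : E' → E) y := by
  rw [← contMDiffAt_iff_contDiffAt]
  exact (contMDiffAt_extChartAt_of_mem hc).comp y (hf.comp y (contMDiffAt_extChartAt_symm hy))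

theorem fderiv_writtenInCharts {d : N} {c : M} {f : N → M} {y : E'}
    (hy : y ∈ (extChartAt 𝓘(ℝ, E') d).target)
    (hf : MDifferentiableAt 𝓘(ℝ, E') 𝓘(ℝ, E) f ((extChartAt 𝓘(ℝ, E') d).symm y))
    (hc : f ((extChartAt 𝓘(ℝ, E') d).symm y) ∈ (extChartAt 𝓘(ℝ, E) c).source) (v : E') :
    fderiv ℝ (writtenInCharts d c f : E' → E) y v =
      mfderiv 𝓘(ℝ, E) 𝓘(ℝ, E) (extChartAt 𝓘(ℝ, E) c) (f ((extChartAt 𝓘(ℝ, E') d).symm y))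
        (mfderiv 𝓘(ℝ, E') 𝓘(ℝ, E) f ((extChartAt 𝓘(ℝ, E') d).symm y)
          (mfderiv 𝓘(ℝ, E') 𝓘(ℝ, E') (extChartAt 𝓘(ℝ, E') d).symm y v)) := by
  have h1 := (contMDiffAt_extChartAt_symm (E := E') hy).mdifferentiableAt (by simp)
  have h2 := (contMDiffAt_extChartAt_of_mem (E := E) hc).mdifferentiableAt (by simp)
  rw [← mfderiv_eq_fderiv]
  have h3 : (writtenInCharts d c f : E' → E) =
    (extChartAt 𝓘(ℝ, E) c) ∘ f ∘ (extChartAt 𝓘(ℝ, E') d).symm := rfl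
  rw [h3, mfderiv_comp y (h2 : MDifferentiableAt _ _ _ ((f ∘ _) y)) (hf.comp y h1),
    mfderiv_comp y hf h1]
  rfl

/-- A form is recovered from its chart representative. -/
theorem chartRep_eq_of_mem (c : M) (α : DForm E M k V) {x : M}
    (hx : x ∈ (extChartAt 𝓘(ℝ, E) c).source) (v : Fin k → E) :
    chartRep c α (extChartAt 𝓘(ℝ, E) c x)
      (fun i => mfderiv 𝓘(ℝ, E) 𝓘(ℝ, E) (extChartAt 𝓘(ℝ, E) c) x (v i)) = α x v := by
  let α' : M → E [⋀^Fin k]→L[ℝ] V := α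
  have h : α' ((extChartAt 𝓘(ℝ, E) c).symm (extChartAt 𝓘(ℝ, E) c x)) = α' x :=
    congrArg α' ((extChartAt 𝓘(ℝ, E) c).left_inv hx)
  have h2 := congrArg (fun T : E [⋀^Fin k]→L[ℝ] V => T v) h
  refine Eq.trans ?_ h2
  change α' ((extChartAt 𝓘(ℝ, E) c).symm (extChartAt 𝓘(ℝ, E) c x)) _ =
    α' ((extChartAt 𝓘(ℝ, E) c).symm (extChartAt 𝓘(ℝ, E) c x)) _
  congr 1
  funext i
  exact mfderiv_symm_comp_mfderiv_extChartAt hx (v i)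

/-- In charts, the pullback of a form is the pullback along the coordinate expression of the map. -/
theorem chartRep_pullForm {d : N} {c : M} {f : N → M} {y : E'} (α : DForm E M k V)
    (hy : y ∈ (extChartAt 𝓘(ℝ, E') d).target)
    (hf : MDifferentiableAt 𝓘(ℝ, E') 𝓘(ℝ, E) f ((extChartAt 𝓘(ℝ, E') d).symm y))
    (hc : f ((extChartAt 𝓘(ℝ, E') d).symm y) ∈ (extChartAt 𝓘(ℝ, E) c).source) :
    chartRep d (pullForm f α) y =
      (chartRep c α (writtenInCharts d c f y)).compContinuousLinearMap
        (fderiv ℝ (writtenInCharts d c f : E' → E) y) := by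
  ext v
  refine (chartRep_eq_of_mem c α hc _).symm.trans ?_
  change _ = (chartRep c α (writtenInCharts d c f y)) _
  unfold writtenInCharts
  congr 1
  funext i
  exact (fderiv_writtenInCharts hy hf hc (v i)).symm

/-- Smoothness of a form at a point, tested in the preferred chart there. -/
def SmoothFormAt (α : DForm E M k V) (x : M) : Prop :=
  ContDiffAt ℝ ∞ (chartRep x α) (extChartAt 𝓘(ℝ, E) x x)

/-- The antisymmetrization of continuous multilinear maps is bounded. -/
def alternatizationCLM (E V : Type*) [NormedAddCommGroup E] [NormedSpace ℝ E]
    [NormedAddCommGroup V] [NormedSpace ℝ V] (k : ℕ) :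
    ContinuousMultilinearMap ℝ (fun _ : Fin k => E) V →L[ℝ] E [⋀^Fin k]→L[ℝ] V :=
  LinearMap.mkContinuous
    { toFun := fun f => f.alternatization
      map_add' := fun f g => map_add _ f g
      map_smul' := fun a f => by
        ext v
        simp [ContinuousMultilinearMap.alternatization_apply_apply, Finset.smul_sum,
          smul_comm a] }
    (Fintype.card (Equiv.Perm (Fin k))) fun f => by
      refine ContinuousAlternatingMap.opNorm_le_bound _ (by positivity) fun v => ?_
      change ‖f.alternatization v‖ ≤ _
      rw [ContinuousMultilinearMap.alternatization_apply_apply]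
      refine (norm_sum_le _ _).trans ?_
      calc ∑ σ : Equiv.Perm (Fin k), ‖Equiv.Perm.sign σ • f (v ∘ σ)‖
          ≤ ∑ _σ : Equiv.Perm (Fin k), ‖f‖ * ∏ i, ‖v i‖ := by
            refine Finset.sum_le_sum fun σ _ => ?_
            have h : ‖Equiv.Perm.sign σ • f (v ∘ σ)‖ = ‖f (v ∘ σ)‖ := by
              rcases Int.units_eq_one_or (Equiv.Perm.sign σ) with h | h <;> simp [h]
            rw [h]
            refine (f.le_opNorm _).trans_eq ?_
            congr 1
            exact Equiv.prod_comp σ fun i => ‖v i‖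
        _ = _ := by simp [mul_assoc]

theorem alternatizationCLM_toContinuousMultilinearMap (f : E [⋀^Fin k]→L[ℝ] V) :
    ((k.factorial : ℝ)⁻¹) • alternatizationCLM E V k f.toContinuousMultilinearMap = f := by
  ext v
  have h : alternatizationCLM E V k f.toContinuousMultilinearMap v =
      ∑ _σ : Equiv.Perm (Fin k), f v := by
    change ContinuousMultilinearMap.alternatization _ v = _
    rw [ContinuousMultilinearMap.alternatization_apply_apply]
    refine Finset.sum_congr rfl fun σ _ => ?_
    change Equiv.Perm.sign σ • f (v ∘ σ) = _
    rw [show f (v ∘ σ) = Equiv.Perm.sign σ • f v from f.toAlternatingMap.map_perm v σ, smul_smul]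
    simp
  have h0 : ((k.factorial : ℝ)) ≠ 0 := by positivity
  rw [ContinuousAlternatingMap.smul_apply, h, Finset.sum_const, Finset.card_univ,
    Fintype.card_perm, Fintype.card_fin, ← Nat.cast_smul_eq_nsmul ℝ, smul_smul,
    inv_mul_cancel₀ h0, one_smul]

/-- The composition of alternating maps with a linear map is smooth in both arguments. It is
obtained from the corresponding fact for multilinear maps, onto which alternating maps embed with
left inverse `(1 / k!) alternatizationCLM`. -/
theorem contDiffAt_compContinuousLinearMap {X : Type*} [NormedAddCommGroup X] [NormedSpace ℝ X]
    {w : X → E [⋀^Fin k]→L[ℝ] V} {T : X → E' →L[ℝ] E} {x : X} {r : WithTop ℕ∞}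
    (hw : ContDiffAt ℝ r w x) (hT : ContDiffAt ℝ r T x) :
    ContDiffAt ℝ r (fun y => (w y).compContinuousLinearMap (T y)) x := by
  have h1 : ContDiffAt ℝ r (fun y => (w y).toContinuousMultilinearMap) x :=
    (ContinuousAlternatingMap.toContinuousMultilinearMapLI (𝕜 := ℝ) (E := E) (F := V)
      (ι := Fin k)).contDiff.contDiffAt.comp x hw
  have h2 : ContDiffAt ℝ r (fun y =>
      ContinuousMultilinearMap.compContinuousLinearMapContinuousMultilinear ℝ
        (fun _ : Fin k => E') (fun _ => E) V (fun _ => T y)) x :=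
    (ContinuousMultilinearMap.contDiff _).contDiffAt.comp x (contDiffAt_pi.2 fun _ => hT)
  have h3 := ((alternatizationCLM E' V k).contDiff.contDiffAt.comp x
    (h2.clm_apply h1)).const_smul ((k.factorial : ℝ)⁻¹)
  refine h3.congr_of_eventuallyEq (Filter.Eventually.of_forall fun y => ?_)
  exact (alternatizationCLM_toContinuousMultilinearMap
    ((w y).compContinuousLinearMap (T y))).symm

theorem two_le_infty : minSmoothness ℝ 2 ≤ (∞ : WithTop ℕ∞) := by
  rw [minSmoothness_of_isRCLikeNormedField]
  exact WithTop.coe_le_coe.2 le_top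

set_option synthInstance.maxHeartbeats 200000 in
theorem contDiffAt_extDeriv {w : E → E [⋀^Fin k]→L[ℝ] V} {x : E} (h : ContDiffAt ℝ ∞ w x) :
    ContDiffAt ℝ ∞ (extDeriv w) x := by
  have := (ContinuousAlternatingMap.alternatizeUncurryFinCLM ℝ E V
    (n := k)).contDiff.contDiffAt.comp x (h.fderiv_right (m := ∞) (by simp))
  refine this.congr_of_eventuallyEq (Filter.Eventually.of_forall fun y => ?_)
  simp [extDeriv]

theorem eventually_mem_target {c : M} {y : E} (hy : y ∈ (extChartAt 𝓘(ℝ, E) c).target) :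
    ∀ᶠ z in nhds y, z ∈ (extChartAt 𝓘(ℝ, E) c).target :=
  (isOpen_extChartAt_target c).mem_nhds hy

theorem continuousAt_symm {c : M} {y : E} (hy : y ∈ (extChartAt 𝓘(ℝ, E) c).target) :
    ContinuousAt (extChartAt 𝓘(ℝ, E) c).symm y :=
  (continuousOn_extChartAt_symm c).continuousAt ((isOpen_extChartAt_target c).mem_nhds hy)

/-- `chartRep_pullForm` near a point. -/
theorem chartRep_pullForm_eventuallyEq {d : N} {c : M} {f : N → M} {y : E'} (α : DForm E M k V)
    (hy : y ∈ (extChartAt 𝓘(ℝ, E') d).target)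
    (hf : ContMDiffAt 𝓘(ℝ, E') 𝓘(ℝ, E) ∞ f ((extChartAt 𝓘(ℝ, E') d).symm y))
    (hc : f ((extChartAt 𝓘(ℝ, E') d).symm y) ∈ (extChartAt 𝓘(ℝ, E) c).source) :
    chartRep d (pullForm f α) =ᶠ[nhds y] fun z =>
      (chartRep c α (writtenInCharts d c f z)).compContinuousLinearMap
        (fderiv ℝ (writtenInCharts d c f : E' → E) z) := by
  have : IsManifold 𝓘(ℝ, E) 1 M := .of_le (n := ∞) (by simp)
  have : IsManifold 𝓘(ℝ, E') 1 N := .of_le (n := ∞) (by simp)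
  have h1 : ∀ᶠ q in nhds ((extChartAt 𝓘(ℝ, E') d).symm y), ContMDiffAt 𝓘(ℝ, E') 𝓘(ℝ, E) 1 f q :=
    contMDiffAt_iff_contMDiffAt_nhds (by simp) |>.1 (hf.of_le (m := 1) (by simp))
  have h2 := hf.continuousAt.eventually ((isOpen_extChartAt_source (I := 𝓘(ℝ, E)) c).mem_nhds hc)
  filter_upwards [eventually_mem_target hy, (continuousAt_symm hy).eventually h1,
    (continuousAt_symm hy).eventually h2] with z hz hz1 hz2
  exact chartRep_pullForm α hz (hz1.mdifferentiableAt (by simp)) hz2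

theorem pullForm_id (α : DForm E M k V) : pullForm (id : M → M) α = α := by
  funext x
  ext v
  simp only [pullForm, mfderiv_id]
  rfl

/-- A form that is smooth at a point is so in every chart around it: two representatives differ by
the pullback along the change of charts. -/
theorem SmoothFormAt.contDiffAt_chartRep {α : DForm E M k V} {c : M} {y : E}
    (hy : y ∈ (extChartAt 𝓘(ℝ, E) c).target)
    (h : SmoothFormAt α ((extChartAt 𝓘(ℝ, E) c).symm y)) : ContDiffAt ℝ ∞ (chartRep c α) y := by
  have h1 := chartRep_pullForm_eventuallyEq (f := id) α hy contMDiffAt_id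
    (mem_extChartAt_source (I := 𝓘(ℝ, E)) ((extChartAt 𝓘(ℝ, E) c).symm y))
  rw [pullForm_id] at h1
  have h2 := contDiffAt_writtenInCharts (f := id) hy contMDiffAt_id
    (mem_extChartAt_source (I := 𝓘(ℝ, E)) ((extChartAt 𝓘(ℝ, E) c).symm y))
  refine ContDiffAt.congr_of_eventuallyEq ?_ h1
  exact contDiffAt_compContinuousLinearMap
    (ContDiffAt.comp (g := chartRep ((extChartAt 𝓘(ℝ, E) c).symm y) α) y h h2)
    (h2.fderiv_right (by simp))

theorem smoothForm_iff {α : DForm E M k V} : SmoothForm α ↔ ∀ x, SmoothFormAt α x :=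
  ⟨fun h x => (h x).contDiffAt ((isOpen_extChartAt_target x).mem_nhds (mem_extChartAt_target x)),
    fun h _ _ hy => ((h _).contDiffAt_chartRep hy).contDiffWithinAt⟩

theorem SmoothForm.at {α : DForm E M k V} (h : SmoothForm α) (x : M) : SmoothFormAt α x :=
  smoothForm_iff.1 h x

theorem SmoothFormAt.pullForm {α : DForm E M k V} {f : N → M} {x : N}
    (hα : SmoothFormAt α (f x)) (hf : ContMDiffAt 𝓘(ℝ, E') 𝓘(ℝ, E) ∞ f x) :
    SmoothFormAt (ConeYM.pullForm (E' := E') f α) x := by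
  have hxx : (extChartAt 𝓘(ℝ, E') x).symm (extChartAt 𝓘(ℝ, E') x x) = x := extChartAt_to_inv x
  have hc : f ((extChartAt 𝓘(ℝ, E') x).symm (extChartAt 𝓘(ℝ, E') x x)) ∈
    (extChartAt 𝓘(ℝ, E) (f x)).source := by rw [hxx]; exact mem_extChartAt_source (f x)
  have hf' := hf
  rw [← hxx] at hf'
  have hy := mem_extChartAt_target (I := 𝓘(ℝ, E')) x
  have h2 := contDiffAt_writtenInCharts hy hf' hc
  refine ContDiffAt.congr_of_eventuallyEq ?_ (chartRep_pullForm_eventuallyEq (E' := E') α hy hf' hc)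
  refine contDiffAt_compContinuousLinearMap
    (ContDiffAt.comp (g := chartRep (f x) α) _ ?_ h2) (h2.fderiv_right (by simp))
  simpa [writtenInCharts, hxx, SmoothFormAt] using hα

/-- The exterior derivative commutes with pullbacks. -/
theorem extD_pullForm {α : DForm E M k V} {f : N → M} {x : N}
    (hα : SmoothFormAt α (f x)) (hf : ContMDiffAt 𝓘(ℝ, E') 𝓘(ℝ, E) ∞ f x) :
    extD (pullForm (E' := E') f α) x = pullForm f (extD α) x := by
  have hxx : (extChartAt 𝓘(ℝ, E') x).symm (extChartAt 𝓘(ℝ, E') x x) = x := extChartAt_to_inv x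
  have hc : f ((extChartAt 𝓘(ℝ, E') x).symm (extChartAt 𝓘(ℝ, E') x x)) ∈
    (extChartAt 𝓘(ℝ, E) (f x)).source := by rw [hxx]; exact mem_extChartAt_source (f x)
  have hf' := hf
  rw [← hxx] at hf'
  have hy := mem_extChartAt_target (I := 𝓘(ℝ, E')) x
  have h2 := contDiffAt_writtenInCharts hy hf' hc
  have hφ : (writtenInCharts x (f x) f (extChartAt 𝓘(ℝ, E') x x) : E) =
    extChartAt 𝓘(ℝ, E) (f x) (f x) := by simp [writtenInCharts]
  ext v
  simp only [extD, ConeYM.pullForm]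
  rw [(chartRep_pullForm_eventuallyEq (E' := E') α hy hf' hc).extDeriv_eq,
    extDeriv_pullback (r := ∞) (by rw [hφ]; exact hα.differentiableAt (by simp)) h2
      two_le_infty, hφ]
  change extDeriv (chartRep (f x) α) _ _ = extDeriv (chartRep (f x) α) _ _
  congr 1
  funext i
  have h3 := fderiv_writtenInCharts hy (hf'.mdifferentiableAt (by simp)) hc
    (mfderiv 𝓘(ℝ, E') 𝓘(ℝ, E') (extChartAt 𝓘(ℝ, E') x) x (v i))
  refine h3.trans ?_
  have h4 := mfderiv_symm_comp_mfderiv_extChartAt (mem_extChartAt_source (I := 𝓘(ℝ, E')) x) (v i)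
  let g : N → E' → E := fun z w => mfderiv 𝓘(ℝ, E) 𝓘(ℝ, E) (extChartAt 𝓘(ℝ, E) (f x)) (f z)
    (mfderiv 𝓘(ℝ, E') 𝓘(ℝ, E) f z w)
  change g ((extChartAt 𝓘(ℝ, E') x).symm (extChartAt 𝓘(ℝ, E') x x)) _ = g x (v i)
  rw [hxx]
  exact congrArg (g x) h4

/-- The exterior derivative may be computed in any chart, as it commutes with the changes of
charts. -/
theorem chartRep_extD {α : DForm E M k V} {c : M} {y : E}
    (hy : y ∈ (extChartAt 𝓘(ℝ, E) c).target)
    (h : SmoothFormAt α ((extChartAt 𝓘(ℝ, E) c).symm y)) :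
    chartRep c (extD α) y = extDeriv (chartRep c α) y := by
  set x := (extChartAt 𝓘(ℝ, E) c).symm y with hx
  have hc := mem_extChartAt_source (I := 𝓘(ℝ, E)) x
  have h1 := chartRep_pullForm_eventuallyEq (f := id) α hy contMDiffAt_id hc
  rw [pullForm_id] at h1
  have h2 := contDiffAt_writtenInCharts (f := id) hy contMDiffAt_id hc
  have hφ : (writtenInCharts c x id y : E) = extChartAt 𝓘(ℝ, E) x x := rfl
  rw [h1.extDeriv_eq, extDeriv_pullback (r := ∞) (by rw [hφ]; exact h.differentiableAt (by simp)) h2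
    two_le_infty]
  ext v
  change extDeriv (chartRep x α) _ _ = extDeriv (chartRep x α) _ _
  congr 1
  funext i
  refine Eq.trans ?_ (fderiv_writtenInCharts (f := id) hy mdifferentiableAt_id hc (v i)).symm
  rw [mfderiv_id]
  rfl

theorem SmoothForm.extD {α : DForm E M k V} (h : SmoothForm α) : SmoothForm (extD α) := by
  intro c y hy
  refine ContDiffAt.contDiffWithinAt ?_
  refine (contDiffAt_extDeriv ((h.at _).contDiffAt_chartRep hy)).congr_of_eventuallyEq ?_
  filter_upwards [eventually_mem_target hy] with z hz
  exact chartRep_extD hz (h.at _)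

theorem chartRep_add (c : M) (α β : DForm E M k V) :
    chartRep c (α + β) = chartRep c α + chartRep c β := rfl

theorem chartRep_smul (c : M) (a : ℝ) (α : DForm E M k V) :
    chartRep c (a • α) = a • chartRep c α := rfl

theorem SmoothFormAt.const_smul {α : DForm E M k V} {x : M} (hα : SmoothFormAt α x) (a : ℝ) :
    SmoothFormAt (a • α) x :=
  ContDiffAt.const_smul a hα

theorem SmoothForm.add {α β : DForm E M k V} (hα : SmoothForm α) (hβ : SmoothForm β) :
    SmoothForm (α + β) := fun c => (hα c).add (hβ c)

theorem SmoothForm.const_smul {α : DForm E M k V} (hα : SmoothForm α) (a : ℝ) :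
    SmoothForm (a • α) := fun c => (hα c).const_smul a

theorem extD_add {α β : DForm E M k V} {x : M} (hα : SmoothFormAt α x) (hβ : SmoothFormAt β x) :
    extD (α + β) x = extD α x + extD β x := by
  simp only [ConeYM.extD, chartRep_add]
  rw [extDeriv_add (hα.differentiableAt (by simp)) (hβ.differentiableAt (by simp))]
  rfl

theorem extD_smul (a : ℝ) (α : DForm E M k V) (x : M) : extD (a • α) x = a • extD α x := by
  simp only [ConeYM.extD, chartRep_smul]
  rw [extDeriv_smul]
  rfl

theorem chartRep_congr {α β : DForm E M k V} {c x : M} (hx : x ∈ (extChartAt 𝓘(ℝ, E) c).source)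
    (h : ∀ᶠ z in nhds x, α z = β z) :
    chartRep c α =ᶠ[nhds (extChartAt 𝓘(ℝ, E) c x)] chartRep c β := by
  have h1 := continuousAt_symm ((extChartAt 𝓘(ℝ, E) c).map_source hx)
  rw [ContinuousAt, (extChartAt 𝓘(ℝ, E) c).left_inv hx] at h1
  filter_upwards [h1.eventually h] with y hy
  simp only [chartRep, hy]

theorem extD_congr {α β : DForm E M k V} {x : M} (h : ∀ᶠ z in nhds x, α z = β z) :
    extD α x = extD β x := by
  simp only [ConeYM.extD, (chartRep_congr (mem_extChartAt_source x) h).extDeriv_eq]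

end Pullback

/-! ### Derivatives of maps of manifolds -/

section Tderiv

variable {E : Type*} [NormedAddCommGroup E] [NormedSpace ℝ E]
  {M : Type*} [TopologicalSpace M] [ChartedSpace E M]
  {E' : Type*} [NormedAddCommGroup E'] [NormedSpace ℝ E']
  {N : Type*} [TopologicalSpace N] [ChartedSpace E' N]
  {E'' : Type*} [NormedAddCommGroup E''] [NormedSpace ℝ E'']
  {Q : Type*} [TopologicalSpace Q] [ChartedSpace E'' Q]

/-- The derivative of a map of manifolds, as a map of the model spaces: the tangent spaces are
copies of the model space, and forgetting the base points allows to rewrite them. -/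
def tderiv (f : M → N) (x : M) : E →L[ℝ] E' := mfderiv 𝓘(ℝ, E) 𝓘(ℝ, E') f x

theorem tderiv_comp {g : N → Q} {f : M → N} {x : M}
    (hg : MDifferentiableAt 𝓘(ℝ, E') 𝓘(ℝ, E'') g (f x))
    (hf : MDifferentiableAt 𝓘(ℝ, E) 𝓘(ℝ, E') f x) (v : E) :
    (tderiv (fun z => g (f z)) x : E →L[ℝ] E'') v =
      (tderiv g (f x) : E' →L[ℝ] E'') ((tderiv f x : E →L[ℝ] E') v) :=
  congrArg (fun L : E →L[ℝ] E'' => L v) (mfderiv_comp x hg hf)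

theorem tderiv_id (x : M) (v : E) : (tderiv (fun z : M => z) x : E →L[ℝ] E) v = v :=
  congrArg (fun L : E →L[ℝ] E => L v) (mfderiv_id (I := 𝓘(ℝ, E)) (x := x))

theorem tderiv_const (x : M) (c : N) (v : E) : (tderiv (fun _ : M => c) x : E →L[ℝ] E') v = 0 :=
  congrArg (fun L : E →L[ℝ] E' => L v) (mfderiv_const (I := 𝓘(ℝ, E)) (I' := 𝓘(ℝ, E')))

theorem tderiv_congr {f g : M → N} {x : M} (h : f =ᶠ[nhds x] g) :
    (tderiv f x : E →L[ℝ] E') = tderiv g x :=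
  Filter.EventuallyEq.mfderiv_eq h

/-- The product rule for a function of two variables. -/
theorem tderiv_comp₂ {F : M × N → Q} {f : M → M} {x : M} {g : M → N}
    (hF : MDifferentiableAt (𝓘(ℝ, E).prod 𝓘(ℝ, E')) 𝓘(ℝ, E'') F (f x, g x))
    (hf : MDifferentiableAt 𝓘(ℝ, E) 𝓘(ℝ, E) f x)
    (hg : MDifferentiableAt 𝓘(ℝ, E) 𝓘(ℝ, E') g x) (v : E) :
    (tderiv (fun z => F (f z, g z)) x : E →L[ℝ] E'') v =
      (tderiv (fun z => F (z, g x)) (f x) : E →L[ℝ] E'') ((tderiv f x : E →L[ℝ] E) v) +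
      (tderiv (fun z => F (f x, z)) (g x) : E' →L[ℝ] E'') ((tderiv g x : E →L[ℝ] E') v) := by
  have h1 := mfderiv_comp x hF (hf.prodMk hg)
  have h2 := congrArg (fun L : E →L[ℝ] E'' => L v) h1
  refine h2.trans ?_
  refine (mfderiv_prod_eq_add_apply (p := (f x, g x)) hF).trans ?_
  rw [hf.mfderiv_prod hg]
  rfl

end Tderiv

section Fiber

variable {E : Type*} [NormedAddCommGroup E] [NormedSpace ℝ E]
  {M : Type*} [TopologicalSpace M] [ChartedSpace E M]
  {V : Type*} [NormedAddCommGroup V] [NormedSpace ℝ V] {k : ℕ}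

/-- The value of a form at a point, as an alternating map of the model space. -/
def fiber (α : DForm E M k V) (x : M) : E [⋀^Fin k]→L[ℝ] V := α x

theorem dform_ext {α β : DForm E M k V} (h : ∀ (x : M) (v : Fin k → E), fiber α x v = fiber β x v) :
    α = β :=
  funext fun x => ContinuousAlternatingMap.ext (h x)

end Fiber

theorem eq_zero_of_neg_eq {V : Type*} [NormedAddCommGroup V] [NormedSpace ℝ V] {x : V}
    (h : -x = x) : x = 0 := by
  have h2 : (2 : ℝ) • x = 0 := by
    rw [two_smul]
    nth_rewrite 1 [← h]
    exact neg_add_cancel x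
  simpa using h2

/-! ### Abelian Lie groups -/

section AbelianGroup

variable {EG : Type*} [NormedAddCommGroup EG] [NormedSpace ℝ EG]
  {G : Type*} [TopologicalSpace G] [ChartedSpace EG G] [CommGroup G] [LieGroup 𝓘(ℝ, EG) ∞ G]

theorem mdifferentiable_mul_left (g h : G) :
    MDifferentiableAt 𝓘(ℝ, EG) 𝓘(ℝ, EG) (fun z => g * z) h :=
  (contMDiff_mul_left (I := 𝓘(ℝ, EG)) (n := ∞)).contMDiffAt.mdifferentiableAt (by simp)

theorem mdifferentiable_inv (h : G) :
    MDifferentiableAt 𝓘(ℝ, EG) 𝓘(ℝ, EG) (fun z : G => z⁻¹) h :=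
  (contMDiff_inv 𝓘(ℝ, EG) ∞).contMDiffAt.mdifferentiableAt (by simp)

theorem mdifferentiable_mul (p : G × G) :
    MDifferentiableAt (𝓘(ℝ, EG).prod 𝓘(ℝ, EG)) 𝓘(ℝ, EG) (fun z : G × G => z.1 * z.2) p :=
  (contMDiff_mul 𝓘(ℝ, EG) ∞).contMDiffAt.mdifferentiableAt (by simp)

/-- The derivative of the inversion at the identity is `-1`. -/
theorem tderiv_inv_one (v : EG) : (tderiv (fun z : G => z⁻¹) 1 : EG →L[ℝ] EG) v = -v := by
  have h := tderiv_comp₂ (F := fun z : G × G => z.1 * z.2) (f := fun z => z) (x := (1 : G))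
    (g := fun z => z⁻¹) (mdifferentiable_mul _) mdifferentiableAt_id (mdifferentiable_inv _) v
  simp only [mul_inv_cancel, inv_one, mul_one, one_mul] at h
  rw [tderiv_const, tderiv_id, tderiv_id, tderiv_id] at h
  exact eq_neg_of_add_eq_zero_right h.symm

/-- Inversion reverses the left invariant vector fields of an abelian Lie group. -/
theorem tderiv_inv_mulInvariant (g : G) (v : EG) :
    (tderiv (fun z : G => z⁻¹) g : EG →L[ℝ] EG) ((tderiv (fun z : G => g * z) 1 : EG →L[ℝ] EG) v) =
      -(tderiv (fun z : G => g⁻¹ * z) 1 : EG →L[ℝ] EG) v := by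
  have h1 := tderiv_comp (g := fun z : G => z⁻¹) (f := fun z : G => g * z) (x := 1)
    (mdifferentiable_inv _) (mdifferentiable_mul_left g _) v
  have h2 := tderiv_comp (g := fun z : G => g⁻¹ * z) (f := fun z : G => z⁻¹) (x := 1)
    (mdifferentiable_mul_left _ _) (mdifferentiable_inv _) v
  simp only [mul_one, inv_one, mul_inv, tderiv_inv_one, map_neg] at h1 h2
  rw [← h1, h2]

theorem tderiv_inv_tderiv_inv (g : G) (v : EG) :
    (tderiv (fun z : G => z⁻¹) g⁻¹ : EG →L[ℝ] EG)
      ((tderiv (fun z : G => z⁻¹) g : EG →L[ℝ] EG) v) = v := by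
  have h := tderiv_comp (g := fun z : G => z⁻¹) (f := fun z : G => z⁻¹) (x := g)
    (mdifferentiable_inv _) (mdifferentiable_inv _) v
  simp only [inv_inv, tderiv_id] at h
  exact h.symm

open VectorField in
/-- The Lie algebra of an abelian Lie group is abelian: pulling back along inversion, which is a
group homomorphism, gives `[ξ, ζ] = [-ξ, -ζ]` for left invariant fields on one side and `-[ξ, ζ]` at
the identity on the other. -/
theorem lieBr_eq_zero [CompleteSpace EG] (ξ ζ : EG) : lieBr EG G ξ ζ = 0 := by
  have hG : LieGroup 𝓘(ℝ, EG) (minSmoothness ℝ 3) G :=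
    LieGroup.of_le (n := ∞) (by
      rw [minSmoothness_of_isRCLikeNormedField]; exact WithTop.coe_le_coe.2 le_top)
  have hG2 : IsManifold 𝓘(ℝ, EG) ∞ G := LieGroup.toContMDiffMul.toIsManifold
  -- the pullback of a left invariant field under inversion
  have hpull : ∀ v : GroupLieAlgebra 𝓘(ℝ, EG) G,
      mpullback 𝓘(ℝ, EG) 𝓘(ℝ, EG) (fun z : G => z⁻¹) (mulInvariantVectorField v) =
        mulInvariantVectorField (-v) := by
    intro v
    funext g
    have hinv : (tderiv (fun z : G => z⁻¹) g : EG →L[ℝ] EG).inverse =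
        tderiv (fun z : G => z⁻¹) g⁻¹ := by
      refine ContinuousLinearMap.inverse_eq ?_ ?_
      · ext w
        simpa using tderiv_inv_tderiv_inv g⁻¹ w
      · ext w
        exact tderiv_inv_tderiv_inv g w
    change (tderiv (fun z : G => z⁻¹) g : EG →L[ℝ] EG).inverse
      ((tderiv (fun z : G => g⁻¹ * z) 1 : EG →L[ℝ] EG) v) =
      (tderiv (fun z : G => g * z) 1 : EG →L[ℝ] EG) (-v)
    rw [hinv]
    have h := tderiv_inv_mulInvariant (EG := EG) g⁻¹ v
    rw [inv_inv] at h
    exact h.trans (map_neg (tderiv (fun z : G => g * z) 1 : EG →L[ℝ] EG) v).symm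
  have h := mpullback_mlieBracket (I := 𝓘(ℝ, EG)) (I' := 𝓘(ℝ, EG)) (n := ∞)
    (f := fun z : G => z⁻¹) (x₀ := 1)
    (V := mulInvariantVectorField (I := 𝓘(ℝ, EG)) (G := G) ξ)
    (W := mulInvariantVectorField (I := 𝓘(ℝ, EG)) (G := G) ζ)
    (mdifferentiableAt_mulInvariantVectorField _) (mdifferentiableAt_mulInvariantVectorField _)
    (contMDiff_inv 𝓘(ℝ, EG) ∞).contMDiffAt two_le_infty
  have hX := hpull ξ
  have hY := hpull ζ
  let B : G → EG := mlieBracket 𝓘(ℝ, EG)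
    (mulInvariantVectorField (I := 𝓘(ℝ, EG)) (G := G) ξ)
    (mulInvariantVectorField (I := 𝓘(ℝ, EG)) (G := G) ζ)
  have hinv : (tderiv (fun z : G => z⁻¹) 1 : EG →L[ℝ] EG).inverse =
      -ContinuousLinearMap.id ℝ EG := by
    have h1 : (tderiv (fun z : G => z⁻¹) 1 : EG →L[ℝ] EG) = -ContinuousLinearMap.id ℝ EG := by
      ext v
      simp [tderiv_inv_one]
    rw [h1]
    exact ContinuousLinearMap.inverse_eq (by ext; simp) (by ext; simp)
  have h3 : (tderiv (fun z : G => z⁻¹) 1 : EG →L[ℝ] EG).inverse (B 1⁻¹) = -lieBr EG G ξ ζ := by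
    rw [hinv, inv_one]
    rfl
  have h4' : ∀ a b : GroupLieAlgebra 𝓘(ℝ, EG) G, ⁅-a, -b⁆ = ⁅a, b⁆ := fun a b => by
    rw [lie_neg, neg_lie, neg_neg]
  have h4 : lieBr EG G (-ξ) (-ζ) = lieBr EG G ξ ζ := h4' ξ ζ
  have h5 : -lieBr EG G ξ ζ = lieBr EG G ξ ζ := h3.symm.trans (h.trans ((congrArg₂
    (fun X Y : ∀ z : G, TangentSpace 𝓘(ℝ, EG) z => mlieBracket 𝓘(ℝ, EG) X Y (1 : G))
      hX hY).trans h4))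
  exact eq_zero_of_neg_eq h5

/-- The Maurer-Cartan form of a Lie group: the translation of tangent vectors to the identity. -/
def maurerCartan (EG G : Type*) [NormedAddCommGroup EG] [NormedSpace ℝ EG]
    [TopologicalSpace G] [ChartedSpace EG G] [Group G] : DForm EG G 1 EG := fun g =>
  ContinuousAlternatingMap.ofSubsingleton ℝ EG EG (0 : Fin 1)
    (tderiv (fun z : G => g⁻¹ * z) g : EG →L[ℝ] EG)

theorem smoothForm_maurerCartan : SmoothForm (maurerCartan EG G) := by
  have hG2 : IsManifold 𝓘(ℝ, EG) ∞ G := LieGroup.toContMDiffMul.toIsManifold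
  intro c y hy
  refine ContDiffAt.contDiffWithinAt ?_
  -- the form is a partial derivative of the smooth function `(y, z) ↦ g(y)⁻¹ g(z)`
  let e := (extChartAt 𝓘(ℝ, EG) c)
  let e1 := (extChartAt 𝓘(ℝ, EG) (1 : G))
  let Ψ : EG → EG → EG := fun y z => e1 ((e.symm y)⁻¹ * e.symm z)
  have hΨ : ContDiffAt ℝ ∞ (Function.uncurry Ψ) (y, y) := by
    rw [← contMDiffAt_iff_contDiffAt]
    have h1 := contMDiffAt_extChartAt_symm hy
    have h2 : ContMDiffAt 𝓘(ℝ, EG × EG) 𝓘(ℝ, EG) ∞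
        (fun p : EG × EG => (e.symm p.1)⁻¹ * e.symm p.2) (y, y) :=
      ((h1.comp (y, y) (contDiff_fst.contMDiff.contMDiffAt)).inv).mul
        (h1.comp (y, y) (contDiff_snd.contMDiff.contMDiffAt))
    refine ContMDiffAt.comp (y, y) (g := e1) ?_ h2
    refine contMDiffAt_extChartAt_of_mem ?_
    simp
  have hfd : ContDiffAt ℝ ∞ (fun y => fderiv ℝ (Ψ y) y) y :=
    ContDiffAt.fderiv (n := ∞) hΨ contDiffAt_id (by simp)
  refine ((ContinuousAlternatingMap.ofSubsingletonLIE (𝕜 := ℝ) (E := EG) (F := EG)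
    (0 : Fin 1)).contDiff.contDiffAt.comp y hfd).congr_of_eventuallyEq ?_
  filter_upwards [eventually_mem_target hy] with z hz
  ext v
  have h1 := contMDiffAt_extChartAt_symm hz
  have h2 : fderiv ℝ (Ψ z) z (v 0) = (tderiv (Ψ z) z : EG →L[ℝ] EG) (v 0) := by
    rw [tderiv, mfderiv_eq_fderiv]
  change (tderiv (fun w : G => (e.symm z)⁻¹ * w) (e.symm z) : EG →L[ℝ] EG)
    ((tderiv e.symm z : EG →L[ℝ] EG) (v 0)) = fderiv ℝ (Ψ z) z (v 0)
  rw [h2]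
  have h3 := tderiv_comp (g := fun w : G => (e.symm z)⁻¹ * w) (f := e.symm) (x := z)
    (mdifferentiable_mul_left _ _) (h1.mdifferentiableAt (by simp)) (v 0)
  have hmem : (e.symm z)⁻¹ * e.symm z ∈ e1.source := by
    rw [inv_mul_cancel]
    exact mem_extChartAt_source 1
  have h4 := tderiv_comp (g := e1) (f := fun w => (e.symm z)⁻¹ * e.symm w) (x := z)
    ((contMDiffAt_extChartAt_of_mem hmem).mdifferentiableAt (by simp))
    (MDifferentiableAt.comp z (mdifferentiable_mul_left _ _) (h1.mdifferentiableAt (by simp))) (v 0)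
  have h5 : ∀ w : EG, (tderiv e1 (1 : G) : EG →L[ℝ] EG) w = w := by
    intro w
    exact congrArg (fun L : EG →L[ℝ] EG => L w)
      (mfderiv_extChartAt_self (I := 𝓘(ℝ, EG)) (x := (1 : G)))
  rw [inv_mul_cancel, h5] at h4
  exact h3.symm.trans h4.symm

/-- Inversion reverses the Maurer-Cartan form, the group being abelian. -/
theorem pullForm_inv_maurerCartan :
    pullForm (fun z : G => z⁻¹) (maurerCartan EG G) = -maurerCartan EG G := by
  refine dform_ext fun g v => ?_
  have h1 := tderiv_comp (g := fun z : G => g * z) (f := fun z : G => z⁻¹) (x := g)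
    (mdifferentiable_mul_left _ _) (mdifferentiable_inv _) (v 0)
  have h2 := tderiv_comp (g := fun z : G => z⁻¹) (f := fun z : G => g⁻¹ * z) (x := g)
    (mdifferentiable_inv _) (mdifferentiable_mul_left _ _) (v 0)
  rw [inv_mul_cancel, tderiv_inv_one] at h2
  change (tderiv (fun z : G => g⁻¹⁻¹ * z) g⁻¹ : EG →L[ℝ] EG)
    ((tderiv (fun z : G => z⁻¹) g : EG →L[ℝ] EG) (v 0)) =
    -(tderiv (fun z : G => g⁻¹ * z) g : EG →L[ℝ] EG) (v 0)
  rw [inv_inv, ← h1, ← h2]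
  simp only [mul_inv, inv_inv]

theorem pullForm_mul_left_maurerCartan (a : G) :
    pullForm (fun z : G => a * z) (maurerCartan EG G) = maurerCartan EG G := by
  refine dform_ext fun g v => ?_
  have h1 := tderiv_comp (g := fun z : G => (a * g)⁻¹ * z) (f := fun z : G => a * z) (x := g)
    (mdifferentiable_mul_left _ _) (mdifferentiable_mul_left _ _) (v 0)
  refine h1.symm.trans ?_
  change _ = (tderiv (fun z : G => g⁻¹ * z) g : EG →L[ℝ] EG) (v 0)
  congr 3
  funext z
  rw [mul_inv_rev, mul_assoc, inv_mul_cancel_left]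

/-- The Maurer-Cartan form of an abelian Lie group is closed. As inversion reverses the form and is
`-1` at the identity, the exterior derivative vanishes there, being of even degree; it is invariant
under translations. -/
theorem extD_maurerCartan (g : G) : extD (maurerCartan EG G) g = 0 := by
  have hG2 : IsManifold 𝓘(ℝ, EG) ∞ G := LieGroup.toContMDiffMul.toIsManifold
  let D : G → EG [⋀^Fin 2]→L[ℝ] EG := extD (maurerCartan EG G)
  have hs := smoothForm_maurerCartan (EG := EG) (G := G)
  have h1 : D 1 = 0 := by
    have h := extD_pullForm (f := fun z : G => z⁻¹) (x := 1) (hs.at _)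
      (contMDiff_inv 𝓘(ℝ, EG) ∞).contMDiffAt
    rw [pullForm_inv_maurerCartan, ← neg_one_smul ℝ, extD_smul] at h
    ext v
    have h' := congrArg (fun T : EG [⋀^Fin 2]→L[ℝ] EG => T v) h
    have h2 : (-1 : ℝ) • D 1 v = D (1⁻¹) fun i =>
        (tderiv (fun z : G => z⁻¹) 1 : EG →L[ℝ] EG) (v i) := h'
    rw [inv_one] at h2
    have h3 : (fun i => (tderiv (fun z : G => z⁻¹) 1 : EG →L[ℝ] EG) (v i)) =
        fun i => (fun _ : Fin 2 => (-1 : ℝ)) i • v i := by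
      funext i
      rw [tderiv_inv_one, neg_one_smul]
    have h4 : D 1 (fun i => (fun _ : Fin 2 => (-1 : ℝ)) i • v i) = D 1 v :=
      ((D 1).toMultilinearMap.map_smul_univ (fun _ => (-1 : ℝ)) v).trans (by simp)
    rw [h3, h4, neg_one_smul] at h2
    exact eq_zero_of_neg_eq h2
  have h := extD_pullForm (f := fun z : G => g⁻¹ * z) (x := g) (hs.at _)
    (contMDiff_mul_left (I := 𝓘(ℝ, EG)) (n := ∞)).contMDiffAt
  rw [pullForm_mul_left_maurerCartan] at h
  ext v
  refine (congrArg (fun T : EG [⋀^Fin 2]→L[ℝ] EG => T v) h).trans ?_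
  change D (g⁻¹ * g) _ = 0
  rw [inv_mul_cancel, h1]
  rfl

end AbelianGroup

/-! ### The curvature of a connection -/

section Curvature

variable {E : Type*} [NormedAddCommGroup E] [NormedSpace ℝ E]
  {M : Type*} [TopologicalSpace M] [ChartedSpace E M] [IsManifold 𝓘(ℝ, E) ∞ M]
  {EG : Type*} [NormedAddCommGroup EG] [NormedSpace ℝ EG] [CompleteSpace EG]
  {G : Type*} [TopologicalSpace G] [ChartedSpace EG G] [CommGroup G] [LieGroup 𝓘(ℝ, EG) ∞ G]
  {EP : Type*} [NormedAddCommGroup EP] [NormedSpace ℝ EP]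
  {P : Type*} [TopologicalSpace P] [ChartedSpace EP P] [IsManifold 𝓘(ℝ, EP) ∞ P]
  [MulAction (MulOpposite G) P] {pr : P → M}

theorem Ad_eq (g : G) (ξ : EG) : Ad EG g ξ = ξ := by
  have h : (fun h : G => g * h * g⁻¹) = fun h => h := by
    funext h
    rw [mul_comm g h, mul_inv_cancel_right]
  change (tderiv (fun h : G => g * h * g⁻¹) 1 : EG →L[ℝ] EG) ξ = ξ
  rw [h, tderiv_id]

/-- A local section `σ` of a principal bundle, with the map `γ` to the group for which
`p = σ (pr p) · γ p`. -/
theorem exists_section (hpr : IsPrincipalBundle E EG G EP pr) (x : M) :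
    ∃ (σ : M → P) (γ : P → G) (U : Set M), IsOpen U ∧ x ∈ U ∧
      (∀ z ∈ U, ContMDiffAt 𝓘(ℝ, E) 𝓘(ℝ, EP) ∞ σ z ∧ pr (σ z) = z) ∧
      ∀ p, pr p ∈ U → ContMDiffAt 𝓘(ℝ, EP) 𝓘(ℝ, EG) ∞ γ p ∧
        MulOpposite.op (γ p) • σ (pr p) = p := by
  obtain ⟨U, hU, hx, e, hes, het, hsm, hsm', he⟩ := hpr.locally_trivial x
  have hmem : ∀ z ∈ U, (z, (1 : G)) ∈ e.target := fun z hz => by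
    rw [het]
    exact ⟨hz, trivial⟩
  have hσ : ∀ z ∈ U, pr (e.symm (z, 1)) = z := fun z hz => by
    have h1 := (he _ (e.map_target (hmem z hz))).1
    rw [e.right_inv (hmem z hz)] at h1
    exact h1.symm
  refine ⟨fun z => e.symm (z, 1), fun p => (e p).2, U, hU, hx, fun z hz => ⟨?_, hσ z hz⟩,
    fun p hp => ?_⟩
  · have h1 := hsm'.contMDiffAt (e.open_target.mem_nhds (hmem z hz))
    exact ContMDiffAt.comp z h1 (contMDiffAt_id.prodMk contMDiffAt_const)
  · have hp' : p ∈ e.source := by rw [hes]; exact hp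
    refine ⟨contMDiffAt_snd.comp p (hsm.contMDiffAt (e.open_source.mem_nhds hp')), ?_⟩
    have hq : e.symm (pr p, 1) ∈ e.source := e.map_target (hmem _ hp)
    have hq' : MulOpposite.op (e p).2 • e.symm (pr p, 1) ∈ e.source := by
      rw [hes, Set.mem_preimage, hpr.proj_act, hσ _ hp]
      exact hp
    refine e.injOn hq' hp' ?_
    rw [(he _ hq).2, hσ _ hp, e.right_inv (hmem _ hp), one_mul, ← (he p hp').1]

theorem vec_eq {X : Type*} (u : Fin 1 → X) : u = ![u 0] := by
  funext i
  fin_cases i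
  rfl

theorem vec₂_eq {X : Type*} (u : Fin 2 → X) : u = ![u 0, u 1] := by
  funext i
  fin_cases i <;> rfl

/-- In a local trivialization a connection is the sum of the pullback of a form on the base and of
the Maurer-Cartan form of the group. -/
theorem IsConnection.eq_add (hpr : IsPrincipalBundle E EG G EP pr) {A : DForm EP P 1 EG}
    (hA : IsConnection EG G A) {σ : M → P} {γ : P → G} {U : Set M} (hU : IsOpen U)
    (hσ : ∀ z ∈ U, ContMDiffAt 𝓘(ℝ, E) 𝓘(ℝ, EP) ∞ σ z)
    (hγ : ∀ p, pr p ∈ U → ContMDiffAt 𝓘(ℝ, EP) 𝓘(ℝ, EG) ∞ γ p ∧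
        MulOpposite.op (γ p) • σ (pr p) = p) {p : P} (hp : pr p ∈ U) :
    A p = (pullForm pr (pullForm (E' := E) σ A) + pullForm γ (maurerCartan EG G) :
      DForm EP P 1 EG) p := by
  have hpr' : MDifferentiableAt 𝓘(ℝ, EP) 𝓘(ℝ, E) pr p :=
    hpr.smooth_proj.contMDiffAt.mdifferentiableAt (by simp)
  have hσ' : MDifferentiableAt 𝓘(ℝ, E) 𝓘(ℝ, EP) σ (pr p) := (hσ _ hp).mdifferentiableAt (by simp)
  have hγ' : MDifferentiableAt 𝓘(ℝ, EP) 𝓘(ℝ, EG) γ p := (hγ p hp).1.mdifferentiableAt (by simp)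
  have hact : ∀ q, MDifferentiableAt (𝓘(ℝ, EP).prod 𝓘(ℝ, EG)) 𝓘(ℝ, EP)
      (fun q : P × G => MulOpposite.op q.2 • q.1) q := fun q =>
    hpr.smooth_act.contMDiffAt.mdifferentiableAt (by simp)
  have hloc : (fun q => MulOpposite.op (γ q) • σ (pr q)) =ᶠ[nhds p] fun q => q := by
    filter_upwards [hpr.smooth_proj.continuous.continuousAt.eventually (hU.mem_nhds hp)] with q hq
    exact (hγ q hq).2
  have hfib : ∀ v : EP, fiber A p ![v] = fiber A (σ (pr p))
      ![(tderiv σ (pr p) : E →L[ℝ] EP) ((tderiv pr p : EP →L[ℝ] E) v)] +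
      (tderiv (fun z : G => (γ p)⁻¹ * z) (γ p) : EG →L[ℝ] EG)
        ((tderiv γ p : EP →L[ℝ] EG) v) := by
    intro v
    have h1 := tderiv_comp₂ (F := fun q : P × G => MulOpposite.op q.2 • q.1)
      (f := fun q => σ (pr q)) (g := γ) (hact _) (hσ'.comp p hpr') hγ' v
    rw [tderiv_congr hloc, tderiv_id, tderiv_comp hσ' hpr'] at h1
    set w : EP := (tderiv σ (pr p) : E →L[ℝ] EP) ((tderiv pr p : EP →L[ℝ] E) v)
    set ξ : EG := (tderiv γ p : EP →L[ℝ] EG) v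
    have h2 : fiber A p ![(tderiv (fun z => MulOpposite.op (γ p) • z) (σ (pr p)) : EP →L[ℝ] EP) w] =
        fiber A (σ (pr p)) ![w] := by
      have h := hA.equivariant (σ (pr p)) (γ p) w
      rw [Ad_eq] at h
      have h' : fiber A (MulOpposite.op (γ p) • σ (pr p))
        ![(tderiv (fun z => MulOpposite.op (γ p) • z) (σ (pr p)) : EP →L[ℝ] EP) w] =
          fiber A (σ (pr p)) ![w] := h
      rwa [(hγ p hp).2] at h'
    have h3 : fiber A p ![(tderiv (fun z => MulOpposite.op z • σ (pr p)) (γ p) : EG →L[ℝ] EP) ξ] =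
        (tderiv (fun z : G => (γ p)⁻¹ * z) (γ p) : EG →L[ℝ] EG) ξ := by
      have h4 : (fun z => MulOpposite.op z • σ (pr p)) =
          fun z => MulOpposite.op ((γ p)⁻¹ * z) • p := by
        funext z
        conv_rhs => rw [← (hγ p hp).2, smul_smul, ← MulOpposite.op_mul,
          (hγ p hp).2, mul_inv_cancel_left]
      have h5 := tderiv_comp (g := fun z : G => MulOpposite.op z • p)
        (f := fun z : G => (γ p)⁻¹ * z) (x := γ p)
        ((hact (p, _)).comp ((γ p)⁻¹ * γ p) (mdifferentiableAt_const.prodMk mdifferentiableAt_id))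
        (mdifferentiable_mul_left _ _) ξ
      rw [inv_mul_cancel] at h5
      rw [h4, h5]
      exact hA.vertical p _
    have h6 : fiber A p ![v] = fiber A p
        ![(tderiv (fun z => MulOpposite.op (γ p) • z) (σ (pr p)) : EP →L[ℝ] EP) w] +
        fiber A p ![(tderiv (fun z => MulOpposite.op z • σ (pr p)) (γ p) : EG →L[ℝ] EP) ξ] := by
      have h7 := (fiber A p).toMultilinearMap.map_update_add ![v] 0
        ((tderiv (fun z => MulOpposite.op (γ p) • z) (σ (pr p)) : EP →L[ℝ] EP) w)
        ((tderiv (fun z => MulOpposite.op z • σ (pr p)) (γ p) : EG →L[ℝ] EP) ξ)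
      rw [← h1] at h7
      have h8 : ∀ a : EP, Function.update ![v] 0 a = ![a] := fun a => by
        funext i
        fin_cases i
        rfl
      simp only [h8] at h7
      exact h7
    rw [h6, h2, h3]
  ext v
  rw [vec_eq v]
  refine (hfib (v 0)).trans ?_
  change _ = fiber A (σ (pr p)) _ + _
  congr 2
  funext i
  fin_cases i
  rfl

/-- The form `dA` is basic: locally, it is the pullback of a form on the base, because the
Maurer-Cartan form is closed. -/
theorem extD_eq_pullForm_section (hpr : IsPrincipalBundle E EG G EP pr) {A : DForm EP P 1 EG}
    (hA : IsConnection EG G A) {σ : M → P} {γ : P → G} {U : Set M} (hU : IsOpen U)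
    (hσ : ∀ z ∈ U, ContMDiffAt 𝓘(ℝ, E) 𝓘(ℝ, EP) ∞ σ z)
    (hγ : ∀ p, pr p ∈ U → ContMDiffAt 𝓘(ℝ, EP) 𝓘(ℝ, EG) ∞ γ p ∧
        MulOpposite.op (γ p) • σ (pr p) = p) {p : P} (hp : pr p ∈ U) :
    extD A p = pullForm pr (pullForm (E' := E) σ (extD A)) p := by
  have hG2 : IsManifold 𝓘(ℝ, EG) ∞ G := LieGroup.toContMDiffMul.toIsManifold
  have h1 : SmoothFormAt (pullForm (E' := E) σ A) (pr p) := (hA.smooth.at _).pullForm (hσ _ hp)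
  have h2 := h1.pullForm (f := pr) (x := p) hpr.smooth_proj.contMDiffAt
  have h3 := ((smoothForm_maurerCartan (EG := EG) (G := G)).at (γ p)).pullForm (hγ p hp).1
  rw [extD_congr (β := pullForm pr (pullForm (E' := E) σ A) + pullForm γ (maurerCartan EG G)),
    extD_add h2 h3, extD_pullForm h1 hpr.smooth_proj.contMDiffAt,
    extD_pullForm (smoothForm_maurerCartan.at _) (hγ p hp).1]
  · have h4 : pullForm (E' := EP) γ (extD (maurerCartan EG G)) p = 0 := by
      simp only [pullForm, extD_maurerCartan]
      rfl
    rw [h4, add_zero]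
    simp only [pullForm]
    rw [extD_pullForm (hA.smooth.at _) (hσ _ hp)]
    rfl
  · filter_upwards [hpr.smooth_proj.continuous.continuousAt.eventually (hU.mem_nhds hp)] with q hq
    exact hA.eq_add hpr hU hσ hγ hq

/-- The curvature of a connection exists: in a local trivialization it is the exterior derivative of
the local connection form. -/
theorem exists_isCurvature (hpr : IsPrincipalBundle E EG G EP pr) {A : DForm EP P 1 EG}
    (hA : IsConnection EG G A) : ∃ F : DForm E M 2 EG, IsCurvature G pr A F := by
  choose σ γ U hU hxU hσ hγ using exists_section hpr
  refine ⟨fun x => pullForm (E' := E) (σ x) (extD A) x, fun p u v => ?_⟩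
  rw [lieBr_eq_zero, add_zero, extD_eq_pullForm_section hpr hA (hU (pr p))
    (fun z hz => (hσ _ z hz).1) (hγ _) (hxU _)]
  rfl

/-- A form on the base is determined by its pullback, through a local section. -/
theorem eq_pullForm_section {σ : M → P} {U : Set M} (hU : IsOpen U)
    (hpr : IsPrincipalBundle E EG G EP pr)
    (hσ : ∀ z ∈ U, ContMDiffAt 𝓘(ℝ, E) 𝓘(ℝ, EP) ∞ σ z ∧ pr (σ z) = z) {z : M} (hz : z ∈ U)
    {V : Type*} [NormedAddCommGroup V] [NormedSpace ℝ V] {k : ℕ} (F : DForm E M k V) :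
    F z = pullForm σ (pullForm (E' := EP) pr F) z := by
  ext v
  change fiber F z v = fiber F (pr (σ z)) fun i => (tderiv pr (σ z) : EP →L[ℝ] E)
    ((tderiv σ z : E →L[ℝ] EP) (v i))
  rw [(hσ z hz).2]
  congr 1
  funext i
  have h := tderiv_comp (g := pr) (f := σ) (x := z)
    (hpr.smooth_proj.contMDiffAt.mdifferentiableAt (by simp))
    ((hσ z hz).1.mdifferentiableAt (by simp)) (v i)
  rw [← h, tderiv_congr (g := fun z => z)]
  · exact (tderiv_id (E := E) z _).symm
  filter_upwards [hU.mem_nhds hz] with y hy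
  exact (hσ y hy).2

theorem IsCurvature.pullForm_eq {A : DForm EP P 1 EG} {F : DForm E M 2 EG}
    (hF : IsCurvature G pr A F) : pullForm pr F = extD A := by
  refine dform_ext fun p v => ?_
  rw [vec₂_eq v]
  have h := hF p (v 0) (v 1)
  rw [lieBr_eq_zero, add_zero] at h
  exact h

theorem isCurvature_unique (hpr : IsPrincipalBundle E EG G EP pr) {A : DForm EP P 1 EG}
    {F F' : DForm E M 2 EG} (hF : IsCurvature G pr A F) (hF' : IsCurvature G pr A F') : F = F' := by
  funext x
  obtain ⟨σ, γ, U, hU, hx, hσ, -⟩ := exists_section hpr x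
  rw [eq_pullForm_section hU hpr hσ hx F, eq_pullForm_section hU hpr hσ hx F', hF.pullForm_eq,
    hF'.pullForm_eq]

theorem curvature_eq (hpr : IsPrincipalBundle E EG G EP pr) {A : DForm EP P 1 EG}
    {F : DForm E M 2 EG} (hF : IsCurvature G pr A F) : curvature G pr A = F := by
  have h : ∃ F : DForm E M 2 EG, IsCurvature G pr A F := ⟨F, hF⟩
  rw [curvature, dif_pos h]
  exact isCurvature_unique hpr h.choose_spec hF

theorem isCurvature_curvature (hpr : IsPrincipalBundle E EG G EP pr) {A : DForm EP P 1 EG}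
    (hA : IsConnection EG G A) : IsCurvature G pr A (curvature G pr A : DForm E M 2 EG) := by
  obtain ⟨F, hF⟩ := exists_isCurvature hpr hA
  rw [curvature_eq hpr hF]
  exact hF

/-- The curvature is smooth, being `σ^* dA` for local sections `σ`. -/
theorem smoothForm_curvature (hpr : IsPrincipalBundle E EG G EP pr) {A : DForm EP P 1 EG}
    (hA : IsConnection EG G A) : SmoothForm (curvature G pr A : DForm E M 2 EG) := by
  refine smoothForm_iff.2 fun x => ?_
  obtain ⟨σ, γ, U, hU, hx, hσ, -⟩ := exists_section hpr x
  have h1 : SmoothFormAt (pullForm (E' := E) σ (extD A)) x :=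
    (hA.smooth.extD.at _).pullForm (hσ x hx).1
  refine ContDiffAt.congr_of_eventuallyEq h1 (chartRep_congr (mem_extChartAt_source x) ?_)
  filter_upwards [hU.mem_nhds hx] with z hz
  rw [eq_pullForm_section hU hpr hσ hz (curvature G pr A),
    (isCurvature_curvature hpr hA).pullForm_eq]

/-- The curvature is affine along the variations `A + t π^* η`. -/
theorem curvature_add_smul (hpr : IsPrincipalBundle E EG G EP pr) {A : DForm EP P 1 EG}
    (hA : IsConnection EG G A) {η : DForm E M 1 EG} (hη : SmoothForm η) (t : ℝ) :
    curvature G pr (A + t • pullForm pr η) = (curvature G pr A : DForm E M 2 EG) + t • extD η := by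
  refine curvature_eq hpr fun p u v => ?_
  have h := isCurvature_curvature hpr hA p u v
  rw [lieBr_eq_zero, add_zero] at h ⊢
  rw [extD_add (hA.smooth.at p)
    (((hη.at (pr p)).pullForm hpr.smooth_proj.contMDiffAt).const_smul t), extD_smul,
    extD_pullForm (hη.at _) hpr.smooth_proj.contMDiffAt]
  exact congrArg (· + t • pullForm pr (extD η) p ![u, v]) h

end Curvature

/-! ### Linear algebra of alternating maps -/

section LinearAlgebra

variable {n : ℕ} {V : Type*} [NormedAddCommGroup V] [NormedSpace ℝ V]

/-- The standard basis vectors of the model space. -/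
def stdVec (i : Fin (2 * n)) : Model n := EuclideanSpace.single i (1 : ℝ)

/-- The matrix of a linear endomorphism of the model space. -/
def opMatrix (T : Model n →L[ℝ] Model n) : Matrix (Fin (2 * n)) (Fin (2 * n)) ℝ :=
  Matrix.of fun i j => T (stdVec j) i

theorem eq_sum_stdVec (v : Model n) : v = ∑ i, v i • stdVec i := by
  ext j
  simp [stdVec, Pi.single_apply]

theorem opMatrix_apply_eq_sum (T : Model n →L[ℝ] Model n) (j : Fin (2 * n)) :
    T (stdVec j) = ∑ i, opMatrix T i j • stdVec i :=
  eq_sum_stdVec _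

theorem opMatrix_mul (S T : Model n →L[ℝ] Model n) :
    opMatrix (S.comp T) = opMatrix S * opMatrix T := by
  ext i j
  have h : S (T (stdVec j)) = ∑ k, opMatrix T k j • S (stdVec k) := by
    conv_lhs => rw [opMatrix_apply_eq_sum T j, map_sum]
    simp only [map_smul]
  simp only [opMatrix, Matrix.of_apply, ContinuousLinearMap.comp_apply, Matrix.mul_apply] at h ⊢
  rw [h]
  simp [mul_comm]

theorem opMatrix_id : opMatrix (ContinuousLinearMap.id ℝ (Model n)) = 1 := by
  ext i j
  simp [opMatrix, stdVec, PiLp.single_apply, Matrix.one_apply]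

/-- The inner product of alternating maps given by a Gram matrix and a bilinear form on the
values, as in `formInner`. -/
def innerE (Q : Matrix (Fin (2 * n)) (Fin (2 * n)) ℝ) (κ : LinearMap.BilinForm ℝ V) {k : ℕ}
    (f h : Model n [⋀^Fin k]→L[ℝ] V) : ℝ :=
  ((k.factorial : ℝ)⁻¹) * ∑ a : Fin k → Fin (2 * n), ∑ b : Fin k → Fin (2 * n),
    (∏ l, Q⁻¹ (a l) (b l)) * κ (f fun l => stdVec (a l)) (h fun l => stdVec (b l))

/-- The contraction of a `2`-form with the inverse of a matrix, as in `dualLefschetz`. -/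
def lamE (W : Matrix (Fin (2 * n)) (Fin (2 * n)) ℝ) (f : Model n [⋀^Fin 2]→L[ℝ] V) : V :=
  -((1 / 2 : ℝ) • ∑ i, ∑ j, (W⁻¹ i j) • f ![stdVec i, stdVec j])

theorem comp_apply_stdVec {k : ℕ} (f : Model n [⋀^Fin k]→L[ℝ] V) (T : Model n →L[ℝ] Model n)
    (a : Fin k → Fin (2 * n)) :
    f.compContinuousLinearMap T (fun l => stdVec (a l)) =
      ∑ r : Fin k → Fin (2 * n), (∏ l, opMatrix T (r l) (a l)) • f fun l => stdVec (r l) := by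
  have h1 : f.compContinuousLinearMap T (fun l => stdVec (a l)) =
      f.toMultilinearMap fun l => ∑ i, opMatrix T i (a l) • stdVec i := by
    refine congrArg f ?_
    funext l
    exact opMatrix_apply_eq_sum T (a l)
  rw [h1, MultilinearMap.map_sum]
  refine Finset.sum_congr rfl fun r _ => ?_
  exact f.toMultilinearMap.map_smul_univ _ _

/-- The inner product does not depend on the basis in which it is computed. -/
theorem innerE_comp {Q : Matrix (Fin (2 * n)) (Fin (2 * n)) ℝ} (κ : LinearMap.BilinForm ℝ V) {k : ℕ}
    (f h : Model n [⋀^Fin k]→L[ℝ] V) {T : Model n →L[ℝ] Model n} (hT : IsUnit (opMatrix T).det) :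
    innerE ((opMatrix T).transpose * Q * opMatrix T) κ (f.compContinuousLinearMap T)
      (h.compContinuousLinearMap T) = innerE Q κ f h := by
  set t := opMatrix T with ht
  have hinv : ∀ i j, ∑ a, ∑ b, t i a * (t.transpose * Q * t)⁻¹ a b * t j b = Q⁻¹ i j := by
    intro i j
    have h1 : t * (t.transpose * Q * t)⁻¹ * t.transpose = Q⁻¹ := by
      rw [Matrix.mul_inv_rev, Matrix.mul_inv_rev, ← mul_assoc, Matrix.mul_nonsing_inv _ hT, one_mul,
        mul_assoc, Matrix.nonsing_inv_mul _ (by rwa [Matrix.det_transpose]), mul_one]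
    rw [← h1]
    simp only [Matrix.mul_apply, Matrix.transpose_apply, Finset.sum_mul]
    rw [Finset.sum_comm]
  unfold innerE
  congr 1
  simp only [comp_apply_stdVec, map_sum, LinearMap.sum_apply, map_smul, LinearMap.smul_apply,
    smul_eq_mul, Finset.mul_sum]
  -- bring the summations over the coefficients of the base change inside
  have h2 : ∀ r s : Fin k → Fin (2 * n), ∏ l, Q⁻¹ (r l) (s l) =
      ∑ a : Fin k → Fin (2 * n), ∑ b : Fin k → Fin (2 * n),
        ∏ l, (t (r l) (a l) * (t.transpose * Q * t)⁻¹ (a l) (b l) * t (s l) (b l)) := by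
    intro r s
    simp only [← hinv, Finset.prod_univ_sum, Fintype.piFinset_univ]
  simp only [h2, Finset.sum_mul]
  simp only [Finset.prod_mul_distrib]
  rw [← ht]
  calc _ = ∑ a : Fin k → Fin (2 * n), ∑ b : Fin k → Fin (2 * n), ∑ r : Fin k → Fin (2 * n),
        ∑ s : Fin k → Fin (2 * n), (∏ l, t (r l) (a l)) *
          (∏ l, (t.transpose * Q * t)⁻¹ (a l) (b l)) * (∏ l, t (s l) (b l)) *
          κ (f fun l => stdVec (r l)) (h fun l => stdVec (s l)) := by
        refine Finset.sum_congr rfl fun a _ => Finset.sum_congr rfl fun b _ => ?_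
        rw [Finset.sum_comm]
        refine Finset.sum_congr rfl fun r _ => Finset.sum_congr rfl fun s _ => ?_
        ring
    _ = _ := by
        rw [Finset.sum_congr rfl fun a _ => Finset.sum_comm]
        rw [Finset.sum_comm]
        refine Finset.sum_congr rfl fun r _ => ?_
        rw [Finset.sum_congr rfl fun a _ => Finset.sum_comm]
        rw [Finset.sum_comm]

theorem sum_fin_two {X ι : Type*} [AddCommMonoid X] [Fintype ι] (F : (Fin 2 → ι) → X) :
    ∑ a, F a = ∑ i, ∑ j, F ![i, j] := by
  rw [← Fintype.sum_prod_type' (f := fun i j => F ![i, j])]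
  refine Fintype.sum_equiv (finTwoArrowEquiv ι) _ _ fun a => ?_
  congr 1
  exact vec₂_eq a

theorem stdVec_vec₂ (i j : Fin (2 * n)) :
    (fun l => stdVec (![i, j] l)) = ![(stdVec i : Model n), stdVec j] := by
  funext l
  fin_cases l <;> rfl

theorem comp_apply_stdVec₂ (f : Model n [⋀^Fin 2]→L[ℝ] V) (T : Model n →L[ℝ] Model n)
    (i j : Fin (2 * n)) :
    f.compContinuousLinearMap T ![stdVec i, stdVec j] =
      ∑ r, ∑ s, (opMatrix T r i * opMatrix T s j) • f ![stdVec r, stdVec s] := by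
  rw [← stdVec_vec₂, comp_apply_stdVec f T, sum_fin_two]
  simp [stdVec_vec₂]

/-- The contraction with `W⁻¹` does not depend on the basis in which it is computed. -/
theorem lamE_comp {W : Matrix (Fin (2 * n)) (Fin (2 * n)) ℝ}
    (f : Model n [⋀^Fin 2]→L[ℝ] V) {T : Model n →L[ℝ] Model n} (hT : IsUnit (opMatrix T).det) :
    lamE ((opMatrix T).transpose * W * opMatrix T) (f.compContinuousLinearMap T) = lamE W f := by
  set t := opMatrix T with ht
  have hinv : ∀ i j, ∑ a, ∑ b, t i a * (t.transpose * W * t)⁻¹ a b * t j b = W⁻¹ i j := by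
    intro i j
    have h1 : t * (t.transpose * W * t)⁻¹ * t.transpose = W⁻¹ := by
      rw [Matrix.mul_inv_rev, Matrix.mul_inv_rev, ← mul_assoc, Matrix.mul_nonsing_inv _ hT, one_mul,
        mul_assoc, Matrix.nonsing_inv_mul _ (by rwa [Matrix.det_transpose]), mul_one]
    rw [← h1]
    simp only [Matrix.mul_apply, Matrix.transpose_apply, Finset.sum_mul]
    rw [Finset.sum_comm]
  unfold lamE
  congr 2
  simp only [comp_apply_stdVec₂, Finset.smul_sum, ← hinv, Finset.sum_smul, smul_smul]
  rw [← ht]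
  calc _ = ∑ a, ∑ r, ∑ b, ∑ s, ((t.transpose * W * t)⁻¹ a b * (t r a * t s b)) •
          f ![stdVec r, stdVec s] :=
        Finset.sum_congr rfl fun a _ => Finset.sum_comm
    _ = ∑ r, ∑ a, ∑ s, ∑ b, ((t.transpose * W * t)⁻¹ a b * (t r a * t s b)) •
          f ![stdVec r, stdVec s] := by
        rw [Finset.sum_comm]
        exact Finset.sum_congr rfl fun r _ => Finset.sum_congr rfl fun a _ => Finset.sum_comm
    _ = _ := by
        refine Finset.sum_congr rfl fun r _ => ?_
        rw [Finset.sum_comm]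
        refine Finset.sum_congr rfl fun s _ => Finset.sum_congr rfl fun a _ =>
          Finset.sum_congr rfl fun b _ => ?_
        congr 1
        ring

/-- The matrix of an alternating `2`-form of the model space. -/
def matE (f : Model n [⋀^Fin 2]→L[ℝ] ℝ) : Matrix (Fin (2 * n)) (Fin (2 * n)) ℝ :=
  Matrix.of fun i j => f ![stdVec i, stdVec j]

theorem matE_comp (f : Model n [⋀^Fin 2]→L[ℝ] ℝ) (T : Model n →L[ℝ] Model n) :
    matE (f.compContinuousLinearMap T) = (opMatrix T).transpose * matE f * opMatrix T := by
  ext i j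
  simp only [matE, Matrix.of_apply, comp_apply_stdVec₂, Matrix.mul_apply, Matrix.transpose_apply,
    Finset.sum_mul, smul_eq_mul]
  rw [Finset.sum_comm]
  refine Finset.sum_congr rfl fun s _ => Finset.sum_congr rfl fun r _ => ?_
  ring

theorem swap_apply (f : Model n [⋀^Fin 2]→L[ℝ] V) (u v : Model n) : f ![u, v] = -f ![v, u] := by
  have h := f.toAlternatingMap.map_swap ![v, u] (i := 0) (j := 1) (by decide)
  have h2 : (![v, u] ∘ Equiv.swap (0 : Fin 2) 1) = ![u, v] := by
    funext i
    fin_cases i <;> rfl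
  rw [h2] at h
  exact h

theorem matE_transpose (f : Model n [⋀^Fin 2]→L[ℝ] ℝ) : (matE f).transpose = -matE f := by
  ext i j
  simp only [matE, Matrix.transpose_apply, Matrix.of_apply, Matrix.neg_apply]
  exact swap_apply f _ _

theorem matE_inv_transpose (f : Model n [⋀^Fin 2]→L[ℝ] ℝ) :
    ((matE f)⁻¹).transpose = -(matE f)⁻¹ := by
  rw [Matrix.transpose_nonsing_inv, matE_transpose]
  by_cases h : IsUnit (matE f).det
  · refine Matrix.inv_eq_right_inv ?_
    rw [neg_mul_neg, Matrix.mul_nonsing_inv _ h]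
  · have h' : ¬IsUnit (-matE f).det := by
      rw [← matE_transpose, Matrix.det_transpose]
      exact h
    rw [Matrix.nonsing_inv_apply_not_isUnit _ h, Matrix.nonsing_inv_apply_not_isUnit _ h', neg_zero]

/-- `Λ` is the adjoint of the multiplication with the symplectic form: with `Q = W J` and
`J² = -1`, the matrix `Q⁻¹ W Q⁻¹` is `-W⁻¹`. -/
theorem innerE_mul_left {Q : Matrix (Fin (2 * n)) (Fin (2 * n)) ℝ} {w : Model n [⋀^Fin 2]→L[ℝ] ℝ}
    {J : Matrix (Fin (2 * n)) (Fin (2 * n)) ℝ} (hJ : J * J = -1) (hQ : Q = matE w * J)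
    (hQt : Q.transpose = Q) (hW : IsUnit (matE w).det)
    (κ : LinearMap.BilinForm ℝ V) (ξ : V) (f : Model n [⋀^Fin 2]→L[ℝ] V) :
    innerE Q κ ((ContinuousLinearMap.toSpanSingleton ℝ ξ).compContinuousAlternatingMap w) f =
      κ ξ (lamE (matE w) f) := by
  have hQi : Q⁻¹ = -J * (matE w)⁻¹ := by
    refine Matrix.inv_eq_right_inv ?_
    rw [hQ, mul_assoc, ← mul_assoc J, mul_neg, hJ, neg_neg, one_mul, Matrix.mul_nonsing_inv _ hW]
  have hQit : Q⁻¹.transpose = Q⁻¹ := by rw [Matrix.transpose_nonsing_inv, hQt]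
  have h1 : Q⁻¹.transpose * matE w * Q⁻¹ = -(matE w)⁻¹ := by
    rw [hQit, hQi]
    calc -J * (matE w)⁻¹ * matE w * (-J * (matE w)⁻¹)
        = -J * ((matE w)⁻¹ * matE w) * (-J * (matE w)⁻¹) := by simp only [mul_assoc]
      _ = (J * J) * (matE w)⁻¹ := by
          rw [Matrix.nonsing_inv_mul _ hW, mul_one, neg_mul, neg_mul, mul_neg, neg_neg, mul_assoc]
      _ = _ := by rw [hJ, neg_mul, one_mul]
  have h2 : ∀ k l, ∑ i, ∑ j, Q⁻¹ i k * matE w i j * Q⁻¹ j l = -(matE w)⁻¹ k l := by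
    intro k l
    rw [← Matrix.neg_apply, ← h1]
    simp only [Matrix.mul_apply, Matrix.transpose_apply, Finset.sum_mul]
    rw [Finset.sum_comm]
  have h3 : ∀ k l, (matE w)⁻¹ k l = -∑ i, ∑ j, Q⁻¹ i k * matE w i j * Q⁻¹ j l := fun k l => by
    rw [h2, neg_neg]
  unfold innerE lamE
  rw [sum_fin_two]
  simp only [sum_fin_two, Fin.prod_univ_two, stdVec_vec₂, Matrix.cons_val_zero, Matrix.cons_val_one,
    ContinuousLinearMap.compContinuousAlternatingMap_coe, Function.comp_apply,
    ContinuousLinearMap.toSpanSingleton_apply, map_smul, LinearMap.smul_apply, map_neg, map_sum,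
    smul_eq_mul, h3]
  simp only [neg_mul, Finset.sum_neg_distrib, mul_neg, neg_neg, Finset.sum_mul]
  norm_num
  calc _ = ∑ k, ∑ l, ∑ i, ∑ j, Q⁻¹ i k * Q⁻¹ j l *
        (w ![stdVec i, stdVec j] * κ ξ (f ![stdVec k, stdVec l])) := by
        rw [Finset.sum_congr rfl fun i _ => Finset.sum_comm, Finset.sum_comm]
        refine Finset.sum_congr rfl fun k _ => ?_
        rw [Finset.sum_congr rfl fun i _ => Finset.sum_comm, Finset.sum_comm]
    _ = _ := by
        refine Finset.sum_congr rfl fun k _ => Finset.sum_congr rfl fun l _ =>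
          Finset.sum_congr rfl fun i _ => Finset.sum_congr rfl fun j _ => ?_
        simp only [matE, Matrix.of_apply]
        ring

/-- The normalization `Λ Ω = n` of the dual Lefschetz operator. -/
theorem lamE_mul {w : Model n [⋀^Fin 2]→L[ℝ] ℝ} (hW : IsUnit (matE w).det) (ξ : V) :
    lamE (matE w) ((ContinuousLinearMap.toSpanSingleton ℝ ξ).compContinuousAlternatingMap w) =
      (n : ℝ) • ξ := by
  have h1 : ∑ i, ∑ j, (matE w)⁻¹ i j * matE w i j = -(2 * n : ℝ) := by
    have h2 : ((matE w)⁻¹ * matE w).trace = (2 * n : ℝ) := by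
      rw [Matrix.nonsing_inv_mul _ hW, Matrix.trace_one]
      simp
    rw [← h2]
    simp only [Matrix.trace, Matrix.diag, Matrix.mul_apply, ← Finset.sum_neg_distrib]
    refine Finset.sum_congr rfl fun i _ => Finset.sum_congr rfl fun j _ => ?_
    have h3 := congrFun (congrFun (matE_transpose w) i) j
    simp only [Matrix.transpose_apply, Matrix.neg_apply] at h3
    rw [h3]
    ring
  have h4 : lamE (matE w) ((ContinuousLinearMap.toSpanSingleton ℝ ξ).compContinuousAlternatingMap w)
      = (-(1 / 2 * ∑ i, ∑ j, (matE w)⁻¹ i j * matE w i j)) • ξ := by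
    unfold lamE
    simp only [ContinuousLinearMap.compContinuousAlternatingMap_coe, Function.comp_apply,
      ContinuousLinearMap.toSpanSingleton_apply, smul_smul, ← Finset.sum_smul, ← neg_smul]
    rfl
  rw [h4, h1]
  congr 1
  ring

theorem sum_fin_one {X ι : Type*} [AddCommMonoid X] [Fintype ι] (F : (Fin 1 → ι) → X) :
    ∑ a, F a = ∑ i, F ![i] := by
  refine Fintype.sum_equiv (Equiv.funUnique (Fin 1) ι) _ _ fun a => ?_
  congr 1
  exact vec_eq a

theorem innerE_one (Q : Matrix (Fin (2 * n)) (Fin (2 * n)) ℝ) (κ : LinearMap.BilinForm ℝ V)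
    (f h : Model n [⋀^Fin 1]→L[ℝ] V) :
    innerE Q κ f h = ∑ i, ∑ j, Q⁻¹ i j * κ (f ![stdVec i]) (h ![stdVec j]) := by
  have h1 : ∀ i : Fin (2 * n), (fun l => stdVec (![i] l)) = ![(stdVec i : Model n)] := fun i => by
    funext l
    fin_cases l
    rfl
  unfold innerE
  rw [sum_fin_one]
  simp only [sum_fin_one, h1]
  simp

open scoped MatrixOrder in
/-- The inner product of `1`-forms is positive definite: with `Q⁻¹ = Sᵀ S` it is a sum of squares in
the basis given by `S`. -/
theorem innerE_one_self {Q : Matrix (Fin (2 * n)) (Fin (2 * n)) ℝ} (hQ : Q.PosDef)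
    {κ : LinearMap.BilinForm ℝ V} (hκ : ∀ ξ, ξ ≠ 0 → 0 < κ ξ ξ) (f : Model n [⋀^Fin 1]→L[ℝ] V) :
    0 ≤ innerE Q κ f f ∧ (innerE Q κ f f = 0 → f = 0) := by
  have hκ0 : ∀ ξ, 0 ≤ κ ξ ξ := fun ξ => by
    by_cases h : ξ = 0
    · simp [h]
    · exact (hκ ξ h).le
  obtain ⟨S, hS, hS'⟩ : ∃ S : Matrix (Fin (2 * n)) (Fin (2 * n)) ℝ, Q⁻¹ = S.transpose * S ∧
      IsUnit S.det := by
    obtain ⟨S, hS⟩ := CStarAlgebra.nonneg_iff_eq_star_mul_self.mp hQ.inv.posSemidef.nonneg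
    have hS2 : Q⁻¹ = S.transpose * S := by
      rw [hS, Matrix.star_eq_conjTranspose, Matrix.conjTranspose_eq_transpose_of_trivial]
    refine ⟨S, hS2, ?_⟩
    have hd : Q⁻¹.det ≠ 0 := hQ.inv.det_pos.ne'
    rw [hS2, Matrix.det_mul] at hd
    exact (right_ne_zero_of_mul hd).isUnit
  set u : Fin (2 * n) → V := fun l => ∑ i, S l i • f ![stdVec i] with hu
  have h1 : innerE Q κ f f = ∑ l, κ (u l) (u l) := by
    rw [innerE_one, hS]
    simp only [hu, map_sum, LinearMap.sum_apply, map_smul, LinearMap.smul_apply, smul_eq_mul,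
      Matrix.mul_apply, Matrix.transpose_apply, Finset.sum_mul, Finset.mul_sum]
    calc _ = ∑ i, ∑ l, ∑ j, S l i * S l j * κ (f ![stdVec i]) (f ![stdVec j]) :=
          Finset.sum_congr rfl fun i _ => Finset.sum_comm
      _ = _ := by
          rw [Finset.sum_comm]
          refine Finset.sum_congr rfl fun l _ => ?_
          rw [Finset.sum_comm]
          refine Finset.sum_congr rfl fun i _ => Finset.sum_congr rfl fun j _ => ?_
          ring
  refine ⟨by rw [h1]; exact Finset.sum_nonneg fun l _ => hκ0 _, fun h0 => ?_⟩
  rw [h1, Finset.sum_eq_zero_iff_of_nonneg fun l _ => hκ0 _] at h0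
  have h2 : ∀ l, u l = 0 := fun l => by
    by_contra h
    exact (hκ _ h).ne' (h0 l (Finset.mem_univ l))
  have h3 : ∀ i, f ![stdVec i] = 0 := fun i => by
    have h4 : f ![stdVec i] = ∑ l, S⁻¹ i l • u l := by
      simp only [hu, Finset.smul_sum, smul_smul]
      rw [Finset.sum_comm]
      simp only [← Finset.sum_smul, ← Matrix.mul_apply, Matrix.nonsing_inv_mul _ hS']
      simp [Matrix.one_apply, ite_smul]
    rw [h4]
    simp [h2]
  ext v
  rw [vec_eq v, eq_sum_stdVec (v 0)]
  have h5 : f ![∑ i, v 0 i • stdVec i] = ∑ i, v 0 i • f ![stdVec i] := by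
    have h6 := f.toMultilinearMap.map_sum fun (_ : Fin 1) i => v 0 i • stdVec i
    rw [sum_fin_one] at h6
    refine (congrArg f (vec_eq _).symm).trans (h6.trans (Finset.sum_congr rfl fun i _ => ?_))
    have h7 := f.toMultilinearMap.map_smul_univ (fun _ : Fin 1 => v 0 i) ![stdVec i]
    simp only [Finset.univ_unique, Finset.prod_const, Finset.card_singleton, pow_one] at h7
    refine Eq.trans (congrArg f ?_) h7
    funext l
    fin_cases l
    rfl
  rw [h5]
  simp [h3]

end LinearAlgebra

/-! ### Endomorphisms of the model space -/

section LinearAlgebra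

variable {n : ℕ} {V : Type*} [NormedAddCommGroup V] [NormedSpace ℝ V]

theorem apply₂_sum_right (f : Model n [⋀^Fin 2]→L[ℝ] V) (u v : Model n) :
    f ![u, v] = ∑ j, v j • f ![u, stdVec j] := by
  have h : ∀ w : Model n, f.toMultilinearMap.toLinearMap ![u, 0] 1 w = f ![u, w] := fun w => by
    refine congrArg f ?_
    funext l
    fin_cases l <;> simp
  conv_lhs => rw [eq_sum_stdVec v, ← h, map_sum]
  exact Finset.sum_congr rfl fun j _ => by rw [map_smul, h]

/-- The endomorphism of the model space with a given matrix. -/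
def opOf (A : Matrix (Fin (2 * n)) (Fin (2 * n)) ℝ) : Model n →L[ℝ] Model n :=
  ∑ i, ∑ j, A i j • (EuclideanSpace.proj (𝕜 := ℝ) j).smulRight (stdVec i)

theorem opOf_apply (A : Matrix (Fin (2 * n)) (Fin (2 * n)) ℝ) (v : Model n) :
    opOf A v = ∑ i, (∑ j, A i j * v j) • stdVec i := by
  simp [opOf, Finset.sum_smul, smul_smul]

theorem opOf_opMatrix (T : Model n →L[ℝ] Model n) : opOf (opMatrix T) = T := by
  ext1 v
  rw [opOf_apply]
  conv_rhs => rw [eq_sum_stdVec v, map_sum]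
  simp only [map_smul]
  conv_rhs =>
    rw [Finset.sum_congr rfl fun j _ => by rw [opMatrix_apply_eq_sum T j, Finset.smul_sum]]
  rw [Finset.sum_comm]
  simp only [Finset.sum_smul, smul_smul]
  exact Finset.sum_congr rfl fun i _ => Finset.sum_congr rfl fun j _ =>
    congrArg (fun a : ℝ => a • (stdVec i : Model n)) (mul_comm _ _)

theorem opMatrix_opOf (A : Matrix (Fin (2 * n)) (Fin (2 * n)) ℝ) : opMatrix (opOf A) = A := by
  ext i j
  simp [opMatrix, opOf_apply, stdVec, PiLp.single_apply, Pi.single_apply]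

theorem isUnit_det_opMatrix {S T : Model n →L[ℝ] Model n} (h : ∀ v, S (T v) = v) :
    IsUnit (opMatrix T).det := by
  have h1 : opMatrix S * opMatrix T = 1 := by
    rw [← opMatrix_mul, ← opMatrix_id]
    congr 1
    ext1 v
    exact h v
  have h2 := congrArg Matrix.det h1
  rw [Matrix.det_mul, Matrix.det_one] at h2
  exact IsUnit.of_mul_eq_one_right _ h2

/-- The Gram matrix of a bilinear form. -/
def gramE (b : Model n →L[ℝ] Model n →L[ℝ] ℝ) : Matrix (Fin (2 * n)) (Fin (2 * n)) ℝ :=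
  Matrix.of fun i j => b (stdVec i) (stdVec j)

theorem bilin_eq_sum (b : Model n →L[ℝ] Model n →L[ℝ] ℝ) (u v : Model n) :
    b u v = ∑ i, ∑ j, u i * (gramE b i j * v j) := by
  conv_lhs => rw [eq_sum_stdVec u, eq_sum_stdVec v]
  simp only [map_sum, map_smul, _root_.sum_apply, _root_.smul_apply,
    smul_eq_mul, Finset.mul_sum]
  rw [Finset.sum_comm]
  refine Finset.sum_congr rfl fun i _ => Finset.sum_congr rfl fun j _ => ?_
  simp only [gramE, Matrix.of_apply]
  ring

theorem gramE_posDef {b : Model n →L[ℝ] Model n →L[ℝ] ℝ} (hs : ∀ u v, b u v = b v u)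
    (hp : ∀ u, u ≠ 0 → 0 < b u u) : (gramE b).PosDef := by
  refine Matrix.PosDef.of_dotProduct_mulVec_pos ?_ fun x hx => ?_
  · ext i j
    simp only [gramE, Matrix.conjTranspose_apply, Matrix.of_apply, star_trivial]
    exact hs _ _
  · have h := hp (WithLp.toLp 2 x) (fun h0 => hx (by
      funext i
      exact congrArg (fun w : Model n => w i) h0))
    rw [bilin_eq_sum] at h
    simpa [dotProduct, Matrix.mulVec, Finset.mul_sum] using h

end LinearAlgebra

/-! ### The metric and the symplectic form at a point -/

section Pointwise

variable {n : ℕ} {M : Type*} [TopologicalSpace M] [ChartedSpace (Model n) M]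
  [IsManifold 𝓘(ℝ, Model n) ∞ M] {V : Type*} [NormedAddCommGroup V] [NormedSpace ℝ V]

/-- The metric at a point, on the model space. -/
def innerAt (g : RiemMetric n M) (x : M) : Model n →L[ℝ] Model n →L[ℝ] ℝ := g.inner x

theorem metricMatrix_eq (g : RiemMetric n M) (x : M) : metricMatrix g x = gramE (innerAt g x) := rfl

theorem metricMatrix_posDef (g : RiemMetric n M) (x : M) : (metricMatrix g x).PosDef :=
  gramE_posDef (b := innerAt g x) (fun u v => g.symm x u v) (fun u hu => g.pos x u hu)

theorem formInner_eq (g : RiemMetric n M) (κ : LinearMap.BilinForm ℝ V) {k : ℕ}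
    (α β : DForm (Model n) M k V) (x : M) :
    formInner g κ α β x = innerE (metricMatrix g x) κ (fiber α x) (fiber β x) := rfl

theorem formMatrix_eq (Ω : DForm (Model n) M 2 ℝ) (x : M) : formMatrix Ω x = matE (fiber Ω x) := rfl

theorem dualLefschetz_eq (Ω : DForm (Model n) M 2 ℝ) (α : DForm (Model n) M 2 V) (x : M) :
    dualLefschetz Ω α x = lamE (matE (fiber Ω x)) (fiber α x) := rfl

/-- The derivative of the inverse chart at `c`. -/
def chartT (c : M) (y : Model n) : Model n →L[ℝ] Model n :=
  tderiv (extChartAt 𝓘(ℝ, Model n) c).symm y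

theorem isUnit_det_chartT {c : M} {y : Model n} (hy : y ∈ (extChartAt 𝓘(ℝ, Model n) c).target) :
    IsUnit (opMatrix (chartT c y)).det :=
  isUnit_det_opMatrix (S := tderiv (extChartAt 𝓘(ℝ, Model n) c)
    ((extChartAt 𝓘(ℝ, Model n) c).symm y)) (mfderiv_extChartAt_comp_mfderiv_symm hy)

theorem chartRep_eq_comp {k : ℕ} (c : M) (α : DForm (Model n) M k V) (y : Model n) :
    chartRep c α y = (fiber α ((extChartAt 𝓘(ℝ, Model n) c).symm y)).compContinuousLinearMap
      (chartT c y) := rfl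

theorem chartGram_eq (g : RiemMetric n M) (c : M) (y : Model n) :
    chartGram g c y = (opMatrix (chartT c y)).transpose *
      metricMatrix g ((extChartAt 𝓘(ℝ, Model n) c).symm y) * opMatrix (chartT c y) := by
  ext i j
  have h := bilin_eq_sum (innerAt g ((extChartAt 𝓘(ℝ, Model n) c).symm y))
    (chartT c y (stdVec i)) (chartT c y (stdVec j))
  refine Eq.trans (show _ = _ from h) ?_
  simp only [Matrix.mul_apply, Matrix.transpose_apply, Finset.sum_mul, metricMatrix_eq]
  rw [Finset.sum_comm]
  refine Finset.sum_congr rfl fun a _ => Finset.sum_congr rfl fun b _ => ?_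
  simp only [opMatrix, Matrix.of_apply]
  ring

theorem matE_chartRep (Ω : DForm (Model n) M 2 ℝ) (c : M) (y : Model n) :
    matE (chartRep c Ω y) = (opMatrix (chartT c y)).transpose *
      formMatrix Ω ((extChartAt 𝓘(ℝ, Model n) c).symm y) * opMatrix (chartT c y) :=
  matE_comp _ _

/-- The inner product of forms computed in a chart. -/
theorem formInner_symm {c : M} {y : Model n} (hy : y ∈ (extChartAt 𝓘(ℝ, Model n) c).target)
    (g : RiemMetric n M) (κ : LinearMap.BilinForm ℝ V) {k : ℕ} (α β : DForm (Model n) M k V) :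
    formInner g κ α β ((extChartAt 𝓘(ℝ, Model n) c).symm y) =
      innerE (chartGram g c y) κ (chartRep c α y) (chartRep c β y) := by
  rw [chartGram_eq, chartRep_eq_comp, chartRep_eq_comp, innerE_comp κ _ _ (isUnit_det_chartT hy),
    formInner_eq]

/-- The dual Lefschetz operator computed in a chart. -/
theorem dualLefschetz_symm {c : M} {y : Model n} (hy : y ∈ (extChartAt 𝓘(ℝ, Model n) c).target)
    (Ω : DForm (Model n) M 2 ℝ) (α : DForm (Model n) M 2 V) :
    dualLefschetz Ω α ((extChartAt 𝓘(ℝ, Model n) c).symm y) =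
      lamE (matE (chartRep c Ω y)) (chartRep c α y) := by
  rw [matE_chartRep, chartRep_eq_comp, lamE_comp _ (isUnit_det_chartT hy), dualLefschetz_eq,
    formMatrix_eq]

theorem chartGram_posDef {c : M} {y : Model n} (hy : y ∈ (extChartAt 𝓘(ℝ, Model n) c).target)
    (g : RiemMetric n M) : (chartGram g c y).PosDef := by
  rw [chartGram_eq]
  have h := (metricMatrix_posDef g ((extChartAt 𝓘(ℝ, Model n) c).symm y)).conjTranspose_mul_mul_same
    (B := opMatrix (chartT c y)) (Matrix.mulVec_injective_of_isUnit
      ((Matrix.isUnit_iff_isUnit_det _).2 (isUnit_det_chartT hy)))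
  rwa [Matrix.conjTranspose_eq_transpose_of_trivial] at h

/-- The almost complex structure, as a family of endomorphisms of the model space. -/
theorem Compatible.exists_J {Ω : DForm (Model n) M 2 ℝ} {g : RiemMetric n M} (hg : Compatible Ω g) :
    ∃ J : M → Model n →L[ℝ] Model n, ∀ x, (∀ u, J x (J x u) = -u) ∧
      metricMatrix g x = formMatrix Ω x * opMatrix (J x) := by
  choose J hJ hJ' using hg
  refine ⟨J, fun x => ⟨hJ x, ?_⟩⟩
  ext i j
  have h := apply₂_sum_right (fiber Ω x) (stdVec i) ((J x : Model n →L[ℝ] Model n) (stdVec j))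
  refine (hJ' x (frame x i) (frame x j)).trans (h.trans ?_)
  simp only [Matrix.mul_apply, smul_eq_mul]
  exact Finset.sum_congr rfl fun k _ => mul_comm _ _

theorem opMatrix_mul_self {J : Model n →L[ℝ] Model n} (hJ : ∀ u, J (J u) = -u) :
    opMatrix J * opMatrix J = -1 := by
  rw [← opMatrix_mul, ← opMatrix_id]
  ext i j
  simp [opMatrix, hJ]

theorem Compatible.isUnit_det {Ω : DForm (Model n) M 2 ℝ} {g : RiemMetric n M}
    (hg : Compatible Ω g) (x : M) : IsUnit (formMatrix Ω x).det := by
  obtain ⟨J, hJ⟩ := hg.exists_J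
  have h := (metricMatrix_posDef g x).det_pos.ne'
  rw [(hJ x).2, Matrix.det_mul] at h
  exact (left_ne_zero_of_mul h).isUnit

theorem Compatible.isUnit_det_chart {Ω : DForm (Model n) M 2 ℝ} {g : RiemMetric n M}
    (hg : Compatible Ω g) {c : M} {y : Model n} (hy : y ∈ (extChartAt 𝓘(ℝ, Model n) c).target) :
    IsUnit (matE (chartRep c Ω y)).det := by
  rw [matE_chartRep, Matrix.det_mul, Matrix.det_mul, Matrix.det_transpose]
  exact ((isUnit_det_chartT hy).mul (hg.isUnit_det _)).mul (isUnit_det_chartT hy)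

/-- The Riemannian density of a compatible metric is the symplectic one. -/
theorem Compatible.det_chartGram {Ω : DForm (Model n) M 2 ℝ} {g : RiemMetric n M}
    (hg : Compatible Ω g) {c : M} {y : Model n} (hy : y ∈ (extChartAt 𝓘(ℝ, Model n) c).target) :
    (chartGram g c y).det = |(matE (chartRep c Ω y)).det| := by
  obtain ⟨J, hJ⟩ := hg.exists_J
  have hd : (chartGram g c y).det = (matE (chartRep c Ω y)).det *
      (opMatrix (J ((extChartAt 𝓘(ℝ, Model n) c).symm y))).det := by
    rw [chartGram_eq, matE_chartRep, (hJ _).2]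
    simp only [Matrix.det_mul]
    ring
  have hJ1 : |(opMatrix (J ((extChartAt 𝓘(ℝ, Model n) c).symm y))).det| = 1 := by
    have h := congrArg Matrix.det (opMatrix_mul_self (hJ ((extChartAt 𝓘(ℝ, Model n) c).symm y)).1)
    rw [Matrix.det_mul, Matrix.det_neg, Matrix.det_one] at h
    simp only [Fintype.card_fin, pow_mul, neg_one_sq, one_pow, mul_one] at h
    rw [← sq, sq_eq_one_iff] at h
    rcases h with h | h <;> rw [h] <;> simp
  rw [← abs_of_pos (chartGram_posDef hy g).det_pos, hd, abs_mul, hJ1, mul_one]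

/-- The operator `Λ` is the pointwise adjoint of `B ↦ Ω B`. -/
theorem formInner_mulFun {Ω : DForm (Model n) M 2 ℝ} {g : RiemMetric n M} (hg : Compatible Ω g)
    (κ : LinearMap.BilinForm ℝ V) (B : M → V) (α : DForm (Model n) M 2 V) (x : M) :
    formInner g κ (mulFun Ω B) α x = κ (B x) (dualLefschetz Ω α x) := by
  obtain ⟨J, hJ⟩ := hg.exists_J
  refine innerE_mul_left (opMatrix_mul_self (hJ x).1) (hJ x).2 ?_ (hg.isUnit_det x) κ (B x)
    (fiber α x)
  have := (metricMatrix_posDef g x).isHermitian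
  rwa [Matrix.IsHermitian, Matrix.conjTranspose_eq_transpose_of_trivial] at this

theorem dualLefschetz_mulFun {Ω : DForm (Model n) M 2 ℝ} {g : RiemMetric n M} (hg : Compatible Ω g)
    (B : M → V) (x : M) : dualLefschetz Ω (mulFun Ω B) x = (n : ℝ) • B x :=
  lamE_mul (hg.isUnit_det x) (B x)

theorem innerE_comm {Q : Matrix (Fin (2 * n)) (Fin (2 * n)) ℝ} (hQ : Q.transpose = Q)
    {κ : LinearMap.BilinForm ℝ V} (hκ : ∀ ξ ζ, κ ξ ζ = κ ζ ξ) {k : ℕ}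
    (f h : Model n [⋀^Fin k]→L[ℝ] V) : innerE Q κ f h = innerE Q κ h f := by
  unfold innerE
  rw [Finset.sum_comm]
  have hQ' : ∀ i j, Q⁻¹ i j = Q⁻¹ j i := fun i j => by
    conv_lhs => rw [← hQ, ← Matrix.transpose_nonsing_inv]
    rfl
  congr 1
  refine Finset.sum_congr rfl fun a _ => Finset.sum_congr rfl fun b _ => ?_
  rw [hκ, Finset.prod_congr rfl fun l _ => hQ' (b l) (a l)]

theorem formInner_comm (g : RiemMetric n M) {κ : LinearMap.BilinForm ℝ V}
    (hκ : ∀ ξ ζ, κ ξ ζ = κ ζ ξ) {k : ℕ} (α β : DForm (Model n) M k V) (x : M) :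
    formInner g κ α β x = formInner g κ β α x := by
  have := (metricMatrix_posDef g x).isHermitian
  rw [Matrix.IsHermitian, Matrix.conjTranspose_eq_transpose_of_trivial] at this
  exact innerE_comm this hκ _ _

theorem formInner_add_left (g : RiemMetric n M) (κ : LinearMap.BilinForm ℝ V) {k : ℕ}
    (α α' β : DForm (Model n) M k V) (x : M) :
    formInner g κ (α + α') β x = formInner g κ α β x + formInner g κ α' β x := by
  simp only [formInner, Pi.add_apply, ContinuousAlternatingMap.add_apply, map_add,
    LinearMap.add_apply, mul_add, Finset.sum_add_distrib]

theorem formInner_smul_left (g : RiemMetric n M) (κ : LinearMap.BilinForm ℝ V) {k : ℕ} (a : ℝ)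
    (α β : DForm (Model n) M k V) (x : M) :
    formInner g κ (a • α) β x = a * formInner g κ α β x := by
  simp only [formInner, Pi.smul_apply, ContinuousAlternatingMap.smul_apply, map_smul,
    LinearMap.smul_apply, smul_eq_mul, Finset.mul_sum]
  exact Finset.sum_congr rfl fun i _ => Finset.sum_congr rfl fun j _ => by ring

theorem dualLefschetz_add (Ω : DForm (Model n) M 2 ℝ) (α β : DForm (Model n) M 2 V) :
    dualLefschetz Ω (α + β) = dualLefschetz Ω α + dualLefschetz Ω β := by
  funext x
  simp only [dualLefschetz, Pi.add_apply, ContinuousAlternatingMap.add_apply, smul_add,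
    Finset.sum_add_distrib, neg_add]

theorem dualLefschetz_smul (Ω : DForm (Model n) M 2 ℝ) (a : ℝ) (α : DForm (Model n) M 2 V) :
    dualLefschetz Ω (a • α) = a • dualLefschetz Ω α := by
  funext x
  simp only [dualLefschetz, Pi.smul_apply, ContinuousAlternatingMap.smul_apply, smul_neg,
    Finset.smul_sum]
  congr 1
  exact Finset.sum_congr rfl fun i _ => Finset.sum_congr rfl fun j _ => by
    simp only [smul_smul]; congr 1; ring

end Pointwise

/-! ### Smoothness of the pointwise operations -/

section Smoothness

variable {n : ℕ} {M : Type*} [TopologicalSpace M] [ChartedSpace (Model n) M]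
  [IsManifold 𝓘(ℝ, Model n) ∞ M] {V : Type*} [NormedAddCommGroup V] [NormedSpace ℝ V]

/-- The coordinates of a smooth metric are smooth: they are its values on the coordinate vector
fields, which are smooth sections of the tangent bundle along the inverse chart. -/
theorem contDiffAt_chartGram (g : RiemMetric n M) {c : M} {y : Model n}
    (hy : y ∈ (extChartAt 𝓘(ℝ, Model n) c).target) (i j : Fin (2 * n)) :
    ContDiffAt ℝ ∞ (fun z => chartGram g c z i j) y := by
  set e := extChartAt 𝓘(ℝ, Model n) c with he
  have hvec : ∀ i : Fin (2 * n), ContMDiffAt 𝓘(ℝ, Model n) (𝓘(ℝ, Model n).prod 𝓘(ℝ, Model n)) ∞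
      (fun z => (Bundle.TotalSpace.mk' (Model n) (E := fun x : M => TangentSpace 𝓘(ℝ, Model n) x)
        (e.symm z) (mfderiv 𝓘(ℝ, Model n) 𝓘(ℝ, Model n) e.symm z
          (stdVec i : Model n)))) y := by
    intro i
    have h1 := (contMDiffOn_extChartAt_symm (I := 𝓘(ℝ, Model n)) (n := ∞)
      c).contMDiffOn_tangentMapWithin (m := ∞) (by simp) (isOpen_extChartAt_target c).uniqueMDiffOn
    have h2 : ContMDiffAt 𝓘(ℝ, Model n) (𝓘(ℝ, Model n).prod 𝓘(ℝ, Model n)) ∞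
      (fun z => (Bundle.TotalSpace.mk' (Model n)
        (E := fun x : Model n => TangentSpace 𝓘(ℝ, Model n) x) z (stdVec i : Model n))) y :=
      contMDiffAt_vectorSpace_iff_contDiffAt.2 contDiffAt_const
    have h3 := (h1.contMDiffAt (x := ⟨y, (stdVec i : Model n)⟩) ?_).comp y h2
    · refine h3.congr_of_eventuallyEq ?_
      filter_upwards [eventually_mem_target hy] with z hz
      simp only [Function.comp_apply, tangentMapWithin]
      rw [mfderivWithin_of_isOpen (isOpen_extChartAt_target c) hz]
    · exact ((isOpen_extChartAt_target c).preimage (FiberBundle.continuous_proj (Model n)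
        (fun x : Model n => TangentSpace 𝓘(ℝ, Model n) x))).mem_nhds hy
  have h := ContMDiffAt.clm_bundle_apply₂ (F₁ := Model n) (F₂ := Model n) (F₃ := ℝ)
    (E₃ := Bundle.Trivial M ℝ) (b := e.symm)
    (ψ := fun z => g.inner (e.symm z)) (x := y) (n := ∞) (IB := 𝓘(ℝ, Model n))
    ((g.contMDiff.contMDiffAt (x := e.symm y)).comp y (contMDiffAt_extChartAt_symm hy))
    (hvec i) (hvec j)
  simp only [Bundle.contMDiffAt_totalSpace] at h
  exact h.2.contDiffAt

theorem contDiffAt_det {X : Type*} [NormedAddCommGroup X] [NormedSpace ℝ X] {ι : Type*} [Fintype ι]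
    [DecidableEq ι] {A : X → Matrix ι ι ℝ} {x : X} {r : WithTop ℕ∞}
    (hA : ∀ i j, ContDiffAt ℝ r (fun z => A z i j) x) : ContDiffAt ℝ r (fun z => (A z).det) x := by
  simp only [Matrix.det_apply]
  refine ContDiffAt.sum fun σ _ => ?_
  exact (contDiffAt_prod fun i _ => hA _ _).const_smul _

theorem contDiffAt_matrix_inv {X : Type*} [NormedAddCommGroup X] [NormedSpace ℝ X] {ι : Type*}
    [Fintype ι] [DecidableEq ι] {A : X → Matrix ι ι ℝ} {x : X} {r : WithTop ℕ∞}
    (hA : ∀ i j, ContDiffAt ℝ r (fun z => A z i j) x) (h0 : IsUnit (A x).det) (i j : ι) :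
    ContDiffAt ℝ r (fun z => (A z)⁻¹ i j) x := by
  have h1 : (fun z => (A z)⁻¹ i j) = fun z =>
      ((A z).det)⁻¹ * ((A z).updateRow j (Pi.single i 1)).det := by
    funext z
    rw [Matrix.inv_def, Matrix.smul_apply, Matrix.adjugate_apply, Ring.inverse_eq_inv', smul_eq_mul]
  rw [h1]
  refine ((contDiffAt_det hA).inv h0.ne_zero).mul (contDiffAt_det fun a b => ?_)
  by_cases h : a = j
  · subst h
    simp only [Matrix.updateRow_self]
    exact contDiffAt_const
  · simp only [Matrix.updateRow_ne h]
    exact hA a b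

theorem SmoothForm.contDiffAt {k : ℕ} {α : DForm (Model n) M k V} (hα : SmoothForm α) {c : M}
    {y : Model n} (hy : y ∈ (extChartAt 𝓘(ℝ, Model n) c).target) :
    ContDiffAt ℝ ∞ (chartRep c α) y :=
  (hα c).contDiffAt ((isOpen_extChartAt_target c).mem_nhds hy)

theorem SmoothForm.contDiffAt_apply {k : ℕ} {α : DForm (Model n) M k V} (hα : SmoothForm α) {c : M}
    {y : Model n} (hy : y ∈ (extChartAt 𝓘(ℝ, Model n) c).target) (v : Fin k → Model n) :
    ContDiffAt ℝ ∞ (fun z => chartRep c α z v) y :=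
  (ContinuousAlternatingMap.apply ℝ (Model n) V v).contDiff.contDiffAt.comp y (hα.contDiffAt hy)

theorem contDiffAt_bilin [FiniteDimensional ℝ V] (κ : LinearMap.BilinForm ℝ V) {X : Type*}
    [NormedAddCommGroup X] [NormedSpace ℝ X] {a b : X → V} {x : X} {r : WithTop ℕ∞}
    (ha : ContDiffAt ℝ r a x) (hb : ContDiffAt ℝ r b x) :
    ContDiffAt ℝ r (fun z => κ (a z) (b z)) x :=
  ((LinearMap.toContinuousBilinearMap κ).contDiff.contDiffAt.comp x ha).clm_apply hb

/-- Smoothness of functions on a manifold, tested in the charts. -/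
theorem contMDiff_of_comp_symm {f : M → V}
    (h : ∀ (c : M), ∀ y ∈ (extChartAt 𝓘(ℝ, Model n) c).target,
      ContDiffAt ℝ ∞ (fun z => f ((extChartAt 𝓘(ℝ, Model n) c).symm z)) y) :
    ContMDiff 𝓘(ℝ, Model n) 𝓘(ℝ, V) ∞ f := by
  intro x
  have h1 : ContMDiffAt 𝓘(ℝ, Model n) 𝓘(ℝ, V) ∞
      ((fun z => f ((extChartAt 𝓘(ℝ, Model n) x).symm z)) ∘ extChartAt 𝓘(ℝ, Model n) x) x :=
    (h x _ (mem_extChartAt_target x)).contMDiffAt.comp x (contMDiffAt_extChartAt)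
  refine h1.congr_of_eventuallyEq ?_
  filter_upwards [extChartAt_source_mem_nhds (I := 𝓘(ℝ, Model n)) x] with z hz
  simp only [Function.comp_apply, (extChartAt 𝓘(ℝ, Model n) x).left_inv hz]

theorem contDiffAt_comp_symm {f : M → V} (hf : ContMDiff 𝓘(ℝ, Model n) 𝓘(ℝ, V) ∞ f) {c : M}
    {y : Model n} (hy : y ∈ (extChartAt 𝓘(ℝ, Model n) c).target) :
    ContDiffAt ℝ ∞ (fun z => f ((extChartAt 𝓘(ℝ, Model n) c).symm z)) y :=
  ((hf.contMDiffAt).comp y (contMDiffAt_extChartAt_symm hy)).contDiffAt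

theorem contMDiff_formInner [FiniteDimensional ℝ V] (g : RiemMetric n M)
    (κ : LinearMap.BilinForm ℝ V) {k : ℕ} {α β : DForm (Model n) M k V} (hα : SmoothForm α)
    (hβ : SmoothForm β) : ContMDiff 𝓘(ℝ, Model n) 𝓘(ℝ, ℝ) ∞ (formInner g κ α β) := by
  refine contMDiff_of_comp_symm fun c y hy => ?_
  have h1 : ContDiffAt ℝ ∞
      (fun z => innerE (chartGram g c z) κ (chartRep c α z) (chartRep c β z)) y := by
    unfold innerE
    refine contDiffAt_const.mul (ContDiffAt.sum fun a _ => ContDiffAt.sum fun b _ => ?_)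
    refine (contDiffAt_prod fun l _ => ?_).mul
      (contDiffAt_bilin κ (hα.contDiffAt_apply hy _) (hβ.contDiffAt_apply hy _))
    exact contDiffAt_matrix_inv (fun i j => contDiffAt_chartGram g hy i j)
      (chartGram_posDef hy g).det_pos.ne'.isUnit _ _
  refine h1.congr_of_eventuallyEq ?_
  filter_upwards [eventually_mem_target hy] with z hz
  exact formInner_symm hz g κ α β

theorem contMDiff_dualLefschetz {Ω : DForm (Model n) M 2 ℝ} {g : RiemMetric n M}
    (hΩ : SmoothForm Ω) (hg : Compatible Ω g) {α : DForm (Model n) M 2 V} (hα : SmoothForm α) :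
    ContMDiff 𝓘(ℝ, Model n) 𝓘(ℝ, V) ∞ (dualLefschetz Ω α) := by
  refine contMDiff_of_comp_symm fun c y hy => ?_
  have h1 : ContDiffAt ℝ ∞ (fun z => lamE (matE (chartRep c Ω z)) (chartRep c α z)) y := by
    unfold lamE
    refine (ContDiffAt.const_smul _ (ContDiffAt.sum fun i _ => ContDiffAt.sum fun j _ => ?_)).neg
    exact (contDiffAt_matrix_inv (fun i j => hΩ.contDiffAt_apply hy _) (hg.isUnit_det_chart hy)
      _ _).smul (hα.contDiffAt_apply hy _)
  refine h1.congr_of_eventuallyEq ?_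
  filter_upwards [eventually_mem_target hy] with z hz
  exact dualLefschetz_symm hz Ω α

theorem contDiffAt_toSpanSingleton_comp {X F : Type*} [NormedAddCommGroup X] [NormedSpace ℝ X]
    [NormedAddCommGroup F] [NormedSpace ℝ F] {k : ℕ} {f : X → F [⋀^Fin k]→L[ℝ] ℝ} {b : X → V}
    {x : X} (hf : ContDiffAt ℝ ∞ f x) (hb : ContDiffAt ℝ ∞ b x) :
    ContDiffAt ℝ ∞ (fun z =>
      (ContinuousLinearMap.toSpanSingleton ℝ (b z)).compContinuousAlternatingMap (f z)) x := by
  have h : IsBoundedBilinearMap ℝ (fun p : V × (F [⋀^Fin k]→L[ℝ] ℝ) =>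
      (ContinuousLinearMap.toSpanSingleton ℝ p.1).compContinuousAlternatingMap p.2) :=
    { add_left := fun b b' f => by ext v; simp
      smul_left := fun a b f => by ext v; simp [smul_smul, mul_comm]
      add_right := fun b f f' => by ext v; simp [add_smul]
      smul_right := fun a b f => by ext v; simp [smul_smul]
      bound := ⟨1, one_pos, fun b f => by
        refine (ContinuousLinearMap.norm_compContinuousAlternatingMap_le _ _).trans ?_
        rw [ContinuousLinearMap.norm_toSpanSingleton, one_mul]⟩ }
  exact h.contDiff.contDiffAt.comp x (hb.prodMk hf)

theorem SmoothForm.mulFun {k : ℕ} {Ω : DForm (Model n) M k ℝ} (hΩ : SmoothForm Ω) {B : M → V}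
    (hB : ContMDiff 𝓘(ℝ, Model n) 𝓘(ℝ, V) ∞ B) : SmoothForm (mulFun Ω B) := by
  intro c y hy
  exact (contDiffAt_toSpanSingleton_comp (hΩ.contDiffAt hy)
    (contDiffAt_comp_symm hB hy)).contDiffWithinAt

/-- The differential of a function, in a chart. -/
theorem chartRep_dFun {B : M → V} (hB : ContMDiff 𝓘(ℝ, Model n) 𝓘(ℝ, V) ∞ B) {c : M}
    {y : Model n} (hy : y ∈ (extChartAt 𝓘(ℝ, Model n) c).target) :
    chartRep c (dFun (E := Model n) B) y =
      ContinuousAlternatingMap.ofSubsingleton ℝ (Model n) V (0 : Fin 1)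
        (fderiv ℝ (fun z => B ((extChartAt 𝓘(ℝ, Model n) c).symm z)) y) := by
  ext v
  have h := tderiv_comp (g := B) (f := (extChartAt 𝓘(ℝ, Model n) c).symm) (x := y)
    (hB.contMDiffAt.mdifferentiableAt (by simp))
    ((contMDiffAt_extChartAt_symm hy).mdifferentiableAt (by simp)) (v 0)
  refine h.symm.trans ?_
  rw [tderiv, mfderiv_eq_fderiv]
  rfl

theorem smoothForm_dFun {B : M → V} (hB : ContMDiff 𝓘(ℝ, Model n) 𝓘(ℝ, V) ∞ B) :
    SmoothForm (dFun (E := Model n) B) := by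
  intro c y hy
  refine ContDiffAt.contDiffWithinAt ?_
  have h1 := (ContinuousAlternatingMap.ofSubsingletonLIE (𝕜 := ℝ) (E := Model n) (F := V)
    (0 : Fin 1)).contDiff.contDiffAt.comp y
      ((contDiffAt_comp_symm hB hy).fderiv_right (m := ∞) (by simp))
  refine h1.congr_of_eventuallyEq ?_
  filter_upwards [eventually_mem_target hy] with z hz
  exact chartRep_dFun hB hz

end Smoothness

open MeasureTheory

/-! ### The Riemannian volume measure -/

section Volume

variable {n : ℕ} {M : Type*} [TopologicalSpace M] [ChartedSpace (Model n) M]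
  [IsManifold 𝓘(ℝ, Model n) ∞ M]

/-- The Riemannian density `√(det gᵢⱼ)` in the chart at `c`. -/
def chartDensity (g : RiemMetric n M) (c : M) (y : Model n) : ℝ := Real.sqrt (chartGram g c y).det

theorem chartDensity_pos (g : RiemMetric n M) {c : M} {y : Model n}
    (hy : y ∈ (extChartAt 𝓘(ℝ, Model n) c).target) : 0 < chartDensity g c y :=
  Real.sqrt_pos.2 (chartGram_posDef hy g).det_pos

theorem contDiffAt_chartDensity (g : RiemMetric n M) {c : M} {y : Model n}
    (hy : y ∈ (extChartAt 𝓘(ℝ, Model n) c).target) : ContDiffAt ℝ ∞ (chartDensity g c) y :=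
  (contDiffAt_det fun i j => contDiffAt_chartGram g hy i j).sqrt (chartGram_posDef hy g).det_pos.ne'

theorem continuousOn_chartDensity (g : RiemMetric n M) (c : M) :
    ContinuousOn (chartDensity g c) (extChartAt 𝓘(ℝ, Model n) c).target := fun _ hy =>
  (contDiffAt_chartDensity g hy).continuousAt.continuousWithinAt

theorem measurableSet_target (c : M) : MeasurableSet (extChartAt 𝓘(ℝ, Model n) c).target :=
  (isOpen_extChartAt_target c).measurableSet

theorem aemeasurable_chartDensity (g : RiemMetric n M) (c : M) :
    AEMeasurable (fun y => ENNReal.ofReal (chartDensity g c y))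
      (volume.restrict (extChartAt 𝓘(ℝ, Model n) c).target) :=
  ((continuousOn_chartDensity g c).aemeasurable (measurableSet_target c)).ennreal_ofReal

theorem chartDensity_eq (g : RiemMetric n M) {c : M} {y : Model n} :
    chartDensity g c y = |(opMatrix (chartT c y)).det| *
      Real.sqrt (metricMatrix g ((extChartAt 𝓘(ℝ, Model n) c).symm y)).det := by
  rw [chartDensity, chartGram_eq, Matrix.det_mul, Matrix.det_mul, Matrix.det_transpose,
    mul_right_comm, ← sq, Real.sqrt_mul (sq_nonneg _), Real.sqrt_sq_eq_abs]

theorem clm_det_eq (T : Model n →L[ℝ] Model n) : T.det = (opMatrix T).det := by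
  have h : opMatrix T = LinearMap.toMatrix (EuclideanSpace.basisFun (Fin (2 * n)) ℝ).toBasis
      (EuclideanSpace.basisFun (Fin (2 * n)) ℝ).toBasis (T : Model n →ₗ[ℝ] Model n) := by
    ext i j
    simp [LinearMap.toMatrix_apply, opMatrix, stdVec]
  rw [h, LinearMap.det_toMatrix]

variable [MeasurableSpace M] [BorelSpace M]

theorem aemeasurable_symm (g : RiemMetric n M) (c : M) :
    AEMeasurable (extChartAt 𝓘(ℝ, Model n) c).symm
      ((volume.restrict (extChartAt 𝓘(ℝ, Model n) c).target).withDensity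
        fun y => ENNReal.ofReal (chartDensity g c y)) :=
  ((continuousOn_extChartAt_symm c).aemeasurable (measurableSet_target c)).mono_ac
    (withDensity_absolutelyContinuous _ _)

theorem measurableSet_target_inter_preimage (c : M) {A : Set M} (hA : MeasurableSet A) :
    MeasurableSet ((extChartAt 𝓘(ℝ, Model n) c).target ∩
      (extChartAt 𝓘(ℝ, Model n) c).symm ⁻¹' A) := by
  have h := (continuousOn_iff_continuous_domRestrict.1
    (continuousOn_extChartAt_symm (I := 𝓘(ℝ, Model n)) c)).measurable hA
  have h2 := (measurableSet_target (n := n) c).subtype_image h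
  convert h2 using 1
  ext y
  simp [and_comm]

theorem chartVolume_eq (g : RiemMetric n M) (c : M) :
    chartVolume g c = Measure.map (extChartAt 𝓘(ℝ, Model n) c).symm
      ((volume.restrict (extChartAt 𝓘(ℝ, Model n) c).target).withDensity
        fun y => ENNReal.ofReal (chartDensity g c y)) := rfl

theorem chartVolume_apply (g : RiemMetric n M) (c : M) {A : Set M} (hA : MeasurableSet A) :
    chartVolume g c A = ∫⁻ y in (extChartAt 𝓘(ℝ, Model n) c).target ∩
      (extChartAt 𝓘(ℝ, Model n) c).symm ⁻¹' A, ENNReal.ofReal (chartDensity g c y) := by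
  rw [chartVolume_eq, Measure.map_apply_of_aemeasurable (aemeasurable_symm g c) hA,
    withDensity_apply', Measure.restrict_restrict' (measurableSet_target c), Set.inter_comm]

/-- The measure `chartVolume g c` is concentrated on the domain of the chart at `c`. -/
theorem chartVolume_inter_source (g : RiemMetric n M) (c : M) {A : Set M} (hA : MeasurableSet A) :
    chartVolume g c (A ∩ (extChartAt 𝓘(ℝ, Model n) c).source) = chartVolume g c A := by
  rw [chartVolume_apply g c hA, chartVolume_apply g c
    (hA.inter (isOpen_extChartAt_source c).measurableSet)]
  congr 2
  ext y
  simp only [Set.mem_inter_iff, Set.mem_preimage]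
  exact ⟨fun h => ⟨h.1, h.2.1⟩, fun h => ⟨h.1, h.2, (extChartAt 𝓘(ℝ, Model n) c).map_target h.1⟩⟩

/-- The change of variables formula for the Riemannian density. -/
theorem chartVolume_eq_of_subset (g : RiemMetric n M) (c c' : M) {A : Set M} (hA : MeasurableSet A)
    (hc : A ⊆ (extChartAt 𝓘(ℝ, Model n) c).source)
    (hc' : A ⊆ (extChartAt 𝓘(ℝ, Model n) c').source) :
    chartVolume g c A = chartVolume g c' A := by
  set e := extChartAt 𝓘(ℝ, Model n) c with he
  set e' := extChartAt 𝓘(ℝ, Model n) c' with he'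
  set φ : Model n → Model n := fun y => e' (e.symm y) with hφ
  have hd : ∀ y ∈ e.target ∩ e.symm ⁻¹' A, DifferentiableAt ℝ φ y := fun y hy =>
    (((contMDiffAt_extChartAt_of_mem (hc' hy.2)).comp y
      (contMDiffAt_extChartAt_symm hy.1)).contDiffAt).differentiableAt (by simp)
  have himg : e'.target ∩ e'.symm ⁻¹' A = φ '' (e.target ∩ e.symm ⁻¹' A) := by
    ext z
    constructor
    · intro hz
      refine ⟨e (e'.symm z), ⟨e.map_source (hc hz.2), ?_⟩, ?_⟩
      · simp only [Set.mem_preimage, e.left_inv (hc hz.2)]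
        exact hz.2
      · simp only [hφ, e.left_inv (hc hz.2), e'.right_inv hz.1]
    · rintro ⟨y, hy, rfl⟩
      refine ⟨e'.map_source (hc' hy.2), ?_⟩
      simp only [Set.mem_preimage, hφ, e'.left_inv (hc' hy.2)]
      exact hy.2
  have hinj : Set.InjOn φ (e.target ∩ e.symm ⁻¹' A) := by
    intro y hy z hz h
    have h1 : e.symm y = e.symm z := e'.injOn (hc' hy.2) (hc' hz.2) h
    exact e.symm.injOn hy.1 hz.1 h1
  have hm := measurableSet_target_inter_preimage (n := n) c hA
  rw [chartVolume_apply g c hA, chartVolume_apply g c' hA, ← he, ← he', himg,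
    lintegral_image_eq_lintegral_abs_det_fderiv_mul volume hm
      (fun y hy => (hd y hy).hasFDerivAt.hasFDerivWithinAt) hinj]
  refine setLIntegral_congr_fun hm fun y hy => ?_
  have hT : chartT c y = (chartT c' (φ y)).comp (fderiv ℝ φ y) := by
    ext1 v
    have h := tderiv_comp (g := e'.symm) (f := φ) (x := y)
      ((contMDiffAt_extChartAt_symm (e'.map_source (hc' hy.2))).mdifferentiableAt (by simp))
      (hd y hy).mdifferentiableAt v
    have hev : (fun z => e'.symm (φ z)) =ᶠ[nhds y] e.symm := by
      filter_upwards [(continuousAt_symm hy.1).preimage_mem_nhds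
        ((isOpen_extChartAt_source (I := 𝓘(ℝ, Model n)) c').mem_nhds (hc' hy.2))] with z hz
      exact e'.left_inv hz
    have h3 : (tderiv (fun z => e'.symm (φ z)) y : Model n →L[ℝ] Model n) = tderiv e.symm y :=
      tderiv_congr hev
    have h4 : (tderiv φ y : Model n →L[ℝ] Model n) = fderiv ℝ φ y := mfderiv_eq_fderiv
    rw [h3, h4] at h
    exact h
  have hφy : e'.symm (φ y) = e.symm y := e'.left_inv (hc' hy.2)
  beta_reduce
  rw [← ENNReal.ofReal_mul (abs_nonneg _), chartDensity_eq, chartDensity_eq, hT, opMatrix_mul,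
    Matrix.det_mul, ← he, ← he', hφy, clm_det_eq, abs_mul]
  congr 1
  ring

/-- On the domain of a chart, the supremum defining the Riemannian volume is attained by the measure
of that chart. -/
theorem riemannianVolume_apply_of_subset (g : RiemMetric n M) (c : M) {A : Set M}
    (hA : MeasurableSet A) (hc : A ⊆ (extChartAt 𝓘(ℝ, Model n) c).source) :
    riemannianVolume g A = chartVolume g c A := by
  refine le_antisymm ?_ (Measure.le_iff'.1 (le_iSup (fun c => chartVolume g c) c) A)
  have hS := (isOpen_extChartAt_source (I := 𝓘(ℝ, Model n)) c).measurableSet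
  -- the right hand side bounds every `chartVolume g c'`, as the measures agree on the overlaps
  have h : riemannianVolume g ≤ chartVolume g c +
      (riemannianVolume g).restrict (extChartAt 𝓘(ℝ, Model n) c).sourceᶜ := by
    refine iSup_le fun c' => Measure.le_iff.2 fun B hB => ?_
    have hS' := (isOpen_extChartAt_source (I := 𝓘(ℝ, Model n)) c').measurableSet
    rw [← measure_inter_add_sdiff B hS, Measure.add_apply, Measure.restrict_apply hB]
    refine add_le_add ?_ (Measure.le_iff'.1 (le_iSup (fun c => chartVolume g c) c') _)
    rw [← chartVolume_inter_source g c' (hB.inter hS), chartVolume_eq_of_subset g c' c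
      ((hB.inter hS).inter hS') Set.inter_subset_right
      (Set.inter_subset_left.trans Set.inter_subset_right)]
    exact measure_mono (Set.inter_subset_left.trans Set.inter_subset_left)
  refine (Measure.le_iff'.1 h A).trans ?_
  rw [Measure.add_apply, Measure.restrict_apply hA, Set.disjoint_iff_inter_eq_empty.1
    (Set.disjoint_compl_right_iff_subset.2 hc), measure_empty, add_zero]

theorem riemannianVolume_restrict_source (g : RiemMetric n M) (c : M) :
    (riemannianVolume g).restrict (extChartAt 𝓘(ℝ, Model n) c).source = chartVolume g c := by
  refine Measure.ext fun A hA => ?_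
  have hS := (isOpen_extChartAt_source (I := 𝓘(ℝ, Model n)) c).measurableSet
  rw [Measure.restrict_apply hA, riemannianVolume_apply_of_subset g c (hA.inter hS)
    Set.inter_subset_right, chartVolume_inter_source g c hA]

/-- Integrals of functions supported in the domain of a chart. -/
theorem integral_riemannianVolume (g : RiemMetric n M) (c : M) {f : M → ℝ}
    (hf : AEStronglyMeasurable f (chartVolume g c))
    (h0 : ∀ x ∉ (extChartAt 𝓘(ℝ, Model n) c).source, f x = 0) :
    ∫ x, f x ∂(riemannianVolume g) = ∫ y in (extChartAt 𝓘(ℝ, Model n) c).target,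
      chartDensity g c y * f ((extChartAt 𝓘(ℝ, Model n) c).symm y) := by
  rw [← setIntegral_eq_integral_of_forall_compl_eq_zero h0, riemannianVolume_restrict_source]
  rw [chartVolume_eq] at hf ⊢
  rw [integral_map (aemeasurable_symm g c) hf]
  have h := integral_withDensity_eq_integral_toReal_smul₀ (aemeasurable_chartDensity g c)
    (Filter.Eventually.of_forall fun y => ENNReal.ofReal_lt_top)
    (fun y => f ((extChartAt 𝓘(ℝ, Model n) c).symm y))
  refine Eq.trans (show _ = _ from h) ?_
  refine setIntegral_congr_fun (measurableSet_target c) fun y hy => ?_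
  simp only [ENNReal.toReal_ofReal (chartDensity_pos g hy).le, smul_eq_mul]

/-- The volume is locally finite, the density in a chart being locally bounded. -/
instance isLocallyFiniteMeasure_riemannianVolume (g : RiemMetric n M) :
    IsLocallyFiniteMeasure (riemannianVolume g) := by
  refine ⟨fun x => ?_⟩
  set e := extChartAt 𝓘(ℝ, Model n) x with he
  have hy : e x ∈ e.target := mem_extChartAt_target x
  obtain ⟨r, hr, hball⟩ := Metric.mem_nhds_iff.1 (Filter.inter_mem (eventually_mem_target hy)
    ((contDiffAt_chartDensity g hy).continuousAt.preimage_mem_nhds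
      (Iio_mem_nhds (lt_add_one (chartDensity g x (e x))))))
  refine ⟨e.source ∩ e ⁻¹' (Metric.ball (e x) r), ?_, ?_⟩
  · exact Filter.inter_mem (extChartAt_source_mem_nhds x)
      ((continuousAt_extChartAt x).preimage_mem_nhds (Metric.ball_mem_nhds _ hr))
  · have hm : MeasurableSet (e.source ∩ e ⁻¹' (Metric.ball (e x) r)) :=
      ((continuousOn_extChartAt x).isOpen_inter_preimage (isOpen_extChartAt_source x)
        Metric.isOpen_ball).measurableSet
    rw [riemannianVolume_apply_of_subset g x hm Set.inter_subset_left, chartVolume_apply g x hm]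
    have hsub : e.target ∩ e.symm ⁻¹' (e.source ∩ e ⁻¹' (Metric.ball (e x) r)) ⊆
        Metric.ball (e x) r := by
      intro y hy
      have h := hy.2.2
      simp only [Set.mem_preimage] at h
      rwa [e.right_inv hy.1] at h
    refine (lintegral_mono_set hsub).trans_lt ?_
    refine (setLIntegral_mono' (g := fun _ => ENNReal.ofReal (chartDensity g x (e x) + 1))
      Metric.isOpen_ball.measurableSet
      fun y hy => ENNReal.ofReal_le_ofReal (le_of_lt (hball hy).2)).trans_lt ?_
    rw [setLIntegral_const]
    exact ENNReal.mul_lt_top ENNReal.ofReal_lt_top measure_ball_lt_top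

/-- Nonempty open sets have positive volume, the density in a chart being positive. -/
instance isOpenPosMeasure_riemannianVolume (g : RiemMetric n M) :
    (riemannianVolume g).IsOpenPosMeasure := by
  refine ⟨fun U hU hne h0 => ?_⟩
  obtain ⟨x, hx⟩ := hne
  set e := extChartAt 𝓘(ℝ, Model n) x with he
  have h1 : chartVolume g x U = 0 :=
    le_antisymm (h0 ▸ Measure.le_iff'.1 (le_iSup (fun c => chartVolume g c) x) U) zero_le
  have hm := measurableSet_target_inter_preimage (n := n) x hU.measurableSet
  rw [chartVolume_apply g x hU.measurableSet, lintegral_eq_zero_iff'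
    ((aemeasurable_chartDensity g x).mono_measure (Measure.restrict_mono_set _
      Set.inter_subset_left)), Filter.EventuallyEq, ae_restrict_iff' hm] at h1
  have h2 : volume (e.target ∩ e.symm ⁻¹' U) = 0 := by
    refine measure_mono_null (fun y hy => ?_) h1
    simp only [Set.mem_compl_iff, Set.mem_ofPred_eq]
    intro h
    have := h hy
    simp only [Pi.zero_apply, ENNReal.ofReal_eq_zero] at this
    exact absurd this (not_le.2 (chartDensity_pos g hy.1))
  refine ((continuousOn_extChartAt_symm x).isOpen_inter_preimage (isOpen_extChartAt_target x)
    hU).measure_ne_zero volume ⟨e x, mem_extChartAt_target x, ?_⟩ h2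
  simp only [Set.mem_preimage, he, extChartAt_to_inv]
  exact hx

theorem integrable_of_continuous [CompactSpace M] (g : RiemMetric n M) {f : M → ℝ}
    (hf : Continuous f) : Integrable f (riemannianVolume g) :=
  hf.integrable_of_hasCompactSupport (HasCompactSupport.of_compactSpace f)

end Volume

/-! ### Derivatives of determinants and inverse matrices -/

section MatrixCalculus

variable {X : Type*} [NormedAddCommGroup X] [NormedSpace ℝ X] {ι : Type*} [Fintype ι]
  [DecidableEq ι]

/-- Jacobi's formula for the derivative of a determinant. -/
theorem fderiv_det {A : X → Matrix ι ι ℝ} {x : X}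
    (hA : ∀ i j, DifferentiableAt ℝ (fun z => A z i j) x) (v : X) :
    fderiv ℝ (fun z => (A z).det) x v =
      ∑ i, ∑ k, (A x).adjugate i k * fderiv ℝ (fun z => A z k i) x v := by
  have h : HasFDerivAt (fun z => (A z).det) (∑ σ : Equiv.Perm ι, ((Equiv.Perm.sign σ : ℤ) : ℝ) •
      ∑ i, (∏ j ∈ Finset.univ.erase i, A x (σ j) j) • fderiv ℝ (fun z => A z (σ i) i) x) x := by
    simp only [Matrix.det_apply']
    exact HasFDerivAt.fun_sum fun σ _ => (HasFDerivAt.finsetProd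
      fun i _ => (hA (σ i) i).hasFDerivAt).const_mul _
  rw [h.fderiv]
  have h2 : ∀ i, ∑ k, (A x).adjugate i k * fderiv ℝ (fun z => A z k i) x v =
      ((A x).updateCol i fun k => fderiv ℝ (fun z => A z k i) x v).det := fun i => by
    rw [← Matrix.cramer_apply, Matrix.cramer_eq_adjugate_mulVec]
    rfl
  simp only [h2, Matrix.det_apply', _root_.sum_apply, _root_.smul_apply, smul_eq_mul,
    Finset.mul_sum]
  rw [Finset.sum_comm]
  refine Finset.sum_congr rfl fun i _ => Finset.sum_congr rfl fun σ _ => ?_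
  rw [← Finset.mul_prod_erase Finset.univ _ (Finset.mem_univ i), Matrix.updateCol_self,
    mul_comm (fderiv ℝ (fun z => A z (σ i) i) x v)]
  refine congrArg (fun a : ℝ => _ * (a * _)) (Finset.prod_congr rfl fun j hj => ?_)
  rw [Matrix.updateCol_ne (Finset.ne_of_mem_erase hj)]

theorem differentiableAt_matrix_inv {A : X → Matrix ι ι ℝ} {x : X}
    (hA : ∀ i j, ContDiffAt ℝ ∞ (fun z => A z i j) x) (h0 : IsUnit (A x).det) (i j : ι) :
    DifferentiableAt ℝ (fun z => (A z)⁻¹ i j) x :=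
  (contDiffAt_matrix_inv hA h0 i j).differentiableAt (by simp)

theorem fderiv_matrix_inv {A : X → Matrix ι ι ℝ} {x : X}
    (hA : ∀ i j, ContDiffAt ℝ ∞ (fun z => A z i j) x) (h0 : IsUnit (A x).det) (v : X) (i j : ι) :
    fderiv ℝ (fun z => (A z)⁻¹ i j) x v =
      -∑ a, ∑ b, (A x)⁻¹ i a * fderiv ℝ (fun z => A z a b) x v * (A x)⁻¹ b j := by
  set N' : Matrix ι ι ℝ := Matrix.of fun i j => fderiv ℝ (fun z => (A z)⁻¹ i j) x v with hN'
  set A' : Matrix ι ι ℝ := Matrix.of fun i j => fderiv ℝ (fun z => A z i j) x v with hA'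
  have hd : ∀ i j, DifferentiableAt ℝ (fun z => A z i j) x := fun i j =>
    (hA i j).differentiableAt (by simp)
  have h1 : N' * A x + (A x)⁻¹ * A' = 0 := by
    ext i j
    have hev : (fun z => ∑ k, (A z)⁻¹ i k * A z k j) =ᶠ[nhds x]
        fun _ => (1 : Matrix ι ι ℝ) i j := by
      filter_upwards [(contDiffAt_det hA).continuousAt.eventually_ne h0.ne_zero] with z hz
      rw [← Matrix.mul_apply, Matrix.nonsing_inv_mul _ (isUnit_iff_ne_zero.2 hz)]
    have h := congrArg (fun L : X →L[ℝ] ℝ => L v) hev.fderiv_eq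
    rw [fderiv_fun_sum fun k _ => (differentiableAt_matrix_inv hA h0 i k).fun_mul (hd k j)] at h
    simp only [_root_.sum_apply, fderiv_fun_mul (differentiableAt_matrix_inv hA h0 i _) (hd _ j),
      _root_.add_apply, _root_.smul_apply, smul_eq_mul, fderiv_fun_const, Pi.zero_apply,
      _root_.zero_apply, Finset.sum_add_distrib] at h
    rw [Matrix.add_apply, Matrix.mul_apply, Matrix.mul_apply, Matrix.zero_apply, ← h, add_comm]
    exact congrArg₂ (· + ·) rfl (Finset.sum_congr rfl fun k _ => mul_comm _ _)
  have h2 : N' = -((A x)⁻¹ * A' * (A x)⁻¹) := by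
    have h3 := congrArg (· * (A x)⁻¹) (eq_neg_of_add_eq_zero_left h1)
    simp only [Matrix.mul_assoc, Matrix.mul_nonsing_inv _ h0, Matrix.mul_one, Matrix.neg_mul] at h3
    rw [h3, Matrix.mul_assoc]
  have h4 := congrFun (congrFun h2 i) j
  refine Eq.trans (show _ = _ from h4) ?_
  rw [Matrix.neg_apply, Matrix.mul_apply]
  simp only [Matrix.mul_apply, Finset.sum_mul]
  rw [Finset.sum_comm]
  rfl

/-- The derivative of the density `√|det A|`. It is given by its fourth power, which does not
involve the sign of the determinant. -/
theorem fderiv_density {A : X → Matrix ι ι ℝ} {ρ : X → ℝ} {x : X}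
    (hA : ∀ i j, ContDiffAt ℝ ∞ (fun z => A z i j) x) (h0 : IsUnit (A x).det)
    (hρ : DifferentiableAt ℝ ρ x) (hpos : 0 < ρ x)
    (h : ∀ᶠ z in nhds x, ρ z ^ 4 = (A z).det ^ 2) (v : X) :
    fderiv ℝ ρ x v =
      ρ x / 2 * ∑ i, ∑ k, (A x)⁻¹ i k * fderiv ℝ (fun z => A z k i) x v := by
  have hd : ∀ i j, DifferentiableAt ℝ (fun z => A z i j) x := fun i j =>
    (hA i j).differentiableAt (by simp)
  have hdet : DifferentiableAt ℝ (fun z => (A z).det) x :=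
    (contDiffAt_det hA).differentiableAt (by simp)
  have h1 := congrArg (fun L : X →L[ℝ] ℝ => L v) (Filter.EventuallyEq.fderiv_eq h)
  rw [fderiv_fun_pow _ hρ, fderiv_fun_pow _ hdet] at h1
  simp only [_root_.smul_apply, smul_eq_mul, fderiv_det hd] at h1
  have h2 : ∑ i, ∑ k, (A x).adjugate i k * fderiv ℝ (fun z => A z k i) x v =
      (A x).det * ∑ i, ∑ k, (A x)⁻¹ i k * fderiv ℝ (fun z => A z k i) x v := by
    rw [Finset.mul_sum]
    refine Finset.sum_congr rfl fun i _ => ?_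
    rw [Finset.mul_sum]
    refine Finset.sum_congr rfl fun k _ => ?_
    rw [Matrix.inv_def, Matrix.smul_apply, Ring.inverse_eq_inv', smul_eq_mul, ← mul_assoc,
      ← mul_assoc, mul_inv_cancel₀ h0.ne_zero, one_mul]
  rw [h2] at h1
  have h3 : ρ x ^ 4 = (A x).det ^ 2 := h.self_of_nhds
  have h4 : (ρ x) ^ 3 ≠ 0 := (pow_pos hpos 3).ne'
  refine mul_left_cancel₀ h4 ?_
  simp only [nsmul_eq_mul] at h1
  push_cast at h1
  set S := ∑ i, ∑ k, (A x)⁻¹ i k * fderiv ℝ (fun z => A z k i) x v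
  norm_num at h1
  linear_combination (1 / 4) * h1 - (S / 2) * h3

/-- For a closed nondegenerate `2`-form with matrix `W`, the bivector `W⁻¹` is divergence free with
respect to the density `√|det W|`. -/
theorem sum_fderiv_density_mul_inv {W : X → Matrix ι ι ℝ} {ρ : X → ℝ} {x : X} {e : ι → X}
    (hW : ∀ i j, ContDiffAt ℝ ∞ (fun z => W z i j) x) (h0 : IsUnit (W x).det)
    (hρ : DifferentiableAt ℝ ρ x) (hpos : 0 < ρ x)
    (h : ∀ᶠ z in nhds x, ρ z ^ 4 = (W z).det ^ 2)
    (hanti : ∀ i j, (W x)⁻¹ i j = -(W x)⁻¹ j i)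
    (hanti' : ∀ i j v, fderiv ℝ (fun z => W z i j) x v = -fderiv ℝ (fun z => W z j i) x v)
    (hclosed : ∀ i a b, fderiv ℝ (fun z => W z a b) x (e i) + fderiv ℝ (fun z => W z b i) x (e a) +
      fderiv ℝ (fun z => W z i a) x (e b) = 0) (j : ι) :
    ∑ i, fderiv ℝ (fun z => ρ z * (W z)⁻¹ i j) x (e i) = 0 := by
  set N := (W x)⁻¹ with hN
  set D : ι → ι → ι → ℝ := fun i a b => fderiv ℝ (fun z => W z a b) x (e i) with hD
  have h1 : ∀ i, fderiv ℝ (fun z => ρ z * (W z)⁻¹ i j) x (e i) =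
      ρ x * ((∑ a, ∑ b, N a b * D i b a * N i j) / 2 - ∑ a, ∑ b, N i a * D i a b * N b j) := by
    intro i
    rw [fderiv_fun_mul hρ (differentiableAt_matrix_inv hW h0 i j)]
    simp only [_root_.add_apply, _root_.smul_apply, smul_eq_mul, fderiv_matrix_inv hW h0,
      fderiv_density hW h0 hρ hpos h, ← Finset.sum_mul]
    simp only [hD, hN]
    ring
  simp only [h1]
  rw [← Finset.mul_sum, Finset.sum_sub_distrib, ← Finset.sum_div]
  -- contracting the closedness relation with `N i a * N b j` gives `2 Y = Z`
  set Y := ∑ i, ∑ a, ∑ b, N i a * D i a b * N b j with hY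
  set Z := ∑ i, ∑ a, ∑ b, N a b * D i b a * N i j with hZ
  have h2 : ∑ i, ∑ a, ∑ b, N i a * D a b i * N b j = Y := by
    rw [hY, Finset.sum_comm]
    refine Finset.sum_congr rfl fun i _ => Finset.sum_congr rfl fun a _ =>
      Finset.sum_congr rfl fun b _ => ?_
    have := hanti' b a (e i)
    simp only [hD]
    rw [hanti a i, this]
    ring
  have h3 : ∑ i, ∑ a, ∑ b, N i a * D b i a * N b j = -Z := by
    rw [hZ, ← Finset.sum_neg_distrib]
    rw [Finset.sum_congr rfl fun i _ => Finset.sum_comm, Finset.sum_comm]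
    refine Finset.sum_congr rfl fun i _ => ?_
    rw [← Finset.sum_neg_distrib]
    refine Finset.sum_congr rfl fun a _ => ?_
    rw [← Finset.sum_neg_distrib]
    refine Finset.sum_congr rfl fun b _ => ?_
    have := hanti' a b (e i)
    simp only [hD]
    rw [this]
    ring
  have h4 : Y + Y + -Z = 0 := by
    conv_lhs => rw [← h3]; enter [1, 2]; rw [← h2]
    rw [hY]
    simp only [← Finset.sum_add_distrib]
    refine Finset.sum_eq_zero fun i _ => Finset.sum_eq_zero fun a _ =>
      Finset.sum_eq_zero fun b _ => ?_
    have := hclosed i a b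
    simp only [hD]
    linear_combination N i a * N b j * this
  have h5 : Z / 2 - Y = 0 := by linarith
  rw [h5, mul_zero]

end MatrixCalculus

/-! ### Integrals of divergences -/

section Divergence

variable {X : Type*} [NormedAddCommGroup X] [NormedSpace ℝ X] [FiniteDimensional ℝ X]
  [MeasurableSpace X] [BorelSpace X]

theorem integral_fderiv_eq_zero (μ : Measure X) [μ.IsAddHaarMeasure] {F : X → ℝ}
    (hF : ContDiff ℝ ∞ F) (hc : HasCompactSupport F) (v : X) :
    Integrable (fun x => fderiv ℝ F x v) μ ∧ ∫ x, fderiv ℝ F x v ∂μ = 0 := by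
  have h1 : Integrable (fun x => fderiv ℝ F x v) μ := by
    refine Continuous.integrable_of_hasCompactSupport ?_ ?_
    · exact ((hF.continuous_fderiv (by simp)).clm_apply continuous_const)
    · exact (hc.fderiv (𝕜 := ℝ)).comp_left (g := fun L : X →L[ℝ] ℝ => L v) rfl
  refine ⟨h1, ?_⟩
  have h := integral_bilinear_fderiv_right_eq_neg_left_of_integrable (μ := μ)
    (f := fun _ : X => (1 : ℝ)) (g := F) (v := v) (B := ContinuousLinearMap.mul ℝ ℝ)
    (by simp) (by simpa using h1)
    (by simpa using hF.continuous.integrable_of_hasCompactSupport hc)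
    (fun x _ => differentiableAt_const _) (fun x _ => hF.differentiable (by simp) x)
  simpa using h

/-- The integral of a directional derivative of a smooth function with compact support in an open
set vanishes. -/
theorem setIntegral_fderiv_eq_zero (μ : Measure X) [μ.IsAddHaarMeasure] {T K : Set X}
    (hT : IsOpen T) (hK : IsCompact K) (hKT : K ⊆ T) {F : X → ℝ}
    (hF : ∀ y ∈ T, ContDiffAt ℝ ∞ F y) (h0 : ∀ y ∈ T, y ∉ K → F y = 0) (v : X) :
    IntegrableOn (fun x => fderiv ℝ F x v) T μ ∧ ∫ x in T, fderiv ℝ F x v ∂μ = 0 := by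
  have hout : ∀ y ∉ K, T.indicator F y = 0 := fun y hy => by
    by_cases hyT : y ∈ T
    · rw [Set.indicator_of_mem hyT, h0 y hyT hy]
    · exact Set.indicator_of_notMem hyT F
  have hin : ∀ y ∈ T, T.indicator F =ᶠ[nhds y] F := fun y hy => by
    filter_upwards [hT.mem_nhds hy] with z hz
    exact Set.indicator_of_mem hz F
  have hzero : ∀ y ∉ T, T.indicator F =ᶠ[nhds y] fun _ => 0 := fun y hy => by
    filter_upwards [hK.isClosed.isOpen_compl.mem_nhds fun h => hy (hKT h)] with z hz
    exact hout z hz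
  -- the extension of `F` by zero is smooth on the whole space
  have hsm : ContDiff ℝ ∞ (T.indicator F) := contDiff_iff_contDiffAt.2 fun y => by
    by_cases hy : y ∈ T
    · exact (hF y hy).congr_of_eventuallyEq (hin y hy)
    · exact contDiffAt_const.congr_of_eventuallyEq (hzero y hy)
  have hcs : HasCompactSupport (T.indicator F) := HasCompactSupport.intro hK hout
  obtain ⟨h1, h2⟩ := integral_fderiv_eq_zero μ hsm hcs v
  have heq : Set.EqOn (fun x => fderiv ℝ (T.indicator F) x v) (fun x => fderiv ℝ F x v) T :=
    fun y hy => by simp only [(hin y hy).fderiv_eq]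
  refine ⟨h1.integrableOn.congr_fun heq hT.measurableSet, ?_⟩
  rw [← setIntegral_congr_fun hT.measurableSet heq, setIntegral_eq_integral_of_forall_compl_eq_zero,
    h2]
  intro y hy
  rw [(hzero y hy).fderiv_eq]
  simp

end Divergence

/-! ### Integration by parts in a chart -/

section ChartDivergence

variable {n : ℕ} {V : Type*} [NormedAddCommGroup V] [NormedSpace ℝ V]

theorem extDeriv_one_apply {a : Model n → Model n [⋀^Fin 1]→L[ℝ] V} {y : Model n}
    (ha : DifferentiableAt ℝ a y) (u v : Model n) :
    extDeriv a y ![u, v] =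
      fderiv ℝ (fun z => a z ![v]) y u - fderiv ℝ (fun z => a z ![u]) y v := by
  have h0 : Fin.removeNth (0 : Fin 2) ![u, v] = ![v] := by
    funext l; fin_cases l; rfl
  have h1 : Fin.removeNth (1 : Fin 2) ![u, v] = ![u] := by
    funext l; fin_cases l; rfl
  rw [extDeriv_apply ha, Fin.sum_univ_two, h0, h1]
  simp [sub_eq_add_neg]

theorem extDeriv_two_apply {a : Model n → Model n [⋀^Fin 2]→L[ℝ] V} {y : Model n}
    (ha : DifferentiableAt ℝ a y) (u v w : Model n) :
    extDeriv a y ![u, v, w] =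
      fderiv ℝ (fun z => a z ![v, w]) y u - fderiv ℝ (fun z => a z ![u, w]) y v +
        fderiv ℝ (fun z => a z ![u, v]) y w := by
  have h0 : Fin.removeNth (0 : Fin 3) ![u, v, w] = ![v, w] := by
    funext l; fin_cases l <;> rfl
  have h1 : Fin.removeNth (1 : Fin 3) ![u, v, w] = ![u, w] := by
    funext l; fin_cases l <;> rfl
  have h2 : Fin.removeNth (2 : Fin 3) ![u, v, w] = ![u, v] := by
    funext l; fin_cases l <;> rfl
  rw [extDeriv_apply ha, Fin.sum_univ_three, h0, h1, h2]
  simp [sub_eq_add_neg]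

theorem lamE_extDeriv {W : Matrix (Fin (2 * n)) (Fin (2 * n)) ℝ}
    (hW : ∀ i j, W⁻¹ i j = -W⁻¹ j i) {a : Model n → Model n [⋀^Fin 1]→L[ℝ] V} {y : Model n}
    (ha : DifferentiableAt ℝ a y) :
    lamE W (extDeriv a y) =
      -∑ i, ∑ j, W⁻¹ i j • fderiv ℝ (fun z => a z ![stdVec j]) y (stdVec i) := by
  set S := ∑ i, ∑ j, W⁻¹ i j • fderiv ℝ (fun z => a z ![stdVec j]) y (stdVec i) with hS
  have h : ∑ i, ∑ j, W⁻¹ i j • extDeriv a y ![stdVec i, stdVec j] = S + S := by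
    simp only [extDeriv_one_apply ha, smul_sub, Finset.sum_sub_distrib]
    rw [sub_eq_add_neg]
    congr 1
    rw [hS, Finset.sum_comm, ← Finset.sum_neg_distrib]
    refine Finset.sum_congr rfl fun i _ => ?_
    rw [← Finset.sum_neg_distrib]
    exact Finset.sum_congr rfl fun j _ => by rw [hW j i, neg_smul, neg_neg]
  rw [lamE, h, ← two_smul ℝ S, smul_smul]
  norm_num

theorem matE_inv_anti (f : Model n [⋀^Fin 2]→L[ℝ] ℝ) (i j : Fin (2 * n)) :
    (matE f)⁻¹ i j = -(matE f)⁻¹ j i :=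
  congrFun (congrFun (matE_inv_transpose f) j) i

variable {M : Type*} [TopologicalSpace M] [ChartedSpace (Model n) M]
  [IsManifold 𝓘(ℝ, Model n) ∞ M]

/-- For a compatible metric `det g = |det Ω|`, so that the density is `√|det Ω|`. -/
theorem chartDensity_pow {Ω : DForm (Model n) M 2 ℝ} {g : RiemMetric n M} (hg : Compatible Ω g)
    {c : M} {y : Model n} (hy : y ∈ (extChartAt 𝓘(ℝ, Model n) c).target) :
    chartDensity g c y ^ 4 = (matE (chartRep c Ω y)).det ^ 2 := by
  have h : chartDensity g c y ^ 2 = (chartGram g c y).det :=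
    Real.sq_sqrt (chartGram_posDef hy g).det_pos.le
  calc chartDensity g c y ^ 4 = (chartDensity g c y ^ 2) ^ 2 := by ring
    _ = _ := by rw [h, hg.det_chartGram hy, sq_abs]

/-- In a chart, the Poisson bivector of a symplectic form is divergence free with respect to the
density of a compatible metric. -/
theorem IsSymplectic.sum_fderiv_eq_zero {Ω : DForm (Model n) M 2 ℝ} (hΩ : IsSymplectic Ω)
    {g : RiemMetric n M} (hg : Compatible Ω g) {c : M} {y : Model n}
    (hy : y ∈ (extChartAt 𝓘(ℝ, Model n) c).target) (j : Fin (2 * n)) :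
    ∑ i, fderiv ℝ (fun z => chartDensity g c z * (matE (chartRep c Ω z))⁻¹ i j) y (stdVec i) =
      0 := by
  have hd := (hΩ.smooth.contDiffAt hy).differentiableAt (by simp)
  have hanti : ∀ (a b : Model n), (fun z => chartRep c Ω z ![a, b]) =
      fun z => -chartRep c Ω z ![b, a] := fun a b => funext fun z => swap_apply _ _ _
  refine sum_fderiv_density_mul_inv (W := fun z => matE (chartRep c Ω z)) (e := stdVec)
    (fun i j => hΩ.smooth.contDiffAt_apply hy _) (hg.isUnit_det_chart hy)
    ((contDiffAt_chartDensity g hy).differentiableAt (by simp)) (chartDensity_pos g hy) ?_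
    (matE_inv_anti _) (fun i j v => ?_) (fun i a b => ?_) j
  · filter_upwards [eventually_mem_target hy] with z hz
    exact chartDensity_pow hg hz
  · simp only [matE, Matrix.of_apply]
    rw [hanti, fderiv_fun_neg]
    rfl
  · have h := chartRep_extD hy (hΩ.smooth.at _)
    have h2 : chartRep c (extD Ω) y = 0 := by
      rw [hΩ.closed]
      rfl
    rw [h2] at h
    have h3 := congrArg (fun f : Model n [⋀^Fin 3]→L[ℝ] ℝ => f ![stdVec i, stdVec a, stdVec b]) h
    rw [extDeriv_two_apply hd, ContinuousAlternatingMap.coe_zero, Pi.zero_apply] at h3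
    simp only [matE, Matrix.of_apply]
    rw [hanti (stdVec b) (stdVec i), fderiv_fun_neg, _root_.neg_apply, ← sub_eq_add_neg]
    exact h3.symm

/-- The pairing of `1`-forms given by the Poisson bivector of `Ω` and a bilinear form on the
values. -/
def poissonPair (Ω : DForm (Model n) M 2 ℝ) (κ : LinearMap.BilinForm ℝ V)
    (α β : DForm (Model n) M 1 V) (x : M) : ℝ :=
  innerE (formMatrix Ω x) κ (fiber α x) (fiber β x)

theorem poissonPair_symm {c : M} {y : Model n} (hy : y ∈ (extChartAt 𝓘(ℝ, Model n) c).target)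
    (Ω : DForm (Model n) M 2 ℝ) (κ : LinearMap.BilinForm ℝ V) (α β : DForm (Model n) M 1 V) :
    poissonPair Ω κ α β ((extChartAt 𝓘(ℝ, Model n) c).symm y) =
      innerE (matE (chartRep c Ω y)) κ (chartRep c α y) (chartRep c β y) := by
  rw [matE_chartRep, chartRep_eq_comp, chartRep_eq_comp, innerE_comp κ _ _ (isUnit_det_chartT hy),
    poissonPair]

theorem contMDiff_poissonPair [FiniteDimensional ℝ V] {Ω : DForm (Model n) M 2 ℝ}
    {g : RiemMetric n M} (hΩ : SmoothForm Ω) (hg : Compatible Ω g) (κ : LinearMap.BilinForm ℝ V)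
    {α β : DForm (Model n) M 1 V} (hα : SmoothForm α) (hβ : SmoothForm β) :
    ContMDiff 𝓘(ℝ, Model n) 𝓘(ℝ, ℝ) ∞ (poissonPair Ω κ α β) := by
  refine contMDiff_of_comp_symm fun c y hy => ?_
  have h1 : ContDiffAt ℝ ∞ (fun z =>
      innerE (matE (chartRep c Ω z)) κ (chartRep c α z) (chartRep c β z)) y := by
    simp only [innerE_one]
    refine ContDiffAt.sum fun a _ => ContDiffAt.sum fun b _ => ?_
    exact (contDiffAt_matrix_inv (fun i j => hΩ.contDiffAt_apply hy _) (hg.isUnit_det_chart hy)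
      _ _).mul (contDiffAt_bilin κ (hα.contDiffAt_apply hy _) (hβ.contDiffAt_apply hy _))
  refine h1.congr_of_eventuallyEq ?_
  filter_upwards [eventually_mem_target hy] with z hz
  exact poissonPair_symm hz Ω κ α β

/-- In a chart, `κ(h, Λ dη) - ⟨dh, η⟩` (with the pairing `poissonPair`) times the density is a
divergence. -/
theorem density_mul_eq_divergence [FiniteDimensional ℝ V] {Ω : DForm (Model n) M 2 ℝ}
    (hΩ : IsSymplectic Ω) {g : RiemMetric n M} (hg : Compatible Ω g)
    (κ : LinearMap.BilinForm ℝ V) {h : M → V} (hh : ContMDiff 𝓘(ℝ, Model n) 𝓘(ℝ, V) ∞ h)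
    {η : DForm (Model n) M 1 V} (hη : SmoothForm η) {c : M} {y : Model n}
    (hy : y ∈ (extChartAt 𝓘(ℝ, Model n) c).target) :
    chartDensity g c y * (κ (h ((extChartAt 𝓘(ℝ, Model n) c).symm y))
        (dualLefschetz Ω (extD η) ((extChartAt 𝓘(ℝ, Model n) c).symm y)) -
      poissonPair Ω κ (dFun (E := Model n) h) η ((extChartAt 𝓘(ℝ, Model n) c).symm y)) =
    -∑ i, fderiv ℝ (fun z => ∑ j, chartDensity g c z * (matE (chartRep c Ω z))⁻¹ i j *
      κ (h ((extChartAt 𝓘(ℝ, Model n) c).symm z)) (chartRep c η z ![stdVec j])) y (stdVec i) := by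
  set u : Model n → V := fun z => h ((extChartAt 𝓘(ℝ, Model n) c).symm z) with hu
  set a : Fin (2 * n) → Model n → V := fun j z => chartRep c η z ![stdVec j] with ha
  set R : Fin (2 * n) → Fin (2 * n) → Model n → ℝ :=
    fun i j z => chartDensity g c z * (matE (chartRep c Ω z))⁻¹ i j with hR
  have hud : DifferentiableAt ℝ u y := (contDiffAt_comp_symm hh hy).differentiableAt (by simp)
  have had : ∀ j, DifferentiableAt ℝ (a j) y := fun j =>
    (hη.contDiffAt_apply hy _).differentiableAt (by simp)
  have hRd : ∀ i j, DifferentiableAt ℝ (R i j) y := fun i j =>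
    ((contDiffAt_chartDensity g hy).differentiableAt (by simp)).fun_mul
      (differentiableAt_matrix_inv (fun i j => hΩ.smooth.contDiffAt_apply hy _)
        (hg.isUnit_det_chart hy) i j)
  have hκ : ∀ j v, fderiv ℝ (fun z => κ (u z) (a j z)) y v =
      κ (fderiv ℝ u y v) (a j y) + κ (u y) (fderiv ℝ (a j) y v) := fun j v => by
    have h1 := (((LinearMap.toContinuousBilinearMap κ).hasFDerivAt.comp y hud.hasFDerivAt).clm_apply
      (had j).hasFDerivAt).fderiv
    have h2 := congrArg (fun L : Model n →L[ℝ] ℝ => L v) h1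
    refine Eq.trans (show _ = _ from h2) ?_
    simp [add_comm]
  have hκd : ∀ j, DifferentiableAt ℝ (fun z => κ (u z) (a j z)) y := fun j =>
    (contDiffAt_bilin κ (contDiffAt_comp_symm hh hy) (hη.contDiffAt_apply hy _)).differentiableAt
      (by simp)
  have hF : ∀ i, fderiv ℝ (fun z => ∑ j, R i j z * κ (u z) (a j z)) y (stdVec i) =
      ∑ j, (fderiv ℝ (R i j) y (stdVec i) * κ (u y) (a j y) +
        R i j y * (κ (fderiv ℝ u y (stdVec i)) (a j y) +
          κ (u y) (fderiv ℝ (a j) y (stdVec i)))) := fun i => by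
    rw [fderiv_fun_sum fun j _ => (hRd i j).fun_mul (hκd j)]
    simp only [_root_.sum_apply]
    refine Finset.sum_congr rfl fun j _ => ?_
    rw [fderiv_fun_mul (hRd i j) (hκd j)]
    simp only [_root_.add_apply, _root_.smul_apply, smul_eq_mul, hκ]
    ring
  have hdiv : ∑ i, ∑ j, fderiv ℝ (R i j) y (stdVec i) * κ (u y) (a j y) = 0 := by
    rw [Finset.sum_comm]
    refine Finset.sum_eq_zero fun j _ => ?_
    rw [← Finset.sum_mul, hΩ.sum_fderiv_eq_zero hg hy j, zero_mul]
  have hpair : poissonPair Ω κ (dFun (E := Model n) h) η ((extChartAt 𝓘(ℝ, Model n) c).symm y) =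
      ∑ i, ∑ j, (matE (chartRep c Ω y))⁻¹ i j * κ (fderiv ℝ u y (stdVec i)) (a j y) := by
    rw [poissonPair_symm hy, innerE_one, chartRep_dFun hh hy]
    rfl
  have hlam : dualLefschetz Ω (extD η) ((extChartAt 𝓘(ℝ, Model n) c).symm y) =
      -∑ i, ∑ j, (matE (chartRep c Ω y))⁻¹ i j • fderiv ℝ (a j) y (stdVec i) := by
    rw [dualLefschetz_symm hy, chartRep_extD hy (hη.at _), lamE_extDeriv (matE_inv_anti _)
      ((hη.contDiffAt hy).differentiableAt (by simp))]
  refine Eq.trans ?_ (congrArg Neg.neg (Finset.sum_congr rfl fun i _ => hF i)).symm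
  rw [hpair, hlam]
  simp only [Finset.sum_add_distrib, hdiv, zero_add, mul_add, map_neg, map_sum, map_smul,
    smul_eq_mul]
  simp only [hR, mul_assoc, ← Finset.mul_sum]
  simp only [hu]
  ring

end ChartDivergence

/-! ### Integration by parts on the manifold -/

section IntegrationByParts

variable {n : ℕ} {M : Type*} [TopologicalSpace M] [ChartedSpace (Model n) M]
  [IsManifold 𝓘(ℝ, Model n) ∞ M] {V : Type*} [NormedAddCommGroup V] [NormedSpace ℝ V]

/-- The product of a function and a form. -/
def funSmul {k : ℕ} (χ : M → ℝ) (η : DForm (Model n) M k V) : DForm (Model n) M k V :=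
  fun x => χ x • η x

theorem SmoothForm.funSmul {k : ℕ} {χ : M → ℝ} (hχ : ContMDiff 𝓘(ℝ, Model n) 𝓘(ℝ, ℝ) ∞ χ)
    {η : DForm (Model n) M k V} (hη : SmoothForm η) : SmoothForm (funSmul χ η) := fun _ _ hy =>
  ((contDiffAt_comp_symm hχ hy).smul (hη.contDiffAt hy)).contDiffWithinAt

theorem SmoothForm.sum {ι : Type*} {k : ℕ} {s : Finset ι} {α : ι → DForm (Model n) M k V}
    (h : ∀ i ∈ s, SmoothForm (α i)) : SmoothForm (∑ i ∈ s, α i) := by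
  classical
  induction s using Finset.induction_on with
  | empty => exact fun c => contDiffOn_const (c := (0 : Model n [⋀^Fin k]→L[ℝ] V))
  | insert i s hi ih =>
    rw [Finset.sum_insert hi]
    exact (h i (Finset.mem_insert_self i s)).add
      (ih fun j hj => h j (Finset.mem_insert_of_mem hj))

theorem poissonPair_add (Ω : DForm (Model n) M 2 ℝ) (κ : LinearMap.BilinForm ℝ V)
    (α β γ : DForm (Model n) M 1 V) (x : M) :
    poissonPair Ω κ α (β + γ) x = poissonPair Ω κ α β x + poissonPair Ω κ α γ x := by
  have h : fiber (β + γ) x = fiber β x + fiber γ x := rfl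
  simp only [poissonPair, h, innerE_one, ContinuousAlternatingMap.add_apply, map_add, mul_add,
    Finset.sum_add_distrib]

variable [MeasurableSpace M] [BorelSpace M] [T2Space M] [CompactSpace M] [FiniteDimensional ℝ V]

theorem continuous_bilin (κ : LinearMap.BilinForm ℝ V) {a b : M → V} (ha : Continuous a)
    (hb : Continuous b) : Continuous fun x => κ (a x) (b x) :=
  ((LinearMap.toContinuousBilinearMap κ).continuous.comp ha).clm_apply hb

theorem continuous_integrand {Ω : DForm (Model n) M 2 ℝ}
    (hΩ : SmoothForm Ω) {g : RiemMetric n M} (hg : Compatible Ω g)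
    (κ : LinearMap.BilinForm ℝ V) {h : M → V} (hh : ContMDiff 𝓘(ℝ, Model n) 𝓘(ℝ, V) ∞ h)
    {η : DForm (Model n) M 1 V} (hη : SmoothForm η) :
    Continuous fun x => κ (h x) (dualLefschetz Ω (extD η) x) -
      poissonPair Ω κ (dFun (E := Model n) h) η x :=
  (continuous_bilin κ hh.continuous (contMDiff_dualLefschetz hΩ hg hη.extD).continuous).sub
    (contMDiff_poissonPair hΩ hg κ (smoothForm_dFun hh) hη).continuous

/-- Integration by parts for forms supported in the domain of a chart. -/
theorem integral_eq_zero_of_support {Ω : DForm (Model n) M 2 ℝ}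
    (hΩ : IsSymplectic Ω) {g : RiemMetric n M} (hg : Compatible Ω g)
    (κ : LinearMap.BilinForm ℝ V) {h : M → V} (hh : ContMDiff 𝓘(ℝ, Model n) 𝓘(ℝ, V) ∞ h)
    {η : DForm (Model n) M 1 V} (hη : SmoothForm η) {c : M} {K : Set M} (hK : IsClosed K)
    (hKc : K ⊆ (extChartAt 𝓘(ℝ, Model n) c).source) (h0 : ∀ x ∉ K, η x = 0) :
    ∫ x, (κ (h x) (dualLefschetz Ω (extD η) x) - poissonPair Ω κ (dFun (E := Model n) h) η x)
      ∂(riemannianVolume g) = 0 := by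
  set e := extChartAt 𝓘(ℝ, Model n) c with he
  have hd0 : ∀ x ∉ K, extD η x = 0 := fun x hx => by
    have h1 : ∀ᶠ z in nhds x, η z = (0 : ℝ) • η z := by
      filter_upwards [hK.isOpen_compl.mem_nhds hx] with z hz
      rw [zero_smul, h0 z hz]
    rw [extD_congr (β := (0 : ℝ) • η) h1, extD_smul, zero_smul]
  rw [integral_riemannianVolume g c
    (continuous_integrand hΩ.smooth hg κ hh hη).measurable.aestronglyMeasurable]
  · rw [setIntegral_congr_fun (measurableSet_target c)
      fun y hy => density_mul_eq_divergence hΩ hg κ hh hη hy, integral_neg]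
    have hF : ∀ i : Fin (2 * n), _ := fun i => setIntegral_fderiv_eq_zero
      (volume : Measure (Model n)) (isOpen_extChartAt_target c)
      (hK.isCompact.image_of_continuousOn ((continuousOn_extChartAt c).mono hKc))
      (Set.image_subset_iff.2 fun x hx => e.map_source (hKc hx))
      (F := fun z => ∑ j, chartDensity g c z * (matE (chartRep c Ω z))⁻¹ i j *
        κ (h (e.symm z)) (chartRep c η z ![stdVec j]))
      (fun y hy => ContDiffAt.sum fun j _ => ((contDiffAt_chartDensity g hy).mul
        (contDiffAt_matrix_inv (fun i j => hΩ.smooth.contDiffAt_apply hy _)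
          (hg.isUnit_det_chart hy) i j)).mul
        (contDiffAt_bilin κ (contDiffAt_comp_symm hh hy) (hη.contDiffAt_apply hy _)))
      (fun y hy hyK => Finset.sum_eq_zero fun j _ => by
        have h1 : η (e.symm y) = 0 := h0 _ fun hx => hyK ⟨_, hx, e.right_inv hy⟩
        have h2 : chartRep c η y ![stdVec j] = 0 := by
          rw [chartRep_eq_comp, fiber, h1]
          rfl
        rw [h2, map_zero, mul_zero]) (stdVec i)
    rw [integral_finsetSum _ fun i _ => (hF i).1]
    rw [Finset.sum_eq_zero fun i _ => (hF i).2, neg_zero]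
  · intro x hx
    have hxK : x ∉ K := fun h => hx (hKc h)
    have h1 : dualLefschetz Ω (extD η) x = 0 := by
      simp [dualLefschetz, hd0 x hxK]
    have h2 : fiber η x = 0 := h0 x hxK
    rw [h1, poissonPair, innerE_one, h2]
    simp

/-- Integration by parts: the adjoint of `η ↦ Λ dη` is `h ↦ dh`, contracted with the Poisson
bivector. The forms `η` are cut into pieces supported in charts by a partition of unity. -/
theorem integral_bilin_dualLefschetz {Ω : DForm (Model n) M 2 ℝ}
    (hΩ : IsSymplectic Ω) {g : RiemMetric n M} (hg : Compatible Ω g)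
    (κ : LinearMap.BilinForm ℝ V) {h : M → V} (hh : ContMDiff 𝓘(ℝ, Model n) 𝓘(ℝ, V) ∞ h)
    {η : DForm (Model n) M 1 V} (hη : SmoothForm η) :
    ∫ x, κ (h x) (dualLefschetz Ω (extD η) x) ∂(riemannianVolume g) =
      ∫ x, poissonPair Ω κ (dFun (E := Model n) h) η x ∂(riemannianVolume g) := by
  obtain ⟨t, ht⟩ := CompactSpace.elim_nhds_subcover
    (fun c : M => (extChartAt 𝓘(ℝ, Model n) c).source)
    (fun c => extChartAt_source_mem_nhds (I := 𝓘(ℝ, Model n)) c)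
  obtain ⟨f, hf⟩ := SmoothPartitionOfUnity.exists_isSubordinate 𝓘(ℝ, Model n)
    (isClosed_univ (X := M)) (fun c : t => (extChartAt 𝓘(ℝ, Model n) (c : M)).source)
    (fun c => isOpen_extChartAt_source (c : M)) (fun x _ => by
      have hx : x ∈ ⋃ c ∈ t, (extChartAt 𝓘(ℝ, Model n) c).source := by rw [ht]; trivial
      simp only [Set.mem_iUnion] at hx ⊢
      obtain ⟨c, hc, hxc⟩ := hx
      exact ⟨⟨c, hc⟩, hxc⟩)
  have hsm : ∀ c, SmoothForm (funSmul (f c) η) := fun c => hη.funSmul (f c).contMDiff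
  have hsum : ∑ c, funSmul (f c) η = η := by
    funext x
    have h1 := f.sum_eq_one (Set.mem_univ x)
    rw [finsum_eq_sum_of_fintype] at h1
    rw [Finset.sum_apply]
    simp only [funSmul]
    rw [← Finset.sum_smul, h1, one_smul]
  have hadd : ∀ s : Finset t, ∫ x, (κ (h x) (dualLefschetz Ω (extD (∑ c ∈ s, funSmul (f c) η)) x) -
      poissonPair Ω κ (dFun (E := Model n) h) (∑ c ∈ s, funSmul (f c) η) x)
        ∂(riemannianVolume g) = 0 := by
    classical
    intro s
    induction s using Finset.induction_on with
    | empty =>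
      refine integral_eq_zero_of_ae (Filter.Eventually.of_forall fun x => ?_)
      have h1 : extD (0 : DForm (Model n) M 1 V) x = 0 := by
        have h2 := extD_smul (0 : ℝ) (0 : DForm (Model n) M 1 V) x
        rwa [zero_smul, zero_smul] at h2
      have h3 : fiber (0 : DForm (Model n) M 1 V) x = 0 := rfl
      simp [dualLefschetz, h1, poissonPair, innerE_one, h3]
    | insert i s hi ih =>
      have h1 : SmoothForm (∑ c ∈ s, funSmul (f c) η) := SmoothForm.sum fun c _ => hsm c
      have h2 : extD (funSmul (f i) η + ∑ c ∈ s, funSmul (f c) η) =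
          extD (funSmul (f i) η) + extD (∑ c ∈ s, funSmul (f c) η) :=
        funext fun x => extD_add ((hsm i).at x) (h1.at x)
      rw [Finset.sum_insert hi, h2, dualLefschetz_add]
      have h3 := integral_eq_zero_of_support hΩ hg κ hh (hsm i) (c := (i : M))
        (K := tsupport (f i)) (isClosed_tsupport _) (hf i) (fun x hx => by
          rw [funSmul, image_eq_zero_of_notMem_tsupport hx, zero_smul])
      have h4 := integral_add
        (integrable_of_continuous g (continuous_integrand hΩ.smooth hg κ hh (hsm i)))
        (integrable_of_continuous g (continuous_integrand hΩ.smooth hg κ hh h1))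
      rw [h3, ih, add_zero] at h4
      rw [← h4]
      refine integral_congr_ae (Filter.Eventually.of_forall fun x => ?_)
      simp only [Pi.add_apply, map_add, poissonPair_add]
      ring
  have h1 := hadd Finset.univ
  rw [hsum, integral_sub
    (integrable_of_continuous g (continuous_bilin κ hh.continuous
      (contMDiff_dualLefschetz hΩ.smooth hg hη.extD).continuous))
    (integrable_of_continuous g
      (contMDiff_poissonPair hΩ.smooth hg κ (smoothForm_dFun hh) hη).continuous), sub_eq_zero] at h1
  exact h1

theorem contDiff_opOf : ContDiff ℝ ∞ (fun A : Fin (2 * n) → Fin (2 * n) → ℝ =>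
    opOf (Matrix.of A)) := by
  unfold opOf
  refine ContDiff.sum fun i _ => ContDiff.sum fun j _ => ContDiff.fun_smul ?_ contDiff_const
  exact (contDiff_apply ℝ ℝ j).comp (contDiff_apply ℝ (Fin (2 * n) → ℝ) i)

theorem opOf_comp (A : Matrix (Fin (2 * n)) (Fin (2 * n)) ℝ) (T : Model n →L[ℝ] Model n) :
    (opOf A).comp T = opOf (A * opMatrix T) := by
  rw [← opOf_opMatrix ((opOf A).comp T), opMatrix_mul, opMatrix_opOf]

theorem comp_opOf (A : Matrix (Fin (2 * n)) (Fin (2 * n)) ℝ) (T : Model n →L[ℝ] Model n) :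
    T.comp (opOf A) = opOf (opMatrix T * A) := by
  rw [← opOf_opMatrix (T.comp (opOf A)), opMatrix_mul, opMatrix_opOf]

/-- Up to the almost complex structure `G⁻¹ W`, the pairing `poissonPair` is the inner product. -/
theorem exists_poissonPair_eq_formInner {Ω : DForm (Model n) M 2 ℝ}
    (hΩ : SmoothForm Ω) {g : RiemMetric n M} (hg : Compatible Ω g)
    (κ : LinearMap.BilinForm ℝ V) {α : DForm (Model n) M 1 V} (hα : SmoothForm α) :
    ∃ η : DForm (Model n) M 1 V, SmoothForm η ∧
      ∀ x, poissonPair Ω κ α η x = formInner g κ α α x := by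
  -- the matrix `-G⁻¹ W` transforms as an endomorphism and satisfies `W⁻¹ (-G⁻¹ W)ᵀ = G⁻¹`
  set C : M → Matrix (Fin (2 * n)) (Fin (2 * n)) ℝ := fun x =>
    (metricMatrix g x)⁻¹ * -formMatrix Ω x with hC
  refine ⟨fun x => (fiber α x).compContinuousLinearMap (opOf (C x)), fun c y hy => ?_, fun x => ?_⟩
  · refine ContDiffAt.contDiffWithinAt ?_
    have h1 : ContDiffAt ℝ ∞ (fun z => (chartRep c α z).compContinuousLinearMap
        (opOf (Matrix.of fun i j => ∑ k, (chartGram g c z)⁻¹ i k * -matE (chartRep c Ω z) k j)))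
        y := by
      refine contDiffAt_compContinuousLinearMap (hα.contDiffAt hy)
        (contDiff_opOf.contDiffAt.comp y (contDiffAt_pi.2 fun i => contDiffAt_pi.2 fun j =>
          ContDiffAt.sum fun k _ => ?_))
      exact (contDiffAt_matrix_inv (fun i j => contDiffAt_chartGram g hy i j)
        (chartGram_posDef hy g).det_pos.ne'.isUnit _ _).mul (hΩ.contDiffAt_apply hy _).neg
    refine h1.congr_of_eventuallyEq ?_
    filter_upwards [eventually_mem_target hy] with z hz
    have hT := isUnit_det_chartT hz
    have h2 : (Matrix.of fun i j => ∑ k, (chartGram g c z)⁻¹ i k * -matE (chartRep c Ω z) k j) =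
        (chartGram g c z)⁻¹ * -matE (chartRep c Ω z) := rfl
    have h3 : (opOf (C ((extChartAt 𝓘(ℝ, Model n) c).symm z))).comp (chartT c z) =
        (chartT c z).comp (opOf ((chartGram g c z)⁻¹ * -matE (chartRep c Ω z))) := by
      rw [opOf_comp, comp_opOf, hC, chartGram_eq, matE_chartRep]
      congr 1
      simp only [Matrix.mul_inv_rev, Matrix.mul_neg, Matrix.neg_mul, Matrix.mul_assoc]
      rw [← Matrix.mul_assoc (opMatrix (chartT c z)), Matrix.mul_nonsing_inv _ hT, Matrix.one_mul,
        ← Matrix.mul_assoc (opMatrix (chartT c z)).transpose⁻¹, Matrix.nonsing_inv_mul _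
          (by rwa [Matrix.det_transpose]), Matrix.one_mul]
    rw [h2]
    have h4 := congrArg (fun T : Model n →L[ℝ] Model n =>
      (fiber α ((extChartAt 𝓘(ℝ, Model n) c).symm z)).compContinuousLinearMap T) h3
    exact h4
  · have h1 : ∀ j, (fiber α x).compContinuousLinearMap (opOf (C x)) ![stdVec j] =
        ∑ k, C x k j • fiber α x ![stdVec k] := fun j => by
      have h2 := comp_apply_stdVec (fiber α x) (opOf (C x)) ![j]
      have h3 : ∀ i : Fin (2 * n), (fun l => stdVec (![i] l)) = ![(stdVec i : Model n)] :=
        fun i => by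
          funext l
          fin_cases l
          rfl
      rw [sum_fin_one] at h2
      simp only [h3, opMatrix_opOf, Finset.univ_unique, Finset.prod_singleton] at h2
      exact h2
    have h2 : ∀ i k, ∑ j, (formMatrix Ω x)⁻¹ i j * C x k j = (metricMatrix g x)⁻¹ i k := by
      intro i k
      have h3 : (formMatrix Ω x)⁻¹ * (C x).transpose = (metricMatrix g x)⁻¹ := by
        have h4 : (metricMatrix g x)⁻¹.transpose = (metricMatrix g x)⁻¹ := by
          have := (metricMatrix_posDef g x).isHermitian
          rw [Matrix.IsHermitian, Matrix.conjTranspose_eq_transpose_of_trivial] at this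
          rw [Matrix.transpose_nonsing_inv, this]
        rw [hC]
        simp only [Matrix.transpose_mul, Matrix.transpose_neg]
        rw [h4, formMatrix_eq, matE_transpose, neg_neg, ← formMatrix_eq, ← Matrix.mul_assoc,
          Matrix.nonsing_inv_mul _ (hg.isUnit_det x), Matrix.one_mul]
      rw [← h3, Matrix.mul_apply]
      rfl
    rw [poissonPair, innerE_one, formInner_eq, innerE_one]
    refine Finset.sum_congr rfl fun i _ => ?_
    have h5 : ∀ j, fiber (fun x => (fiber α x).compContinuousLinearMap (opOf (C x)) :
        DForm (Model n) M 1 V) x ![stdVec j] = ∑ k, C x k j • fiber α x ![stdVec k] := h1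
    simp only [h5, map_sum, map_smul, smul_eq_mul, Finset.mul_sum, ← h2, Finset.sum_mul]
    rw [Finset.sum_comm]
    exact Finset.sum_congr rfl fun j _ => Finset.sum_congr rfl fun k _ => by ring

/-- The `L²` norm of smooth `1`-forms is definite. -/
theorem eq_zero_of_integral_formInner {g : RiemMetric n M}
    {κ : LinearMap.BilinForm ℝ V} (hκ : ∀ ξ, ξ ≠ 0 → 0 < κ ξ ξ) {α : DForm (Model n) M 1 V}
    (hα : SmoothForm α) (h : ∫ x, formInner g κ α α x ∂(riemannianVolume g) = 0) : α = 0 := by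
  have hc : Continuous (formInner g κ α α) := (contMDiff_formInner g κ hα hα).continuous
  have hpos : ∀ x, 0 ≤ formInner g κ α α x ∧ (formInner g κ α α x = 0 → fiber α x = 0) :=
    fun x => innerE_one_self (metricMatrix_posDef g x) hκ (fiber α x)
  rw [integral_eq_zero_iff_of_nonneg (fun x => (hpos x).1) (integrable_of_continuous g hc),
    Continuous.ae_eq_iff_eq _ hc continuous_zero] at h
  funext x
  exact (hpos x).2 (congrFun h x)

/-- A smooth function `h` is `L²`-orthogonal to all `Λ dη` only if it is locally constant: for a
suitable `η`, the integral is `‖dh‖²`. -/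
theorem dFun_eq_zero_of_integral_eq_zero {Ω : DForm (Model n) M 2 ℝ}
    (hΩ : IsSymplectic Ω) {g : RiemMetric n M} (hg : Compatible Ω g)
    {κ : LinearMap.BilinForm ℝ V} (hκ : ∀ ξ, ξ ≠ 0 → 0 < κ ξ ξ) {h : M → V}
    (hh : ContMDiff 𝓘(ℝ, Model n) 𝓘(ℝ, V) ∞ h)
    (hint : ∀ η : DForm (Model n) M 1 V, SmoothForm η →
      ∫ x, κ (h x) (dualLefschetz Ω (extD η) x) ∂(riemannianVolume g) = 0) :
    dFun (E := Model n) h = 0 := by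
  obtain ⟨η, hη, hη'⟩ := exists_poissonPair_eq_formInner hΩ.smooth hg κ (smoothForm_dFun hh)
  have h1 := hint η hη
  rw [integral_bilin_dualLefschetz hΩ hg κ hh hη, funext hη'] at h1
  exact eq_zero_of_integral_formInner hκ (smoothForm_dFun hh) h1

/-- Locally constant functions are orthogonal to all `Λ dη`. -/
theorem integral_eq_zero_of_dFun_eq_zero {Ω : DForm (Model n) M 2 ℝ}
    (hΩ : IsSymplectic Ω) {g : RiemMetric n M} (hg : Compatible Ω g)
    (κ : LinearMap.BilinForm ℝ V) {h : M → V} (hh : ContMDiff 𝓘(ℝ, Model n) 𝓘(ℝ, V) ∞ h)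
    (h0 : dFun (E := Model n) h = 0) {η : DForm (Model n) M 1 V} (hη : SmoothForm η) :
    ∫ x, κ (h x) (dualLefschetz Ω (extD η) x) ∂(riemannianVolume g) = 0 := by
  rw [integral_bilin_dualLefschetz hΩ hg κ hh hη]
  refine integral_eq_zero_of_ae (Filter.Eventually.of_forall fun x => ?_)
  have h1 : fiber (dFun (E := Model n) h) x = 0 := by rw [h0]; rfl
  rw [poissonPair, innerE_one, h1]
  simp

end IntegrationByParts

/-! ### First variations -/

section Variations

variable {n : ℕ} {M : Type*} [TopologicalSpace M] [ChartedSpace (Model n) M]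
  [IsManifold 𝓘(ℝ, Model n) ∞ M] {V : Type*} [NormedAddCommGroup V] [NormedSpace ℝ V]
  {Ω : DForm (Model n) M 2 ℝ} {g : RiemMetric n M} {κ : LinearMap.BilinForm ℝ V}

/-- The relation `Λ α = n Φ`. It also holds for `n = 0`, where both sides vanish. -/
theorem dualLefschetz_eq_smul_lefschetzCoeff (Ω : DForm (Model n) M 2 ℝ)
    (α : DForm (Model n) M 2 V) (x : M) :
    dualLefschetz Ω α x = (n : ℝ) • lefschetzCoeff Ω α x := by
  rcases Nat.eq_zero_or_pos n with rfl | hn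
  · simp [dualLefschetz]
  · rw [lefschetzCoeff, smul_inv_smul₀ (Nat.cast_ne_zero.2 hn.ne')]

theorem mulFun_add_smul {k : ℕ} (Ω : DForm (Model n) M k ℝ) (B b : M → V) (t : ℝ) :
    mulFun Ω (B + t • b) = mulFun Ω B + t • mulFun Ω b := by
  funext x
  refine ContinuousAlternatingMap.ext fun v => ?_
  change Ω x v • (B x + t • b x) = Ω x v • B x + t • (Ω x v • b x)
  rw [smul_add, smul_comm]

theorem mulFun_zero {k : ℕ} (Ω : DForm (Model n) M k ℝ) : mulFun Ω (0 : M → V) = 0 := by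
  funext x
  refine ContinuousAlternatingMap.ext fun v => ?_
  change Ω x v • (0 : V) = 0
  rw [smul_zero]

theorem dFun_zero : dFun (E := Model n) (0 : M → V) = 0 :=
  dform_ext fun x v => tderiv_const x (0 : V) (v 0)

theorem dFun_add_smul {B b : M → V} (hB : ContMDiff 𝓘(ℝ, Model n) 𝓘(ℝ, V) ∞ B)
    (hb : ContMDiff 𝓘(ℝ, Model n) 𝓘(ℝ, V) ∞ b) (t : ℝ) :
    dFun (E := Model n) (B + t • b) = dFun B + t • dFun b := by
  funext x
  have h1 : MDifferentiableAt 𝓘(ℝ, Model n) 𝓘(ℝ, V) B x :=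
    hB.contMDiffAt.mdifferentiableAt (by simp)
  have h2 : MDifferentiableAt 𝓘(ℝ, Model n) 𝓘(ℝ, V) b x :=
    hb.contMDiffAt.mdifferentiableAt (by simp)
  refine ContinuousAlternatingMap.ext fun v => ?_
  exact congrArg (fun L : Model n →L[ℝ] V => L (v 0))
    (h1.hasMFDerivAt.add (h2.hasMFDerivAt.const_smul t)).mfderiv

theorem primitivePart_add_smul (Ω : DForm (Model n) M 2 ℝ) (α β : DForm (Model n) M 2 V) (t : ℝ) :
    primitivePart Ω (α + t • β) = primitivePart Ω α + t • primitivePart Ω β := by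
  have h : lefschetzCoeff Ω (α + t • β) = lefschetzCoeff Ω α + t • lefschetzCoeff Ω β := by
    funext x
    simp only [lefschetzCoeff, dualLefschetz_add, dualLefschetz_smul, Pi.add_apply, Pi.smul_apply,
      smul_add]
    rw [smul_comm]
  rw [primitivePart, primitivePart, primitivePart, h, mulFun_add_smul, smul_sub]
  abel

theorem formInner_add_right (g : RiemMetric n M) (hκ : ∀ ξ ζ, κ ξ ζ = κ ζ ξ) {k : ℕ}
    (α β β' : DForm (Model n) M k V) (x : M) :
    formInner g κ α (β + β') x = formInner g κ α β x + formInner g κ α β' x := by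
  rw [formInner_comm g hκ, formInner_add_left, formInner_comm g hκ β, formInner_comm g hκ β']

theorem formInner_smul_right (g : RiemMetric n M) (hκ : ∀ ξ ζ, κ ξ ζ = κ ζ ξ) {k : ℕ}
    (a : ℝ) (α β : DForm (Model n) M k V) (x : M) :
    formInner g κ α (a • β) x = a * formInner g κ α β x := by
  rw [formInner_comm g hκ, formInner_smul_left, formInner_comm g hκ β]

/-- The Lefschetz decomposition is orthogonal: the inner product of the primitive parts is
`⟨α, β⟩ - κ(Φ, Λ β)`, where `Φ` is the coefficient of `α`. -/
theorem formInner_primitivePart (hg : Compatible Ω g) (hκ : ∀ ξ ζ, κ ξ ζ = κ ζ ξ)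
    (α β : DForm (Model n) M 2 V) (x : M) :
    formInner g κ (primitivePart Ω α) (primitivePart Ω β) x =
      formInner g κ α β x - κ (lefschetzCoeff Ω α x) (dualLefschetz Ω β x) := by
  have h : ∀ γ : DForm (Model n) M 2 V,
      primitivePart Ω γ = γ + (-1 : ℝ) • mulFun Ω (lefschetzCoeff Ω γ) := fun γ => by
    rw [primitivePart, neg_one_smul, sub_eq_add_neg]
  rw [h α, h β, formInner_add_left, formInner_add_right g hκ, formInner_smul_left,
    formInner_smul_right g hκ, formInner_add_right g hκ, formInner_smul_right g hκ,
    formInner_comm g hκ α (mulFun Ω _), formInner_mulFun hg, formInner_mulFun hg,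
    formInner_mulFun hg, dualLefschetz_mulFun hg, dualLefschetz_eq_smul_lefschetzCoeff Ω α,
    map_smul, map_smul, hκ (lefschetzCoeff Ω β x)]
  simp only [smul_eq_mul]
  ring

variable [MeasurableSpace M] [BorelSpace M] [T2Space M] [CompactSpace M] [FiniteDimensional ℝ V]

theorem integrable_formInner (g : RiemMetric n M) (κ : LinearMap.BilinForm ℝ V) {k : ℕ}
    {α β : DForm (Model n) M k V} (hα : SmoothForm α) (hβ : SmoothForm β) :
    Integrable (formInner g κ α β) (riemannianVolume g) :=
  integrable_of_continuous g (contMDiff_formInner g κ hα hβ).continuous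

/-- The first variation of the squared `L²` norm. -/
theorem hasDerivAt_normSq (g : RiemMetric n M) (hκ : ∀ ξ ζ, κ ξ ζ = κ ζ ξ) {k : ℕ}
    {α β : DForm (Model n) M k V} (hα : SmoothForm α) (hβ : SmoothForm β) :
    HasDerivAt (fun t : ℝ => normSq g κ (α + t • β))
      (2 * ∫ x, formInner g κ α β x ∂(riemannianVolume g)) 0 := by
  have h : (fun t : ℝ => normSq g κ (α + t • β)) = fun t =>
      normSq g κ α + t * (2 * ∫ x, formInner g κ α β x ∂(riemannianVolume g)) +
        t ^ 2 * normSq g κ β := by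
    funext t
    have h1 : ∀ x, formInner g κ (α + t • β) (α + t • β) x =
        formInner g κ α α x + (2 * t) * formInner g κ α β x + t ^ 2 * formInner g κ β β x :=
      fun x => by
        rw [formInner_add_left, formInner_add_right g hκ, formInner_add_right g hκ,
          formInner_smul_left, formInner_smul_left, formInner_smul_right g hκ,
          formInner_smul_right g hκ, formInner_comm g hκ β α]
        ring
    rw [normSq, funext h1, integral_add, integral_add, integral_const_mul, integral_const_mul,
      normSq, normSq]
    · ring
    · exact integrable_formInner g κ hα hα
    · exact (integrable_formInner g κ hα hβ).const_mul _
    · exact (integrable_formInner g κ hα hα).add ((integrable_formInner g κ hα hβ).const_mul _)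
    · exact (integrable_formInner g κ hβ hβ).const_mul _
  rw [h]
  have h1 := (((hasDerivAt_id (0 : ℝ)).mul_const
    (2 * ∫ x, formInner g κ α β x ∂(riemannianVolume g))).const_add (normSq g κ α)).add
    (((hasDerivAt_id (0 : ℝ)).pow 2).mul_const (normSq g κ β))
  exact h1.congr_deriv (by simp)

theorem contMDiff_lefschetzCoeff (hΩ : SmoothForm Ω) (hg : Compatible Ω g)
    {α : DForm (Model n) M 2 V} (hα : SmoothForm α) :
    ContMDiff 𝓘(ℝ, Model n) 𝓘(ℝ, V) ∞ (lefschetzCoeff Ω α) :=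
  (contMDiff_const (I' := 𝓘(ℝ, ℝ)) (c := (n : ℝ)⁻¹)).smul (contMDiff_dualLefschetz hΩ hg hα)

theorem smoothForm_primitivePart (hΩ : SmoothForm Ω) (hg : Compatible Ω g)
    {α : DForm (Model n) M 2 V} (hα : SmoothForm α) : SmoothForm (primitivePart Ω α) := by
  have h : primitivePart Ω α = α + (-1 : ℝ) • mulFun Ω (lefschetzCoeff Ω α) := by
    rw [primitivePart, neg_one_smul, sub_eq_add_neg]
  rw [h]
  exact hα.add ((hΩ.mulFun (contMDiff_lefschetzCoeff hΩ hg hα)).const_smul _)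

end Variations

/-! ### The weak form of the equations -/

section CriticalPoints

variable {n : ℕ} {M : Type*} [TopologicalSpace M] [T2Space M] [CompactSpace M]
  [ChartedSpace (Model n) M] [IsManifold 𝓘(ℝ, Model n) ∞ M] [MeasurableSpace M] [BorelSpace M]
  {Ω : DForm (Model n) M 2 ℝ} {g : RiemMetric n M}
  {EG : Type*} [NormedAddCommGroup EG] [NormedSpace ℝ EG] [FiniteDimensional ℝ EG]
  {G : Type*} [TopologicalSpace G] [ChartedSpace EG G] [CommGroup G] [LieGroup 𝓘(ℝ, EG) ∞ G]
  {κ : LinearMap.BilinForm ℝ EG}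
  {EP : Type*} [NormedAddCommGroup EP] [NormedSpace ℝ EP] [FiniteDimensional ℝ EP]
  {P : Type*} [TopologicalSpace P] [ChartedSpace EP P] [IsManifold 𝓘(ℝ, EP) ∞ P]
  [MulAction (MulOpposite G) P] {pr : P → M} {A : DForm EP P 1 EG}

/-- The Yang-Mills equation, in weak form. -/
theorem isYangMills_iff (hκ : ∀ ξ ζ, κ ξ ζ = κ ζ ξ) (hpr : IsPrincipalBundle (Model n) EG G EP pr)
    (hA : IsConnection EG G A) :
    IsYangMills G g κ pr A ↔ ∀ η : DForm (Model n) M 1 EG, SmoothForm η →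
      ∫ x, formInner g κ (curvature G pr A) (extD η) x ∂(riemannianVolume g) = 0 := by
  have : CompleteSpace EG := FiniteDimensional.complete ℝ EG
  refine forall_congr' fun η => forall_congr' fun hη => ?_
  have h1 := hasDerivAt_normSq g hκ (smoothForm_curvature hpr hA) hη.extD
  have h2 : (fun t : ℝ => yangMills G g κ pr (A + t • pullForm pr η)) =
      fun t => normSq g κ (curvature G pr A + t • extD η) := by
    funext t
    rw [yangMills, curvature_add_smul hpr hA hη t]
  rw [h2]
  refine ⟨fun h => by simpa using h1.unique h, fun h => by simpa [h] using h1⟩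

/-- The primitive Yang-Mills equation, in weak form. -/
theorem isPrimitiveYangMills_iff (hΩ : SmoothForm Ω) (hg : Compatible Ω g)
    (hκ : ∀ ξ ζ, κ ξ ζ = κ ζ ξ) (hpr : IsPrincipalBundle (Model n) EG G EP pr)
    (hA : IsConnection EG G A) :
    IsPrimitiveYangMills G Ω g κ pr A ↔ ∀ η : DForm (Model n) M 1 EG, SmoothForm η →
      ∫ x, formInner g κ (curvature G pr A) (extD η) x ∂(riemannianVolume g) =
        ∫ x, κ (lefschetzCoeff Ω (curvature G pr A) x) (dualLefschetz Ω (extD η) x)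
          ∂(riemannianVolume g) := by
  have : CompleteSpace EG := FiniteDimensional.complete ℝ EG
  refine forall_congr' fun η => forall_congr' fun hη => ?_
  have hF := smoothForm_curvature hpr hA
  have h1 := hasDerivAt_normSq g hκ (smoothForm_primitivePart hΩ hg hF)
    (smoothForm_primitivePart hΩ hg hη.extD)
  have h2 : (fun t : ℝ => primitiveYangMills G Ω g κ pr (A + t • pullForm pr η)) =
      fun t => normSq g κ (primitivePart Ω (curvature G pr A) + t • primitivePart Ω (extD η)) := by
    funext t
    rw [primitiveYangMills, curvature_add_smul hpr hA hη t, primitivePart_add_smul]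
  rw [funext (formInner_primitivePart hg hκ (curvature G pr A) (extD η)), integral_sub
    (integrable_formInner g κ hF hη.extD) (integrable_of_continuous g (continuous_bilin κ
      (contMDiff_lefschetzCoeff hΩ hg hF).continuous
      (contMDiff_dualLefschetz hΩ hg hη.extD).continuous))] at h1
  rw [h2, ← sub_eq_zero]
  refine ⟨fun h => by simpa using h1.unique h, fun h => by simpa [h] using h1⟩

/-- The equations of the cone Yang-Mills functional, in weak form: the first is the variation of
the connection, the second the variation of `B`. -/
theorem IsConeCritical.equations (hΩ : SmoothForm Ω) (hg : Compatible Ω g)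
    (hκ : ∀ ξ ζ, κ ξ ζ = κ ζ ξ) (hpr : IsPrincipalBundle (Model n) EG G EP pr)
    (hA : IsConnection EG G A) {B : M → EG} (hB : ContMDiff 𝓘(ℝ, Model n) 𝓘(ℝ, EG) ∞ B)
    (h : IsConeCritical G Ω g κ pr A B) :
    (∀ η : DForm (Model n) M 1 EG, SmoothForm η →
      ∫ x, formInner g κ (curvature G pr A) (extD η) x ∂(riemannianVolume g) +
        ∫ x, κ (B x) (dualLefschetz Ω (extD η) x) ∂(riemannianVolume g) = 0) ∧
    ∀ b : M → EG, ContMDiff 𝓘(ℝ, Model n) 𝓘(ℝ, EG) ∞ b →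
      n * ∫ x, κ (b x) (lefschetzCoeff Ω (curvature G pr A) x + B x) ∂(riemannianVolume g) +
        ∫ x, formInner g κ (dFun (E := Model n) B) (dFun (E := Model n) b) x
          ∂(riemannianVolume g) = 0 := by
  have : CompleteSpace EG := FiniteDimensional.complete ℝ EG
  have hF := smoothForm_curvature hpr hA
  have hFB : SmoothForm (curvature G pr A + mulFun Ω B) := hF.add (hΩ.mulFun hB)
  have key : ∀ (η : DForm (Model n) M 1 EG) (b : M → EG), SmoothForm η →
      ContMDiff 𝓘(ℝ, Model n) 𝓘(ℝ, EG) ∞ b →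
      ∫ x, formInner g κ (curvature G pr A + mulFun Ω B) (extD η + mulFun Ω b) x
        ∂(riemannianVolume g) +
      ∫ x, formInner g κ (dFun (E := Model n) B) (dFun (E := Model n) b) x
        ∂(riemannianVolume g) = 0 := by
    intro η b hη hb
    have h1 := (hasDerivAt_normSq g hκ hFB (hη.extD.add (hΩ.mulFun hb))).add
      (hasDerivAt_normSq g hκ (smoothForm_dFun hB) (smoothForm_dFun hb))
    have h2 : (fun t : ℝ => coneYangMills G Ω g κ pr (A + t • pullForm pr η) (B + t • b)) =
        (fun t : ℝ => normSq g κ (curvature G pr A + mulFun Ω B + t • (extD η + mulFun Ω b))) +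
        fun t : ℝ => normSq g κ (dFun (E := Model n) B + t • dFun (E := Model n) b) := by
      funext t
      rw [Pi.add_apply, coneYangMills, curvature_add_smul hpr hA hη t, mulFun_add_smul,
        dFun_add_smul hB hb, smul_add]
      congr 2
      abel
    have h3 := h η b hη hb
    rw [h2] at h3
    have h4 := h1.unique h3
    linarith
  refine ⟨fun η hη => ?_, fun b hb => ?_⟩
  · have h1 := key η 0 hη contMDiff_const
    rw [mulFun_zero, add_zero, dFun_zero] at h1
    have h2 : ∀ x, formInner g κ (dFun (E := Model n) B) (0 : DForm (Model n) M 1 EG) x = 0 :=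
      fun x => by simp [formInner]
    have h3 : ∀ x, formInner g κ (curvature G pr A + mulFun Ω B) (extD η) x =
        formInner g κ (curvature G pr A) (extD η) x + κ (B x) (dualLefschetz Ω (extD η) x) :=
      fun x => by rw [formInner_add_left, formInner_mulFun hg]
    rw [funext h2, funext h3, integral_zero, add_zero, integral_add
      (integrable_formInner g κ hF hη.extD) (integrable_of_continuous g
        (continuous_bilin κ hB.continuous
          (contMDiff_dualLefschetz hΩ hg hη.extD).continuous))] at h1
    exact h1
  · have h1 := key 0 b (fun c => contDiffOn_const (c := (0 : Model n [⋀^Fin 1]→L[ℝ] EG))) hb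
    have h2 : extD (0 : DForm (Model n) M 1 EG) = 0 := funext fun x => by
      have h2 := extD_smul (0 : ℝ) (0 : DForm (Model n) M 1 EG) x
      rwa [zero_smul, zero_smul] at h2
    have h3 : ∀ x, formInner g κ (curvature G pr A + mulFun Ω B) (mulFun Ω b) x =
        n * κ (b x) (lefschetzCoeff Ω (curvature G pr A) x + B x) := fun x => by
      rw [formInner_comm g hκ, formInner_mulFun hg, dualLefschetz_add, Pi.add_apply,
        dualLefschetz_mulFun hg, dualLefschetz_eq_smul_lefschetzCoeff, ← smul_add, map_smul,
        smul_eq_mul]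
    rw [h2, zero_add, funext h3, integral_const_mul] at h1
    exact h1

/-- The `L²` norm of continuous functions is definite. -/
theorem eq_zero_of_integral_bilin (hκ : ∀ ξ, ξ ≠ 0 → 0 < κ ξ ξ) {f : M → EG} (hf : Continuous f)
    (h : ∫ x, κ (f x) (f x) ∂(riemannianVolume g) = 0) : f = 0 := by
  have hc : Continuous fun x => κ (f x) (f x) := continuous_bilin κ hf hf
  have hpos : ∀ x, 0 ≤ κ (f x) (f x) := fun x => by
    by_cases h0 : f x = 0
    · simp [h0]
    · exact (hκ _ h0).le
  rw [integral_eq_zero_iff_of_nonneg hpos (integrable_of_continuous g hc),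
    Continuous.ae_eq_iff_eq _ hc continuous_zero] at h
  funext x
  by_contra h0
  exact (hκ _ h0).ne' (congrFun h x)

end CriticalPoints

end ConeYM

end

theorem mainTheorem3 {n : ℕ}
    -- a closed symplectic manifold of dimension `2 n` with a compatible metric
    {M : Type*} [TopologicalSpace M] [T2Space M] [CompactSpace M]
    [ChartedSpace (Model n) M] [IsManifold 𝓘(ℝ, Model n) ∞ M]
    [MeasurableSpace M] [BorelSpace M]
    (Ω : DForm (Model n) M 2 ℝ) (hΩ : IsSymplectic Ω)
    (g : RiemMetric n M) (hg : Compatible Ω g)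
    -- an abelian Lie group with an inner product on its Lie algebra
    {EG : Type*} [NormedAddCommGroup EG] [NormedSpace ℝ EG] [FiniteDimensional ℝ EG]
    {G : Type*} [TopologicalSpace G] [ChartedSpace EG G] [CommGroup G] [LieGroup 𝓘(ℝ, EG) ∞ G]
    (κ : LinearMap.BilinForm ℝ EG) (hκ_symm : ∀ ξ ζ, κ ξ ζ = κ ζ ξ)
    (hκ_pos : ∀ ξ, ξ ≠ 0 → 0 < κ ξ ξ)
    -- a principal bundle
    {EP : Type*} [NormedAddCommGroup EP] [NormedSpace ℝ EP] [FiniteDimensional ℝ EP]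
    {P : Type*} [TopologicalSpace P] [ChartedSpace EP P] [IsManifold 𝓘(ℝ, EP) ∞ P]
    [MulAction (MulOpposite G) P]
    (pr : P → M) (hpr : IsPrincipalBundle (Model n) EG G EP pr)
    -- a connection that is exactly one of Yang-Mills and primitive Yang-Mills
    (A : DForm EP P 1 EG) (hA : IsConnection EG G A)
    (h : (IsYangMills G g κ pr A ∧ ¬ IsPrimitiveYangMills G Ω g κ pr A) ∨
      (IsPrimitiveYangMills G Ω g κ pr A ∧ ¬ IsYangMills G g κ pr A)) :
    ¬ ∃ B : M → EG, ContMDiff 𝓘(ℝ, Model n) 𝓘(ℝ, EG) ∞ B ∧ IsConeCritical G Ω g κ pr A B := by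
  rintro ⟨B, hB, hcone⟩
  have : CompleteSpace EG := FiniteDimensional.complete ℝ EG
  obtain ⟨hvarA, hvarB⟩ := hcone.equations hΩ.smooth hg hκ_symm hpr hA hB
  have hF := smoothForm_curvature hpr hA
  have hΦ := contMDiff_lefschetzCoeff hΩ.smooth hg hF
  rw [isYangMills_iff hκ_symm hpr hA, isPrimitiveYangMills_iff hΩ.smooth hg hκ_symm hpr hA] at h
  set Φ := lefschetzCoeff Ω (curvature G pr A) with hΦ_def
  have hf : ContMDiff 𝓘(ℝ, Model n) 𝓘(ℝ, EG) ∞ (Φ + B) := hΦ.add hB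
  -- in dimension zero the form `Λ dη` vanishes, otherwise `f = Φ + B` vanishes
  have hfzero : n * ∫ x, κ ((Φ + B) x) ((Φ + B) x) ∂(riemannianVolume g) = 0 → n = 0 ∨ Φ + B = 0 :=
    fun h0 => (mul_eq_zero.1 h0).imp (fun h1 => Nat.cast_eq_zero.1 h1)
      (eq_zero_of_integral_bilin hκ_pos hf.continuous)
  have hsplit : ∀ η : DForm (Model n) M 1 EG, SmoothForm η →
      ∫ x, κ ((Φ + B) x) (dualLefschetz Ω (extD η) x) ∂(riemannianVolume g) =
        ∫ x, κ (Φ x) (dualLefschetz Ω (extD η) x) ∂(riemannianVolume g) +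
          ∫ x, κ (B x) (dualLefschetz Ω (extD η) x) ∂(riemannianVolume g) := fun η hη => by
    have hΛ := (contMDiff_dualLefschetz hΩ.smooth hg hη.extD).continuous
    rw [← MeasureTheory.integral_add
      (integrable_of_continuous g (continuous_bilin κ hΦ.continuous hΛ))
      (integrable_of_continuous g (continuous_bilin κ hB.continuous hΛ))]
    simp only [Pi.add_apply, map_add, LinearMap.add_apply]
  rcases h with ⟨hYM, hpYM⟩ | ⟨hpYM, hYM⟩
  · refine hpYM fun η hη => ?_
    have hdB : dFun (E := Model n) B = 0 := dFun_eq_zero_of_integral_eq_zero hΩ hg hκ_pos hB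
      fun η hη => by simpa [hYM η hη] using hvarA η hη
    have h1 := hvarB _ hf
    have h2 : ∀ x, formInner g κ (dFun (E := Model n) B) (dFun (E := Model n) (Φ + B)) x = 0 :=
      fun x => by simp [hdB, formInner]
    rw [funext h2, MeasureTheory.integral_zero, add_zero] at h1
    have h3 : ∫ x, κ ((Φ + B) x) (dualLefschetz Ω (extD η) x) ∂(riemannianVolume g) = 0 := by
      rcases hfzero h1 with rfl | h0
      · simp [dualLefschetz]
      · have h5 : ∀ x, (Φ + B) x = 0 := congrFun h0
        simp only [h5, map_zero, LinearMap.zero_apply, MeasureTheory.integral_zero]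
    have h4 := hsplit η hη
    have h5 := hvarA η hη
    linarith
  · refine hYM fun η hη => ?_
    have hdf : dFun (E := Model n) (Φ + B) = 0 :=
      dFun_eq_zero_of_integral_eq_zero hΩ hg hκ_pos hf fun η hη => by
        rw [hsplit η hη, ← hpYM η hη]
        exact hvarA η hη
    have h1 := hvarB _ hf
    have h2 : ∀ x, formInner g κ (dFun (E := Model n) B) (dFun (E := Model n) (Φ + B)) x = 0 :=
      fun x => by simp [hdf, formInner]
    rw [funext h2, MeasureTheory.integral_zero, add_zero] at h1
    have h3 := hvarB B hB
    have h4 : n * ∫ x, κ (B x) (Φ x + B x) ∂(riemannianVolume g) = 0 := by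
      rcases hfzero h1 with rfl | h0
      · simp
      · have h5 : ∀ x, Φ x + B x = 0 := fun x => congrFun h0 x
        simp [h5]
    rw [h4, zero_add] at h3
    have hdB := eq_zero_of_integral_formInner hκ_pos (smoothForm_dFun hB) h3
    have h6 := integral_eq_zero_of_dFun_eq_zero hΩ hg κ hB hdB hη
    have h7 := hvarA η hη
    linarith
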